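/- **Setting.** Let $U$ be a smooth (Hausdorff, second countable) manifold of dimension $m+1$ with a smooth Lorentzian metric $g$ of signature $(-,+,\dots,+)$, let $\Phi:U\to\mathbb R$ be smooth with $d\Phi\neq 0$ on $\Phi^{-1}(0)$, and let $M=\Phi^{-1}(0)$, an embedded hypersurface of dimension $m$, equipped with a metric $d$ inducing its topology ("bounded" refers to $d$). Assume that the restriction $g^M$ of $g$ to $TM$ has constant corank $k\ge 1$, and let $\mathcal N=\ker g^M\subset TM$ be the null distribution, of rank $k$. Let $V$ be a $C^2$ vector field on $M$. **Theorem 2 (dimension bound).** Suppose that 1. the equation $\dot X=V(X)$ defines a continuous semiflow $(\varphi_t)_{t\ge 0}$ on $M$ which is asymptotically compact (for every bounded sequence $(X_j)$ in $M$ and all $t_j\to\infty$, the sequence $\varphi_{t_j}(X_j)$ has a subsequence converging in $M$) and has a bounded absorbing set (a bounded set $B$ such that for every bounded $D\subset M$ there is $T_D\ge0$ with $\varphi_t(D)\subset B$ for all $t\ge T_D$); 2. $\mathcal N$ is involutive, the leaves of the foliation $\mathscr F$ tangent to $\mathcal N$ are compact embedded ($k$-dimensional) submanifolds of $M$, and the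 leaf space $M_{\mathrm{red}}=M/\mathscr F$, with the quotient topology, is Hausdorff; 3. $V$ is projectable with respect to $\mathscr F$, that is, $[V,W]$ takes values in $\mathcal N$ for every smooth section $W$ of $\mathcal N$. Then $\varphi$ has a unique global attractor $A$, i.e. there is a unique compact set $A\subset M$ with $\varphi_t(A)=A$ for all $t\ge 0$ which attracts every bounded set $D\subset M$: for every $\varepsilon>0$, $\varphi_t(D)$ lies in the $\varepsilon$-neighbourhood of $A$ for all large $t$. Let $\pi:M\to M_{\mathrm{red}}$ be the canonical projection. There is a unique continuous semiflow $\psi$ on $M_{\mathrm{red}}$ with $\psi_t\circ\pi=\pi\circ\varphi_t$ for all $t\ge0$, and the projected attractor $A_*=\pi(A)$ is a compact subset of $M_{\mathrm{red}}$ with $\psi_t(A_*)=A_*$ for all $t\ge 0$ whose (Lebesgue) covering dimension satisfies $$\dim_T(A_*)\le m-k .$$ (If $M$ is empty then so is $A_*$ and the bound is void; otherwise $k\le m$.) -/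

import Mathlib

open Set Filter Topology Bundle
open scoped Manifold ContDiff NNReal

noncomputable section

/-! ### Lorentzian ambient space, induced form and null distribution -/

/-- A smooth symmetric `(0,2)`-tensor field of Lorentzian signature `(-,+,…,+)` on an
`n`-dimensional smooth manifold `U`. -/
structure LorentzianMetric (n : ℕ) [NeZero n] (U : Type*) [TopologicalSpace U]
    [ChartedSpace (EuclideanSpace ℝ (Fin n)) U] [IsManifold (𝓡 n) ∞ U] where
  /-- The bilinear form on each tangent space. -/
  form (p : U) : TangentSpace (𝓡 n) p →L[ℝ] TangentSpace (𝓡 n) p →L[ℝ] ℝ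
  symm (p : U) (v w : TangentSpace (𝓡 n) p) : form p v w = form p w v
  /-- Every tangent space has a basis in which the form is `diag(-1, 1, …, 1)`. -/
  signature (p : U) : ∃ b : Module.Basis (Fin n) ℝ (TangentSpace (𝓡 n) p),
    ∀ i j, form p (b i) (b j) = if i = j then (if i = 0 then -1 else 1) else 0
  contMDiff : ContMDiff (𝓡 n)
    ((𝓡 n).prod 𝓘(ℝ, EuclideanSpace ℝ (Fin n) →L[ℝ] EuclideanSpace ℝ (Fin n) →L[ℝ] ℝ)) ∞
    (fun p ↦ TotalSpace.mk' (EuclideanSpace ℝ (Fin n) →L[ℝ] EuclideanSpace ℝ (Fin n) →L[ℝ] ℝ)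
      p (form p))

/-- The form induced by `g` at `x : M` along `ι : M → U`, i.e. the restriction of `g` to the
tangent space of the submanifold when `ι` is an embedding. -/
def inducedForm {n m : ℕ} [NeZero n] {U M : Type*} [TopologicalSpace U]
    [ChartedSpace (EuclideanSpace ℝ (Fin n)) U] [IsManifold (𝓡 n) ∞ U]
    [TopologicalSpace M] [ChartedSpace (EuclideanSpace ℝ (Fin m)) M]
    (g : LorentzianMetric n U) (ι : M → U) (x : M) (v w : TangentSpace (𝓡 m) x) : ℝ :=
  g.form (ι x) (mfderiv (𝓡 m) (𝓡 n) ι x v) (mfderiv (𝓡 m) (𝓡 n) ι x w)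

/-- The null distribution: the pointwise kernel of the induced form. -/
def nullDistribution {n m : ℕ} [NeZero n] {U M : Type*} [TopologicalSpace U]
    [ChartedSpace (EuclideanSpace ℝ (Fin n)) U] [IsManifold (𝓡 n) ∞ U]
    [TopologicalSpace M] [ChartedSpace (EuclideanSpace ℝ (Fin m)) M]
    (g : LorentzianMetric n U) (ι : M → U) (x : M) :
    Submodule ℝ (TangentSpace (𝓡 m) x) where
  carrier := {v | ∀ w : TangentSpace (𝓡 m) x, inducedForm g ι x v w = 0}
  add_mem' := by
    intro a b ha hb w
    have h1 := ha w
    have h2 := hb w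
    simp only [inducedForm] at h1 h2 ⊢
    rw [map_add, map_add, add_apply, h1, h2, add_zero]
  zero_mem' := by
    intro w
    simp only [inducedForm]
    rw [map_zero, map_zero, zero_apply]
  smul_mem' := by
    intro c a ha w
    have h1 := ha w
    simp only [inducedForm] at h1 ⊢
    rw [map_smul, map_smul, smul_apply, h1, smul_zero]

/-! ### Vector fields, distributions, leaves and the leaf space -/

section Foliation

variable {m : ℕ} {M : Type*} [TopologicalSpace M] [ChartedSpace (EuclideanSpace ℝ (Fin m)) M]
  [IsManifold (𝓡 m) ∞ M]

/-- `W` is a vector field of class `C^r` on `M`. -/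
def IsVectorFieldOfClass (r : WithTop ℕ∞) (W : ∀ x : M, TangentSpace (𝓡 m) x) : Prop :=
  ContMDiff (𝓡 m) (𝓡 m).tangent r (fun x ↦ (⟨x, W x⟩ : TangentBundle (𝓡 m) M))

/-- `W ∈ Γ(N)`: a smooth vector field with values in the distribution `N`. -/
def IsSmoothSection (N : ∀ x : M, Submodule ℝ (TangentSpace (𝓡 m) x))
    (W : ∀ x : M, TangentSpace (𝓡 m) x) : Prop :=
  IsVectorFieldOfClass ∞ W ∧ ∀ x, W x ∈ N x

/-- `[W₁, W₂] ∈ Γ(N)` for all `W₁, W₂ ∈ Γ(N)`. -/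
def IsInvolutive (N : ∀ x : M, Submodule ℝ (TangentSpace (𝓡 m) x)) : Prop :=
  ∀ W₁ W₂ : ∀ x : M, TangentSpace (𝓡 m) x, IsSmoothSection N W₁ → IsSmoothSection N W₂ →
    ∀ x, VectorField.mlieBracket (𝓡 m) W₁ W₂ x ∈ N x

/-- The vector field `V` is projectable with respect to `N` (it preserves the foliation tangent
to `N`): `[V, W]` takes values in `N` for every `W ∈ Γ(N)`. -/
def IsProjectable (N : ∀ x : M, Submodule ℝ (TangentSpace (𝓡 m) x))
    (V : ∀ x : M, TangentSpace (𝓡 m) x) : Prop :=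
  ∀ W : ∀ x : M, TangentSpace (𝓡 m) x, IsSmoothSection N W →
    ∀ x, VectorField.mlieBracket (𝓡 m) V W x ∈ N x

/-- `x` and `y` are the endpoints of a smooth arc that is everywhere tangent to `N`. -/
def JoinedByTangentArc (N : ∀ x : M, Submodule ℝ (TangentSpace (𝓡 m) x)) (x y : M) : Prop :=
  ∃ γ : ℝ → M, ContMDiffOn 𝓘(ℝ, ℝ) (𝓡 m) ∞ γ (Icc 0 1) ∧ γ 0 = x ∧ γ 1 = y ∧
    ∀ t ∈ Icc (0 : ℝ) 1, mfderivWithin 𝓘(ℝ, ℝ) (𝓡 m) γ (Icc 0 1) t (1 : ℝ) ∈ N (γ t)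

/-- Two points lie on the same leaf of the foliation tangent to `N` iff they are joined by a
piecewise smooth curve tangent to `N`. For an involutive distribution of constant rank the classes
are exactly the maximal connected integral manifolds of `N`. -/
def leafSetoid (N : ∀ x : M, Submodule ℝ (TangentSpace (𝓡 m) x)) : Setoid M :=
  Relation.EqvGen.setoid (JoinedByTangentArc N)

/-- The leaf through `x`. -/
def leaf (N : ∀ x : M, Submodule ℝ (TangentSpace (𝓡 m) x)) (x : M) : Set M :=
  {y | leafSetoid N x y}

/-- The leaf space `M / 𝓕` with the quotient topology. -/
abbrev LeafSpace (N : ∀ x : M, Submodule ℝ (TangentSpace (𝓡 m) x)) : Type _ :=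
  Quotient (leafSetoid N)

/-- The canonical projection onto the leaf space. -/
def leafProj (N : ∀ x : M, Submodule ℝ (TangentSpace (𝓡 m) x)) (x : M) : LeafSpace N :=
  Quotient.mk (leafSetoid N) x

/-- `S` is an embedded `k`-dimensional submanifold of `M`: around each of its points there is a
smooth chart of `M` in which `S` is a `k`-dimensional coordinate slice. -/
def IsEmbeddedSubmanifold (k : ℕ) (S : Set M) : Prop :=
  ∀ p ∈ S, ∃ e ∈ IsManifold.maximalAtlas (𝓡 m) ∞ M, p ∈ e.source ∧
    ∀ q ∈ e.source, q ∈ S ↔ ∀ i : Fin m, k ≤ (i : ℕ) → e q i = e p i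

/-- The semiflow `φ` is the evolution of `Ẋ = V(X)`: for each `x` the curve `t ↦ φ t x`, `t ≥ 0`,
is an integral curve of `V` (with the one-sided derivative at `t = 0`). -/
def IsEvolutionOf (φ : Flow ℝ≥0 M) (V : ∀ x : M, TangentSpace (𝓡 m) x) : Prop :=
  ∀ x, IsMIntegralCurveOn (I := 𝓡 m) (fun t : ℝ ↦ φ t.toNNReal x) V (Ici 0)

end Foliation

/-! ### Semiflows on metric spaces and global attractors -/

section Attractor

variable {M : Type*} [MetricSpace M]

/-- For every bounded sequence `X` and all times `t j → ∞`, the sequence `φ (t j) (X j)` has a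
convergent subsequence. -/
def IsAsymptoticallyCompact (φ : Flow ℝ≥0 M) : Prop :=
  ∀ X : ℕ → M, Bornology.IsBounded (range X) → ∀ t : ℕ → ℝ≥0, Tendsto t atTop atTop →
    ∃ (y : M) (s : ℕ → ℕ), StrictMono s ∧
      Tendsto (fun j ↦ φ (t (s j)) (X (s j))) atTop (𝓝 y)

/-- There is a bounded set that absorbs every bounded set. -/
def HasBoundedAbsorbingSet (φ : Flow ℝ≥0 M) : Prop :=
  ∃ B : Set M, Bornology.IsBounded B ∧
    ∀ D : Set M, Bornology.IsBounded D → ∃ T : ℝ≥0, ∀ t ≥ T, φ t '' D ⊆ B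

/-- `A` is a global attractor: compact, invariant (`φ_t(A) = A` for all `t ≥ 0`), and attracting
every bounded set in the Hausdorff semidistance. -/
structure IsGlobalAttractor (φ : Flow ℝ≥0 M) (A : Set M) : Prop where
  isCompact : IsCompact A
  invariant : ∀ t, φ t '' A = A
  attracts : ∀ D : Set M, Bornology.IsBounded D → ∀ ε > 0, ∃ T : ℝ≥0, ∀ t ≥ T,
    φ t '' D ⊆ Metric.thickening ε A

end Attractor

/-! ### Covering dimension -/

/-- Every finite open cover of `X` has a finite open refinement such that each point lies in at
most `d + 1` of its members. For `d = ⊥` (read as `-1`) this says that `X` is empty. -/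
def CoveringDimLE (X : Type*) [TopologicalSpace X] (d : WithBot ℕ∞) : Prop :=
  ∀ 𝒰 : Set (Set X), 𝒰.Finite → (∀ O ∈ 𝒰, IsOpen O) → ⋃₀ 𝒰 = univ →
    ∃ 𝒱 : Set (Set X), 𝒱.Finite ∧ (∀ O ∈ 𝒱, IsOpen O) ∧ ⋃₀ 𝒱 = univ ∧
      (∀ O ∈ 𝒱, ∃ O' ∈ 𝒰, O ⊆ O') ∧
      ∀ x, (({O ∈ 𝒱 | x ∈ O}.encard : ℕ∞) : WithBot ℕ∞) ≤ d + 1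

/-- The Lebesgue covering dimension (`⊥` for the empty space, `⊤` if infinite). -/
def coveringDim (X : Type*) [TopologicalSpace X] : WithBot ℕ∞ :=
  sInf {d | CoveringDimLE X d}

/-!
The attractor is the `ω`-limit set of the absorbing set. The null distribution is totally isotropic
and hence at most one-dimensional, so only `k = 1` occurs. In a chart a projectable field `V`
satisfies `[V, w] ∈ ℝ w` for a vector field `w` spanning the null line; a Gronwall estimate for the
component of the difference of two orbits transverse to `w` shows that the semiflow maps null curves
to null curves, and so descends to the leaf space.

For the dimension bound, continuous functions on the compact Hausdorff space `A_*` are built as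
suprema over the leaves of functions supported in flow boxes. The supremum over the leaf of `y` is
attained at the image of `y` under one of countably many Lipschitz holonomy relations between
transversals of dimension `m - 1`, so a finite family of such functions has an image of Hausdorff
dimension at most `m - 1`. After a generic rescaling of the coordinates of such an image, comparing
each of them with the `(m + 1)`-st largest one gives the required refinement of a given cover.
-/

/-! ### Global attractors and semiflows on quotients -/

section GlobalAttractor

variable {M : Type*} [MetricSpace M] {φ : Flow ℝ≥0 M} {B : Set M}

theorem mem_omegaLimit_of_tendsto {t : ℕ → ℝ≥0} {b : ℕ → M} {y : M}
    (ht : Tendsto t atTop atTop) (hb : ∀ n, b n ∈ B)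
    (hy : Tendsto (fun n ↦ φ (t n) (b n)) atTop (𝓝 y)) : y ∈ omegaLimit atTop φ B := by
  rw [mem_omegaLimit_iff_frequently]
  exact fun O hO ↦ ht.frequently ((hy.eventually hO).mono fun n hn ↦ ⟨b n, hb n, hn⟩).frequently

theorem exists_dist_lt_of_mem_omegaLimit {y : M} (hy : y ∈ omegaLimit atTop φ B) (T : ℝ≥0) {ε : ℝ}
    (hε : 0 < ε) : ∃ t ≥ T, ∃ b ∈ B, dist (φ t b) y < ε := by
  rw [mem_omegaLimit_iff_frequently] at hy
  obtain ⟨t, hT, b, hb, h⟩ := frequently_atTop.1 (hy _ (Metric.ball_mem_nhds y hε)) T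
  exact ⟨t, hT, b, hb, h⟩

theorem tendsto_atTop_of_natCast_le {t : ℕ → ℝ≥0} (h : ∀ n : ℕ, (n : ℝ≥0) ≤ t n) :
    Tendsto t atTop atTop :=
  tendsto_atTop_mono h tendsto_natCast_atTop_atTop

theorem tendsto_atTop_tsub_const {t : ℕ → ℝ≥0} (h : Tendsto t atTop atTop) (T : ℝ≥0) :
    Tendsto (fun n ↦ t n - T) atTop atTop :=
  tendsto_atTop.2 fun c ↦ (h.eventually_ge_atTop (c + T)).mono fun _ ↦ le_tsub_of_add_le_right

theorem exists_tendsto_of_mem_omegaLimit {y : M} (hy : y ∈ omegaLimit atTop φ B) :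
    ∃ (t : ℕ → ℝ≥0) (b : ℕ → M), Tendsto t atTop atTop ∧ (∀ n, b n ∈ B) ∧
      Tendsto (fun n ↦ φ (t n) (b n)) atTop (𝓝 y) := by
  choose t ht b hb h using fun n : ℕ ↦
    exists_dist_lt_of_mem_omegaLimit hy n (Nat.one_div_pos_of_nat (n := n))
  refine ⟨t, b, tendsto_atTop_of_natCast_le ht, hb, tendsto_iff_dist_tendsto_zero.2 ?_⟩
  exact squeeze_zero (fun _ ↦ dist_nonneg) (fun n ↦ (h n).le)
    tendsto_one_div_add_atTop_nhds_zero_nat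

theorem IsAsymptoticallyCompact.isCompact_omegaLimit (hac : IsAsymptoticallyCompact φ)
    (hB : Bornology.IsBounded B) : IsCompact (omegaLimit atTop φ B) := by
  rw [isCompact_iff_isSeqCompact]
  intro y hy
  choose t ht b hb h using fun n : ℕ ↦
    exists_dist_lt_of_mem_omegaLimit (hy n) n (Nat.one_div_pos_of_nat (n := n))
  have ht_top := tendsto_atTop_of_natCast_le ht
  obtain ⟨z, s, hs, hz⟩ := hac b (hB.subset (range_subset_iff.2 hb)) t ht_top
  refine ⟨z, mem_omegaLimit_of_tendsto (ht_top.comp hs.tendsto_atTop) (fun n ↦ hb (s n)) hz, s,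
    hs, (tendsto_iff_of_dist ?_).1 hz⟩
  exact squeeze_zero (fun _ ↦ dist_nonneg) (fun n ↦ (h (s n)).le)
    (tendsto_one_div_add_atTop_nhds_zero_nat.comp hs.tendsto_atTop)

theorem image_omegaLimit_subset (t : ℝ≥0) :
    φ t '' omegaLimit atTop φ B ⊆ omegaLimit atTop φ B :=
  (Flow.isInvariant_omegaLimit atTop φ B (fun _ ↦
    tendsto_atTop_mono (fun _ ↦ le_add_self) tendsto_id) t).image_subset

theorem IsAsymptoticallyCompact.omegaLimit_subset_image (hac : IsAsymptoticallyCompact φ)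
    (hB : Bornology.IsBounded B) (t : ℝ≥0) :
    omegaLimit atTop φ B ⊆ φ t '' omegaLimit atTop φ B := by
  intro y hy
  obtain ⟨u, b, hu, hb, h⟩ := exists_tendsto_of_mem_omegaLimit hy
  have hut := tendsto_atTop_tsub_const hu t
  obtain ⟨z, s, hs, hz⟩ := hac b (hB.subset (range_subset_iff.2 hb)) _ hut
  refine ⟨z, mem_omegaLimit_of_tendsto (hut.comp hs.tendsto_atTop) (fun n ↦ hb (s n)) hz, ?_⟩
  refine tendsto_nhds_unique (((φ.continuous_toFun t).tendsto z).comp hz)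
    ((h.comp hs.tendsto_atTop).congr' ?_)
  filter_upwards [(hu.comp hs.tendsto_atTop).eventually_ge_atTop t] with n hn
  simp only [Function.comp_apply] at hn ⊢
  rw [← φ.map_add, add_tsub_cancel_of_le hn]

theorem IsAsymptoticallyCompact.exists_attraction_time (hac : IsAsymptoticallyCompact φ)
    {D : Set M} (hD : Bornology.IsBounded D) {T : ℝ≥0} (hT : φ T '' D ⊆ B) {ε : ℝ} (hε : 0 < ε) :
    ∃ S : ℝ≥0, ∀ t ≥ S, φ t '' D ⊆ Metric.thickening ε (omegaLimit atTop φ B) := by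
  by_contra! hcon
  simp only [not_subset, exists_mem_image] at hcon
  choose t ht x hx h using fun n : ℕ ↦ hcon n
  have ht_top := tendsto_atTop_of_natCast_le ht
  obtain ⟨y, s, hs, hy⟩ := hac x (hD.subset (range_subset_iff.2 hx)) t ht_top
  have hts := ht_top.comp hs.tendsto_atTop
  have hyB : y ∈ omegaLimit atTop φ B := by
    refine mem_omegaLimit_of_tendsto (b := fun n ↦ φ T (x (s n)))
      (tendsto_atTop_tsub_const hts T) (fun n ↦ hT ⟨_, hx _, rfl⟩) (hy.congr' ?_)
    filter_upwards [hts.eventually_ge_atTop T] with n hn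
    rw [← φ.map_add, tsub_add_cancel_of_le hn, Function.comp_apply]
  obtain ⟨n, hn⟩ := (hy.eventually (Metric.isOpen_thickening.mem_nhds
    (Metric.self_subset_thickening hε _ hyB))).exists
  exact h (s n) hn

theorem exists_isGlobalAttractor (hac : IsAsymptoticallyCompact φ)
    (habs : HasBoundedAbsorbingSet φ) : ∃ A, IsGlobalAttractor φ A := by
  obtain ⟨B, hB, habsorb⟩ := habs
  refine ⟨omegaLimit atTop φ B, hac.isCompact_omegaLimit hB,
    fun t ↦ (image_omegaLimit_subset t).antisymm (hac.omegaLimit_subset_image hB t),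
    fun D hD ε hε ↦ ?_⟩
  obtain ⟨T, hT⟩ := habsorb D hD
  exact hac.exists_attraction_time hD (hT T le_rfl) hε

theorem IsGlobalAttractor.subset {A A' : Set M} (hA : IsGlobalAttractor φ A)
    (hA' : IsGlobalAttractor φ A') : A' ⊆ A := by
  rw [← hA.isCompact.isClosed.closure_eq, Metric.closure_eq_iInter_thickening]
  refine subset_iInter₂ fun ε hε ↦ ?_
  obtain ⟨T, hT⟩ := hA.attracts A' hA'.isCompact.isBounded ε hε
  exact (hA'.invariant T).symm.subset.trans (hT T le_rfl)

theorem IsGlobalAttractor.eq {A A' : Set M} (hA : IsGlobalAttractor φ A)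
    (hA' : IsGlobalAttractor φ A') : A' = A :=
  (hA.subset hA').antisymm (hA'.subset hA)

end GlobalAttractor

section QuotientFlow

variable {M : Type*} [TopologicalSpace M]

/-- The semiflow induced on a quotient by a semiflow that respects the equivalence relation. -/
def quotientFlow (φ : Flow ℝ≥0 M) (r : Setoid M) (h : ∀ t x y, r x y → r (φ t x) (φ t y)) :
    Flow ℝ≥0 (Quotient r) where
  toFun t := Quotient.map (φ t) (h t)
  cont' := isQuotientMap_quotient_mk'.continuous_lift_prod_right (f := Quotient.mk r)
    (continuous_quotient_mk'.comp φ.cont')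
  map_add' t₁ t₂ := Quotient.ind fun x ↦ congrArg (Quotient.mk r) (φ.map_add t₁ t₂ x)
  map_zero' := Quotient.ind fun x ↦ congrArg (Quotient.mk r) (φ.map_zero_apply x)

theorem isSemiconjugacy_quotientFlow (φ : Flow ℝ≥0 M) (r : Setoid M)
    (h : ∀ t x y, r x y → r (φ t x) (φ t y)) :
    Flow.IsSemiconjugacy (Quotient.mk r) φ (quotientFlow φ r h) :=
  ⟨continuous_quotient_mk', Quotient.mk_surjective, fun _ _ ↦ rfl⟩

theorem existsUnique_isSemiconjugacy_quotient (φ : Flow ℝ≥0 M) (r : Setoid M)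
    (h : ∀ t x y, r x y → r (φ t x) (φ t y)) :
    ∃! ψ : Flow ℝ≥0 (Quotient r), Flow.IsSemiconjugacy (Quotient.mk r) φ ψ := by
  refine ⟨quotientFlow φ r h, isSemiconjugacy_quotientFlow φ r h, fun ψ hψ ↦ Flow.ext fun t ξ ↦ ?_⟩
  obtain ⟨x, rfl⟩ := Quotient.mk_surjective ξ
  rw [← hψ.semiconj t x, ← (isSemiconjugacy_quotientFlow φ r h).semiconj t x]

theorem image_image_eq_of_isSemiconjugacy {X : Type*} [TopologicalSpace X] {q : M → X}
    {φ : Flow ℝ≥0 M} {ψ : Flow ℝ≥0 X} (h : Flow.IsSemiconjugacy q φ ψ) {A : Set M} {t : ℝ≥0}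
    (hA : φ t '' A = A) : ψ t '' (q '' A) = q '' A := by
  rw [← (h.semiconj t).set_image A, hA]

end QuotientFlow

/-! ### Covering dimension and Hausdorff dimension -/

section CoveringDimension

open MeasureTheory

theorem ae_comp_linearMap_notMem_of_dimH_lt {ι κ : Type*} [Fintype ι] [Fintype κ]
    {L : (ι → ℝ) →ₗ[ℝ] (κ → ℝ)} (hL : Function.Surjective L) {Z : Set (κ → ℝ)}
    (hZ : dimH Z < Fintype.card κ) : ∀ᵐ a, L a ∉ Z := by
  have hnull : volume Z = 0 := by
    rw [← hausdorffMeasure_pi_real]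
    exact hausdorffMeasure_of_dimH_lt (d := Fintype.card κ) (by exact_mod_cast hZ)
  have hae : ∀ᵐ z, z ∈ (toMeasurable volume Z)ᶜ :=
    compl_mem_ae_iff.2 ((measure_toMeasurable Z).trans hnull)
  refine ((ae_comp_linearMap_mem_iff L volume volume hL
    (measurableSet_toMeasurable volume Z).compl).2 hae).mono fun a ha haZ ↦ ?_
  exact ha (subset_toMeasurable volume Z haZ)

open Finset in
-- In logarithmic coordinates the condition is that the differences `a i - a i₀` avoid a set of
-- dimension at most `n` in a space of dimension at least `n + 1`.
theorem ae_forall_mul_exp_ne {ι : Type*} [Fintype ι] {K : Set (ι → ℝ)} {n : ℕ} (hK : dimH K ≤ n)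
    {S : Finset ι} (hS : n + 2 ≤ #S) :
    ∀ᵐ a : ι → ℝ, ∀ y ∈ K, ∀ c > 0, ¬ ∀ i ∈ S, y i * Real.exp (a i) = c := by
  classical
  obtain ⟨i₀, hi₀⟩ : S.Nonempty := card_pos.1 (by lia)
  let L : (ι → ℝ) →ₗ[ℝ] (↥(S.erase i₀) → ℝ) :=
    LinearMap.pi fun i ↦ (LinearMap.proj i.1 : (ι → ℝ) →ₗ[ℝ] ℝ) - LinearMap.proj i₀
  have hL : Function.Surjective L := fun z ↦
    ⟨fun i ↦ if h : i ∈ S.erase i₀ then z ⟨i, h⟩ else 0, funext fun i ↦ by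
      simp [L, -mem_erase, i.2, notMem_erase i₀ S]⟩
  let P : Set (ι → ℝ) := {y | ∀ i ∈ S, 0 < y i}
  have hP : Convex ℝ P := fun y hy z hz s t hs ht hst i hi ↦
    convex_Ioi (𝕜 := ℝ) (0 : ℝ) (hy i hi) (hz i hi) hs ht hst
  let f : (ι → ℝ) → (↥(S.erase i₀) → ℝ) := fun y i ↦ Real.log (y i₀) - Real.log (y i)
  have hf : ContDiffOn ℝ 1 f P := contDiffOn_pi.2 fun i ↦
    (ContDiffOn.log (by fun_prop) fun y hy ↦ (hy i₀ hi₀).ne').sub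
      (ContDiffOn.log (by fun_prop) fun y hy ↦ (hy i (mem_of_mem_erase i.2)).ne')
  have hdim : dimH (f '' (K ∩ P)) < Fintype.card ↥(S.erase i₀) := by
    refine ((hf.dimH_image_le hP inter_subset_right).trans
      ((dimH_mono inter_subset_left).trans hK)).trans_lt ?_
    rw [Fintype.card_coe, card_erase_of_mem hi₀]
    exact_mod_cast (by lia : n < #S - 1)
  filter_upwards [ae_comp_linearMap_notMem_of_dimH_lt hL hdim] with a ha y hy c hc h
  have hpos : y ∈ P := fun i hi ↦
    pos_of_mul_pos_left ((h i hi).symm ▸ hc) (Real.exp_pos _).le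
  have hlog : ∀ i ∈ S, Real.log (y i) + a i = Real.log c := fun i hi ↦ by
    rw [← h i hi, Real.log_mul (hpos i hi).ne' (Real.exp_pos _).ne', Real.log_exp]
  refine ha ⟨y, ⟨hy, hpos⟩, funext fun i ↦ ?_⟩
  have hi := hlog i (mem_of_mem_erase i.2)
  simp only [f, L, LinearMap.pi_apply, LinearMap.sub_apply, LinearMap.proj_apply]
  linarith [hlog i₀ hi₀]

theorem exists_generic_weights {ι : Type*} [Fintype ι] {K : Set (ι → ℝ)} {n : ℕ}
    (hK : dimH K ≤ n) : ∃ w : ι → ℝ, (∀ i, 0 < w i) ∧ ∀ S : Finset ι, S.card = n + 2 →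
      ∀ y ∈ K, ∀ c > 0, ¬ ∀ i ∈ S, y i * w i = c := by
  have hae : ∀ᵐ a : ι → ℝ, ∀ S : {S : Finset ι // S.card = n + 2}, ∀ y ∈ K, ∀ c > 0,
      ¬ ∀ i ∈ S.1, y i * Real.exp (a i) = c :=
    ae_all_iff.2 fun S ↦ ae_forall_mul_exp_ne hK S.2.ge
  obtain ⟨a, ha⟩ := hae.exists
  exact ⟨fun i ↦ Real.exp (a i), fun i ↦ Real.exp_pos _, fun S hS ↦ ha ⟨S, hS⟩⟩

/-- The `k`-th largest coordinate of `y`, counted with multiplicity. If `y` has fewer than `k`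
coordinates, this is the supremum of the empty family, i.e. `0`. -/
noncomputable def kthLargest {ι : Type*} (k : ℕ) (y : ι → ℝ) : ℝ :=
  ⨆ S : {S : Finset ι // S.card = k}, ⨅ i : S.1, y i

section KthLargest

variable {ι : Type*} {k : ℕ} {y : ι → ℝ}

theorem kthLargest_nonneg (hy : ∀ i, 0 ≤ y i) : 0 ≤ kthLargest k y :=
  Real.iSup_nonneg fun _ ↦ Real.iInf_nonneg fun i ↦ hy i

theorem iInf_le_kthLargest [Finite ι] (y : ι → ℝ) {S : Finset ι} (hS : S.card = k) :
    ⨅ i : S, y i ≤ kthLargest k y :=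
  le_ciSup (f := fun S : {S : Finset ι // S.card = k} ↦ ⨅ i : S.1, y i)
    (finite_range _).bddAbove ⟨S, hS⟩

theorem lipschitzWith_kthLargest [Fintype ι] : LipschitzWith 1 (kthLargest (ι := ι) k) := by
  refine LipschitzWith.of_le_add fun y z ↦ ?_
  rcases isEmpty_or_nonempty {S : Finset ι // S.card = k} with h | h
  · simp [kthLargest, dist_nonneg]
  refine ciSup_le fun S ↦ (sub_le_iff_le_add.1 ?_).trans
    (add_le_add_left (iInf_le_kthLargest z S.2) _)
  rcases isEmpty_or_nonempty S.1 with hS | hS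
  · simp
  refine le_ciInf fun i ↦ ?_
  have hi : ⨅ j : S.1, y j ≤ y i := ciInf_le (finite_range _).bddBelow i
  have hyz : y i - z i ≤ dist y z := (le_abs_self _).trans (dist_le_pi_dist y z i)
  linarith

theorem ncard_kthLargest_lt_apply_lt [Finite ι] (hk : k ≠ 0) (y : ι → ℝ) :
    {i | kthLargest k y < y i}.ncard < k := by
  by_contra! hcard
  obtain ⟨T, hT, hTk⟩ := exists_subset_card_eq hcard
  lift T to Finset ι using toFinite T
  rw [ncard_coe_finset] at hTk
  have : Nonempty T := (Finset.card_pos.1 (by lia)).to_subtype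
  obtain ⟨i, hi⟩ := exists_eq_ciInf_of_finite (f := fun i : T ↦ y i)
  exact (hi.trans_le (iInf_le_kthLargest y hTk)).not_gt (hT i.2)

theorem exists_forall_eq_of_forall_le_kthLargest [Finite ι] (hpos : ∀ i, 0 ≤ y i) (hne : y ≠ 0)
    (hle : ∀ i, y i ≤ kthLargest k y) :
    ∃ S : Finset ι, S.card = k ∧ ∃ c > 0, ∀ i ∈ S, y i = c := by
  obtain ⟨j, hj⟩ := Function.ne_iff.1 hne
  have hc : 0 < kthLargest k y := ((hpos j).lt_of_ne' hj).trans_le (hle j)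
  have : Nonempty {S : Finset ι // S.card = k} := by
    by_contra h
    rw [not_nonempty_iff] at h
    exact hc.ne' (Real.iSup_of_isEmpty _)
  obtain ⟨S, hS⟩ := exists_eq_ciSup_of_finite
    (f := fun S : {S : Finset ι // S.card = k} ↦ ⨅ i : S.1, y i)
  refine ⟨S.1, S.2, _, hc, fun i hi ↦ (hle i).antisymm (hS.ge.trans ?_)⟩
  exact ciInf_le (f := fun i : S.1 ↦ y i) (finite_range _).bddBelow ⟨i, hi⟩

end KthLargest

-- After a generic rescaling of the coordinates no `n + 2` of them share a positive value on
-- `range F`, so at every point some coordinate exceeds the `(n + 2)`-nd largest one.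
theorem exists_open_cover_of_dimH_range_le {X ι : Type*} [TopologicalSpace X] [Fintype ι]
    {F : X → ι → ℝ} (hF : Continuous F) (hpos : ∀ x i, 0 ≤ F x i) (hne : ∀ x, F x ≠ 0) {n : ℕ}
    (hdim : dimH (range F) ≤ n) :
    ∃ W : ι → Set X, (∀ i, IsOpen (W i)) ∧ ⋃ i, W i = univ ∧ (∀ i, ∀ x ∈ W i, F x i ≠ 0) ∧
      ∀ x, {i | x ∈ W i}.ncard ≤ n + 1 := by
  obtain ⟨w, hw, hgen⟩ := exists_generic_weights hdim
  let G : X → ι → ℝ := fun x ↦ F x * w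
  have hG : Continuous G := hF.mul continuous_const
  have hGpos : ∀ x i, 0 ≤ G x i := fun x i ↦ mul_nonneg (hpos x i) (hw i).le
  have hGne : ∀ x, G x ≠ 0 := fun x h0 ↦ hne x <| funext fun i ↦
    (mul_eq_zero_iff_right (hw i).ne').1 (congrFun h0 i)
  refine ⟨fun i ↦ {x | kthLargest (n + 2) (G x) < G x i}, fun i ↦ ?_, ?_, fun i x hx h0 ↦ ?_,
    fun x ↦ Nat.lt_succ_iff.1 (ncard_kthLargest_lt_apply_lt (by lia) (G x))⟩
  · exact isOpen_lt (lipschitzWith_kthLargest.continuous.comp hG) ((continuous_apply i).comp hG)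
  · refine eq_univ_of_forall fun x ↦ mem_iUnion.2 ?_
    by_contra! hle
    obtain ⟨S, hS, c, hc, hSc⟩ := exists_forall_eq_of_forall_le_kthLargest (hGpos x) (hGne x)
      fun i ↦ not_lt.1 (hle i)
    exact hgen S hS _ (mem_range_self x) c hc hSc
  · refine ((kthLargest_nonneg (hGpos x)).trans_lt hx).ne' ?_
    simp [G, h0]

theorem coveringDimLE_of_dimH_range_le.{u} {X : Type u} [TopologicalSpace X] [CompactSpace X]
    {n : ℕ} {L : Set (X → ℝ)} (hcont : ∀ f ∈ L, Continuous f) (hpos : ∀ f ∈ L, ∀ x, 0 ≤ f x)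
    (hsep : ∀ x, ∀ O : Set X, IsOpen O → x ∈ O → ∃ f ∈ L, f x ≠ 0 ∧ ∀ y, f y ≠ 0 → y ∈ O)
    (hdim : ∀ (ι : Type u) [Fintype ι] (f : ι → X → ℝ), (∀ i, f i ∈ L) →
      dimH (range fun x i ↦ f i x) ≤ n) :
    CoveringDimLE X n := by
  intro 𝒰 _ hopen hcover
  have hsep' : ∀ x, ∃ O ∈ 𝒰, ∃ f ∈ L, f x ≠ 0 ∧ ∀ y, f y ≠ 0 → y ∈ O := fun x ↦ by
    obtain ⟨O, hO, hxO⟩ := mem_sUnion.1 (hcover ▸ mem_univ x)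
    exact ⟨O, hO, hsep x O (hopen O hO) hxO⟩
  choose O hO f hfL hfx hfO using hsep'
  obtain ⟨t, ht⟩ := isCompact_univ.elim_finite_subcover (fun x ↦ {y | f x y ≠ 0})
    (fun x ↦ isOpen_ne_fun (hcont _ (hfL x)) continuous_const)
    (fun x _ ↦ mem_iUnion.2 ⟨x, hfx x⟩)
  have hFne : ∀ y, (fun x : t ↦ f x y) ≠ 0 := fun y h0 ↦ by
    obtain ⟨x, hx, hxy⟩ := mem_iUnion₂.1 (ht (mem_univ y))
    exact hxy (congrFun h0 ⟨x, hx⟩)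
  obtain ⟨W, hWopen, hWcover, hWne, hWcard⟩ := exists_open_cover_of_dimH_range_le
    (F := fun y (x : t) ↦ f x y) (continuous_pi fun x ↦ hcont _ (hfL x))
    (fun y x ↦ hpos _ (hfL x) y) hFne (hdim t (fun x ↦ f x) fun x ↦ hfL x)
  refine ⟨range W, finite_range W, forall_mem_range.2 hWopen, hWcover,
    forall_mem_range.2 fun x ↦ ⟨O x, hO x, fun y hy ↦ hfO x y (hWne x y hy)⟩, fun x ↦ ?_⟩
  have hsub : {V ∈ range W | x ∈ V} ⊆ W '' {i | x ∈ W i} := by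
    rintro _ ⟨⟨i, rfl⟩, hi⟩
    exact ⟨i, hi, rfl⟩
  have hcard : {V ∈ range W | x ∈ V}.encard ≤ (n + 1 : ℕ) :=
    (encard_le_encard hsub).trans <| (encard_image_le _ _).trans <| by
      rw [← (toFinite _).cast_ncard_eq]
      exact_mod_cast hWcard x
  exact_mod_cast hcard

theorem coveringDimLE_of_isEmpty (X : Type*) [TopologicalSpace X] [IsEmpty X] (d : WithBot ℕ∞) :
    CoveringDimLE X d := fun _ _ _ _ ↦
  ⟨∅, finite_empty, by simp, by rw [sUnion_empty, univ_eq_empty_iff.2 ‹_›], by simp,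
    fun x ↦ isEmptyElim x⟩

end CoveringDimension

/-! ### Partitions into plaques -/

section FibreSup

variable {M X : Type*}

/-- The largest value of `h` on the part of `S` over `ξ`, and `0` if there is none. -/
noncomputable def fibreSup (q : M → X) (S : Set M) (h : M → ℝ) (ξ : X) : ℝ :=
  sSup (h '' (S ∩ q ⁻¹' {ξ}))

theorem fibreSup_nonneg {q : M → X} {S : Set M} {h : M → ℝ} (hpos : ∀ z, 0 ≤ h z) (ξ : X) :
    0 ≤ fibreSup q S h ξ :=
  Real.sSup_nonneg (by rintro _ ⟨z, -, rfl⟩; exact hpos z)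

variable [TopologicalSpace M] [TopologicalSpace X] [T1Space X] {q : M → X} {S : Set M} {h : M → ℝ}

theorem isCompact_inter_fibre (hq : Continuous q) (hS : IsCompact S) (ξ : X) :
    IsCompact (S ∩ q ⁻¹' {ξ}) :=
  hS.inter_right (isClosed_singleton.preimage hq)

theorem le_fibreSup (hq : Continuous q) (hS : IsCompact S) (hh : ContinuousOn h S) {z : M}
    (hz : z ∈ S) : h z ≤ fibreSup q S h (q z) :=
  le_csSup ((isCompact_inter_fibre hq hS _).image_of_continuousOn
    (hh.mono inter_subset_left)).bddAbove ⟨z, ⟨hz, rfl⟩, rfl⟩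

theorem fibreSup_eq_zero_or_exists (hq : Continuous q) (hS : IsCompact S) (hh : ContinuousOn h S)
    (ξ : X) : fibreSup q S h ξ = 0 ∨ ∃ z ∈ S, q z = ξ ∧ fibreSup q S h ξ = h z := by
  rcases (S ∩ q ⁻¹' {ξ}).eq_empty_or_nonempty with he | hne
  · exact .inl (by rw [fibreSup, he, image_empty, Real.sSup_empty])
  · obtain ⟨z, hz, hzh⟩ := (isCompact_inter_fibre hq hS ξ).exists_sSup_image_eq hne
      (hh.mono inter_subset_left)
    exact .inr ⟨z, hz.1, hz.2, hzh⟩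

theorem preimage_Ioi_fibreSup (hq : Continuous q) (hS : IsCompact S) (hh : ContinuousOn h S)
    {a : ℝ} (ha : 0 ≤ a) : fibreSup q S h ⁻¹' Ioi a = q '' {z ∈ S | a < h z} := by
  refine Subset.antisymm (fun ξ (hξ : a < fibreSup q S h ξ) ↦ ?_) ?_
  · rcases fibreSup_eq_zero_or_exists hq hS hh ξ with h0 | ⟨z, hz, rfl, hzh⟩
    · exact absurd (h0 ▸ hξ) ha.not_gt
    · exact ⟨z, ⟨hz, hzh ▸ hξ⟩, rfl⟩
  · rintro _ ⟨z, ⟨hz, hza⟩, rfl⟩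
    exact hza.trans_le (le_fibreSup hq hS hh hz)

theorem preimage_Ici_fibreSup (hq : Continuous q) (hS : IsCompact S) (hh : ContinuousOn h S)
    {a : ℝ} (ha : 0 < a) : fibreSup q S h ⁻¹' Ici a = q '' (S ∩ h ⁻¹' Ici a) := by
  refine Subset.antisymm (fun ξ (hξ : a ≤ fibreSup q S h ξ) ↦ ?_) ?_
  · rcases fibreSup_eq_zero_or_exists hq hS hh ξ with h0 | ⟨z, hz, rfl, hzh⟩
    · exact absurd (h0 ▸ hξ) ha.not_ge
    · exact ⟨z, ⟨hz, hξ.trans_eq hzh⟩, rfl⟩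
  · rintro _ ⟨z, ⟨hz, hza⟩, rfl⟩
    exact (mem_Ici.1 hza).trans (le_fibreSup hq hS hh hz)

end FibreSup

theorem continuous_fibreSup {M X : Type*} [TopologicalSpace M] [TopologicalSpace X] [T2Space X]
    {q : M → X} {S : Set M} {h : M → ℝ} (hq : Continuous q) (hS : IsCompact S)
    (hh : ContinuousOn h S) (hpos : ∀ z, 0 ≤ h z)
    (hopen : ∀ a : ℝ, 0 ≤ a → IsOpen (q '' {z ∈ S | a < h z})) :
    Continuous (fibreSup q S h) := by
  refine continuous_iff_lower_upperSemicontinuous.2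
    ⟨lowerSemicontinuous_iff_isOpen_preimage.2 fun a ↦ ?_,
      upperSemicontinuous_iff_isClosed_preimage.2 fun a ↦ ?_⟩
  · rcases lt_or_ge a 0 with ha | ha
    · convert isOpen_univ
      exact eq_univ_of_forall fun ξ ↦ ha.trans_le (fibreSup_nonneg hpos ξ)
    · exact preimage_Ioi_fibreSup hq hS hh ha ▸ hopen a ha
  · rcases le_or_gt a 0 with ha | ha
    · convert isClosed_univ
      exact eq_univ_of_forall fun ξ ↦ ha.trans (fibreSup_nonneg hpos ξ)
    · rw [preimage_Ici_fibreSup hq hS hh ha]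
      obtain ⟨C, hC, hCe⟩ := continuousOn_iff_isClosed.1 hh (Ici a) isClosed_Ici
      rw [inter_comm, hCe, inter_comm]
      exact ((hS.inter_right hC).image hq).isClosed

section LipschitzRelations

variable {E Λ : Type*} [PseudoMetricSpace E]

/-- `R` restricts to a Lipschitz function on a subset of `E`: this is how a change of transversal
along the plaques is described without specifying its domain. -/
def IsLipschitzRel (R : E → E → Prop) : Prop :=
  ∃ K : ℝ≥0, ∀ a b a' b', R a b → R a' b' → dist b b' ≤ K * dist a a'

/-- The relation composed of the relations `R l` for the letters `l` of a word. -/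
def wordRel {E Λ : Type*} (R : Λ → E → E → Prop) : List Λ → E → E → Prop
  | [] => Eq
  | l :: w => Relation.Comp (R l) (wordRel R w)

theorem isLipschitzRel_wordRel {R : Λ → E → E → Prop} (hR : ∀ l, IsLipschitzRel (R l))
    (w : List Λ) : IsLipschitzRel (wordRel R w) := by
  induction w with
  | nil => exact ⟨1, by rintro a b a' b' rfl rfl; simp⟩
  | cons l w ih =>
    obtain ⟨K, hK⟩ := hR l
    obtain ⟨K', hK'⟩ := ih
    refine ⟨K' * K, ?_⟩
    rintro a b a' b' ⟨c, hc, h⟩ ⟨c', hc', h'⟩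
    calc dist b b' ≤ K' * dist c c' := hK' _ _ _ _ h h'
      _ ≤ K' * (K * dist a a') := by gcongr; exact hK _ _ _ _ hc hc'
      _ = _ := by push_cast; ring

end LipschitzRelations

theorem dimH_image_le_of_dist_le {M E F : Type*} [MetricSpace E] [MetricSpace F] {Z : Set M}
    {f : M → F} {p : M → E} {K : ℝ≥0}
    (h : ∀ x ∈ Z, ∀ y ∈ Z, dist (f x) (f y) ≤ K * dist (p x) (p y)) :
    dimH (f '' Z) ≤ dimH (p '' Z) := by
  choose s hsZ hps using fun a : p '' Z ↦ a.2
  have hL : LipschitzWith K (f ∘ s) := LipschitzWith.of_dist_le_mul fun a b ↦ by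
    simpa only [hps, Subtype.dist_eq, Function.comp_apply] using h _ (hsZ a) _ (hsZ b)
  have hsub : f '' Z ⊆ range (f ∘ s) := by
    rintro _ ⟨x, hx, rfl⟩
    refine ⟨⟨p x, mem_image_of_mem p hx⟩, dist_le_zero.1 ?_⟩
    simpa only [hps, dist_self, mul_zero, Function.comp_apply] using
      h _ (hsZ ⟨p x, mem_image_of_mem p hx⟩) x hx
  calc dimH (f '' Z) ≤ dimH (univ : Set (p '' Z)) := (dimH_mono hsub).trans hL.dimH_range_le
    _ = dimH (p '' Z) := by
      rw [← isometry_subtype_coe.dimH_image, image_univ, Subtype.range_coe]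

section PlaqueAtlas

/-- Points `x` and `y` lie on a common plaque of one of the boxes `B j`, `j ∈ J'`. -/
def SamePlaque {M E J : Type*} (B : J → Set M) (p : J → M → E) (J' : Set J) (x y : M) : Prop :=
  ∃ j ∈ J', x ∈ B j ∧ y ∈ B j ∧ p j x = p j y

instance {M E J : Type*} {B : J → Set M} {p : J → M → E} {J' : Set J} :
    Std.Symm (SamePlaque B p J') where
  symm _ _ := fun ⟨j, hj, hx, hy, h⟩ ↦ ⟨j, hj, hy, hx, h.symm⟩

/-- An atlas of boxes `B j` with transversal coordinates `p j` for the partition of `M` into the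
classes of `r`: the fibres of `p j` are the plaques, the transversal coordinates of two boxes are
locally Lipschitz functions of each other, and the transversals have dimension at most `n`. -/
structure PlaqueAtlas {M E J : Type*} [TopologicalSpace M] [MetricSpace E] (r : Setoid M)
    (B : J → Set M) (p : J → M → E) (n : ℕ) : Prop where
  isOpen : ∀ j, IsOpen (B j)
  continuousOn : ∀ j, ContinuousOn (p j) (B j)
  rel : ∀ j, ∀ x ∈ B j, ∀ y ∈ B j, p j x = p j y → r x y
  generated : ∀ J' : Set J, (∀ x, ∃ j ∈ J', x ∈ B j) → ∀ x y, r x y →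
    Relation.EqvGen (SamePlaque B p J') x y
  lipschitz : ∀ i j, ∀ z ∈ B i ∩ B j, ∃ O ∈ 𝓝 z, ∃ K : ℝ≥0, ∀ x ∈ O, ∀ y ∈ O,
    dist (p j x) (p j y) ≤ K * dist (p i x) (p i y)
  plaque_open : ∀ j, ∀ y ∈ B j, ∀ z ∈ B j, p j y = p j z → ∀ O ∈ 𝓝 z,
    ∀ᶠ y' in 𝓝 y, ∃ z' ∈ O, r y' z'
  exists_transversal : ∀ x, ∃ j, x ∈ B j ∧ ∃ S ⊆ B j, IsCompact S ∧ x ∈ S ∧ InjOn (p j) S ∧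
    ∃ ε > 0, ∀ z ∈ B j, dist (p j z) (p j x) < ε → ∃ z' ∈ S, p j z' = p j z
  dimH_le : ∀ j, dimH (p j '' B j) ≤ n

/-- Functions on the quotient whose pullbacks are, on countably many pieces of each box, Lipschitz
functions of the transversal coordinate. -/
def IsPiecewiseTransverselyLipschitz {M E J X : Type*} [MetricSpace E]
    (B : J → Set M) (p : J → M → E) (q : M → X) (f : X → ℝ) : Prop :=
  ∀ j, ∃ 𝒬 : Set (Set M), 𝒬.Countable ∧ B j ⊆ ⋃₀ 𝒬 ∧ ∀ Q ∈ 𝒬, ∃ K : ℝ≥0, ∀ x ∈ Q ∩ B j,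
    ∀ y ∈ Q ∩ B j, dist (f (q x)) (f (q y)) ≤ K * dist (p j x) (p j y)

namespace PlaqueAtlas

variable {M E J : Type*} [TopologicalSpace M] [MetricSpace E] {r : Setoid M}
    {B : J → Set M} {p : J → M → E} {n : ℕ}

theorem reflTransGen (h : PlaqueAtlas r B p n) {J' : Set J} (hJ' : ∀ x, ∃ j ∈ J', x ∈ B j)
    {x y : M} (hxy : r x y) : Relation.ReflTransGen (SamePlaque B p J') x y :=
  Relation.EqvGen.eqvGen_eq_reflTransGen (r := SamePlaque B p J') ▸ h.generated J' hJ' x y hxy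

theorem eventually_exists_rel (h : PlaqueAtlas r B p n) {y z : M} (hyz : r y z) {O : Set M}
    (hO : O ∈ 𝓝 z) : ∀ᶠ y' in 𝓝 y, ∃ z' ∈ O, r y' z' := by
  have hcov : ∀ x, ∃ j ∈ univ, x ∈ B j := fun x ↦
    (h.exists_transversal x).imp fun j hj ↦ ⟨mem_univ j, hj.1⟩
  induction h.reflTransGen hcov hyz generalizing O with
  | refl => exact eventually_of_mem hO fun y' hy' ↦ ⟨y', hy', r.refl y'⟩
  | @tail w z _ hwz ih =>
    obtain ⟨j, -, hw, hz, he⟩ := hwz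
    have hrel := h.rel j w hw z hz he
    filter_upwards [ih (r.trans hyz (r.symm hrel)) (h.plaque_open j w hw z hz he O hO)]
      with y' ⟨w', ⟨z', hz', hwz'⟩, hyw'⟩
    exact ⟨z', hz', r.trans hyw' hwz'⟩

theorem isOpenMap_mk (h : PlaqueAtlas r B p n) : IsOpenMap (Quotient.mk r) := by
  intro O hO
  rw [← (isQuotientMap_quotient_mk' (s := r)).isOpen_preimage, isOpen_iff_mem_nhds]
  rintro y ⟨z, hz, hzy⟩
  have hyz : r y z := r.symm (Quotient.exact hzy)
  filter_upwards [h.eventually_exists_rel hyz (hO.mem_nhds hz)] with y' ⟨z', hz', h'⟩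
  exact ⟨z', hz', Quotient.sound (r.symm h')⟩

theorem continuous_fibreSup [T2Space (Quotient r)] (h : PlaqueAtlas r B p n) {j : J} {S : Set M}
    (hS : IsCompact S) (hSB : S ⊆ B j) {ρ : E → ℝ} (hρ : Continuous ρ) (hpos : ∀ a, 0 ≤ ρ a)
    (hsurj : ∀ z ∈ B j, 0 < ρ (p j z) → ∃ z' ∈ S, p j z' = p j z) :
    Continuous (fibreSup (Quotient.mk r) S (ρ ∘ p j)) := by
  have hB : ContinuousOn (ρ ∘ p j) (B j) := hρ.comp_continuousOn (h.continuousOn j)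
  refine _root_.continuous_fibreSup continuous_quotient_mk' hS (hB.mono hSB) (fun z ↦ hpos _)
    fun a ha ↦ ?_
  have heq : Quotient.mk r '' {z ∈ S | a < ρ (p j z)} =
      Quotient.mk r '' {z ∈ B j | a < ρ (p j z)} := by
    refine Subset.antisymm (image_mono (inter_subset_inter_left _ hSB)) ?_
    rintro _ ⟨z, ⟨hz, hza⟩, rfl⟩
    obtain ⟨z', hz', he⟩ := hsurj z hz (ha.trans_lt hza)
    exact ⟨z', ⟨hz', he.symm ▸ hza⟩, Quotient.sound (h.rel j z' (hSB hz') z hz he)⟩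
  rw [Function.comp_def, heq]
  exact h.isOpenMap_mk _ (hB.isOpen_inter_preimage (h.isOpen j) isOpen_Ioi)

theorem exists_transversal_of_isOpen (h : PlaqueAtlas r B p n) {x : M} {O : Set M} (hO : IsOpen O)
    (hx : x ∈ O) : ∃ j, ∃ S ⊆ B j, IsCompact S ∧ x ∈ S ∧ ∃ ε > 0,
      (∀ z ∈ B j, dist (p j z) (p j x) < ε → ∃ z' ∈ S, p j z' = p j z) ∧
      ∀ z ∈ S, dist (p j z) (p j x) < ε → z ∈ O := by
  obtain ⟨j, -, S, hSB, hS, hxS, hinj, ε₁, hε₁, hsurj⟩ := h.exists_transversal x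
  have hC : IsCompact (p j '' (S \ O)) :=
    (hS.diff hO).image_of_continuousOn ((h.continuousOn j).mono (sdiff_subset.trans hSB))
  have hxC : p j x ∈ (p j '' (S \ O))ᶜ := by
    rintro ⟨z, hz, hzx⟩
    exact hz.2 (hinj hz.1 hxS hzx ▸ hx)
  obtain ⟨ε₂, hε₂, hball⟩ := Metric.isOpen_iff.1 hC.isClosed.isOpen_compl _ hxC
  refine ⟨j, S, hSB, hS, hxS, min ε₁ ε₂, lt_min hε₁ hε₂,
    fun z hz hzε ↦ hsurj z hz (hzε.trans_le (min_le_left _ _)), fun z hz hzε ↦ ?_⟩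
  by_contra hzO
  exact hball (Metric.mem_ball.2 (hzε.trans_le (min_le_right _ _))) ⟨z, ⟨hz, hzO⟩, rfl⟩

variable [SecondCountableTopology M]

theorem exists_countable_cover (h : PlaqueAtlas r B p n) :
    ∃ J₀ : Set J, J₀.Countable ∧ ∀ x, ∃ j ∈ J₀, x ∈ B j := by
  choose j hj using fun x ↦ h.exists_transversal x
  obtain ⟨s, hs, hcov⟩ := TopologicalSpace.countable_cover_nhds
    (fun x ↦ (h.isOpen (j x)).mem_nhds (hj x).1)
  refine ⟨j '' s, hs.image j, fun x ↦ ?_⟩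
  obtain ⟨y, hy, hxy⟩ := mem_iUnion₂.1 (hcov ▸ mem_univ x)
  exact ⟨j y, mem_image_of_mem j hy, hxy⟩

theorem exists_countable_transition (h : PlaqueAtlas r B p n) (i j : J) :
    ∃ 𝒯 : Set (E → E → Prop), 𝒯.Countable ∧ (∀ R ∈ 𝒯, IsLipschitzRel R) ∧
      ∀ x ∈ B i ∩ B j, ∃ R ∈ 𝒯, R (p i x) (p j x) := by
  choose! O hO K hK using h.lipschitz i j
  obtain ⟨T, hTB, hTc, hTcov⟩ := TopologicalSpace.countable_cover_nhdsWithin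
    fun z hz ↦ mem_nhdsWithin_of_mem_nhds (hO z hz)
  refine ⟨(fun z a b ↦ ∃ x ∈ O z, p i x = a ∧ p j x = b) '' T, hTc.image _, ?_, fun x hx ↦ ?_⟩
  · rintro _ ⟨z, hz, rfl⟩
    refine ⟨K z, ?_⟩
    rintro _ _ _ _ ⟨x, hx, rfl, rfl⟩ ⟨x', hx', rfl, rfl⟩
    exact hK z (hTB hz) x hx x' hx'
  · obtain ⟨z, hz, hxz⟩ := mem_iUnion₂.1 (hTcov hx)
    exact ⟨_, mem_image_of_mem _ hz, x, hxz, rfl, rfl⟩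

theorem exists_countable_holonomy (h : PlaqueAtlas r B p n) {J₀ : Set J} (hJ₀ : J₀.Countable)
    (hcov : ∀ x, ∃ j ∈ J₀, x ∈ B j) :
    ∃ ℋ : Set (E → E → Prop), ℋ.Countable ∧ (∀ R ∈ ℋ, IsLipschitzRel R) ∧
      ∀ x y, ∀ i ∈ J₀, ∀ j ∈ J₀, r x y → x ∈ B i → y ∈ B j → ∃ R ∈ ℋ, R (p i x) (p j y) := by
  choose 𝒯 h𝒯c h𝒯L h𝒯 using h.exists_countable_transition
  let Λ : Set (E → E → Prop) := ⋃ i ∈ J₀, ⋃ j ∈ J₀, 𝒯 i j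
  have hΛc : Λ.Countable := hJ₀.biUnion fun i _ ↦ hJ₀.biUnion fun j _ ↦ h𝒯c i j
  have hΛ : ∀ R ∈ Λ, IsLipschitzRel R := by
    simp only [Λ, mem_iUnion]
    rintro R ⟨i, -, j, -, hR⟩
    exact h𝒯L i j R hR
  have hletter : ∀ x, ∀ i ∈ J₀, ∀ j ∈ J₀, x ∈ B i → x ∈ B j → ∃ R : Λ, R.1 (p i x) (p j x) := by
    intro x i hi j hj hxi hxj
    obtain ⟨R, hR, hRx⟩ := h𝒯 i j x ⟨hxi, hxj⟩
    exact ⟨⟨R, mem_iUnion₂.2 ⟨i, hi, mem_iUnion₂.2 ⟨j, hj, hR⟩⟩⟩, hRx⟩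
  have := hΛc.to_subtype
  refine ⟨range (wordRel fun R : Λ ↦ R.1), countable_range _,
    forall_mem_range.2 (isLipschitzRel_wordRel fun R ↦ hΛ R R.2), ?_⟩
  intro x y i hi j hj hxy hx hy
  rw [exists_range_iff]
  induction h.reflTransGen hcov hxy using Relation.ReflTransGen.head_induction_on
    generalizing i with
  | refl =>
    obtain ⟨R, hR⟩ := hletter y i hi j hj hx hy
    exact ⟨[R], p j y, hR, rfl⟩
  | @head x x' hxx' _ ih =>
    obtain ⟨k, hk, hxk, hx'k, he⟩ := hxx'
    obtain ⟨R, hR⟩ := hletter x i hi k hk hx hxk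
    obtain ⟨w, hw⟩ := ih k hk (r.trans (r.symm (h.rel k x hxk x' hx'k he)) hxy) hx'k
    exact ⟨R :: w, p k x, hR, he ▸ hw⟩

theorem dimH_range_le (h : PlaqueAtlas r B p n) {ι : Type*} [Fintype ι]
    (f : ι → Quotient r → ℝ)
    (hf : ∀ i, IsPiecewiseTransverselyLipschitz B p (Quotient.mk r) (f i)) :
    dimH (range fun ξ i ↦ f i ξ) ≤ n := by
  obtain ⟨J₀, hJ₀, hcov⟩ := h.exists_countable_cover
  have : Countable J₀ := hJ₀.to_subtype
  choose 𝒬 h𝒬c h𝒬B h𝒬 using hf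
  have : ∀ i j, Countable (𝒬 i j) := fun i j ↦ (h𝒬c i j).to_subtype
  let Z : (Σ j : J₀, ∀ i, 𝒬 i j) → Set M := fun a ↦ B a.1 ∩ ⋂ i, (a.2 i : Set M)
  let F : M → ι → ℝ := fun x i ↦ f i (Quotient.mk r x)
  have hsub : (range fun ξ i ↦ f i ξ) ⊆ ⋃ a, F '' Z a := by
    rintro _ ⟨ξ, rfl⟩
    obtain ⟨x, rfl⟩ := Quotient.mk_surjective ξ
    obtain ⟨j, hj, hxj⟩ := hcov x
    choose Q hQ hxQ using fun i ↦ mem_sUnion.1 (h𝒬B i j hxj)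
    exact mem_iUnion.2 ⟨⟨⟨j, hj⟩, fun i ↦ ⟨Q i, hQ i⟩⟩, x, ⟨hxj, mem_iInter.2 hxQ⟩, rfl⟩
  refine (dimH_mono hsub).trans ?_
  rw [dimH_iUnion]
  refine iSup_le fun a ↦ ?_
  choose K hK using fun i ↦ h𝒬 i a.1 (a.2 i) (a.2 i).2
  refine (dimH_image_le_of_dist_le (p := p a.1) (K := Finset.univ.sup K) ?_).trans
    ((dimH_mono (image_mono inter_subset_left)).trans (h.dimH_le a.1))
  intro x hx y hy
  refine (dist_pi_le_iff (by positivity)).2 fun i ↦ ?_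
  refine (hK i x ⟨mem_iInter.1 hx.2 i, hx.1⟩ y ⟨mem_iInter.1 hy.2 i, hy.1⟩).trans ?_
  gcongr
  exact Finset.le_sup (f := K) (Finset.mem_univ i)

variable [T2Space (Quotient r)]

theorem isPiecewiseTransverselyLipschitz_fibreSup (h : PlaqueAtlas r B p n) {i : J} {S : Set M}
    (hS : IsCompact S) (hSB : S ⊆ B i) {ρ : E → ℝ} {C : ℝ≥0} (hρ : LipschitzWith C ρ) :
    IsPiecewiseTransverselyLipschitz B p (Quotient.mk r)
      (fibreSup (Quotient.mk r) S (ρ ∘ p i)) := by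
  intro j
  set f := fibreSup (Quotient.mk r) S (ρ ∘ p i)
  obtain ⟨J₀, hJ₀, hcov⟩ := h.exists_countable_cover
  obtain ⟨ℋ, hHc, hHL, hH⟩ := h.exists_countable_holonomy (J₀ := insert j (insert i J₀))
    ((hJ₀.insert _).insert _)
    (fun x ↦ (hcov x).imp fun k hk ↦ ⟨mem_insert_of_mem _ (mem_insert_of_mem _ hk.1), hk.2⟩)
  -- The supremum over the leaf of `y` is attained at the image of `y` under one of countably many
  -- holonomy relations, which determines the piece containing `y`.
  let Q : (E → E → Prop) → Set M := fun R ↦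
    {y | ∃ z ∈ S, R (p j y) (p i z) ∧ f (Quotient.mk r y) = ρ (p i z)}
  refine ⟨insert {y | f (Quotient.mk r y) = 0} (Q '' ℋ), (hHc.image Q).insert _, fun y hy ↦ ?_, ?_⟩
  · rcases fibreSup_eq_zero_or_exists continuous_quotient_mk' hS
      (hρ.continuous.comp_continuousOn ((h.continuousOn i).mono hSB)) (Quotient.mk r y)
      with h0 | ⟨z, hz, hzy, hzh⟩
    · exact ⟨_, mem_insert _ _, h0⟩
    · obtain ⟨R, hR, hRyz⟩ := hH y z j (mem_insert _ _) i
        (mem_insert_of_mem _ (mem_insert _ _)) (r.symm (Quotient.exact hzy)) hy (hSB hz)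
      exact ⟨Q R, mem_insert_of_mem _ (mem_image_of_mem Q hR), z, hz, hRyz, hzh⟩
  · rintro _ (rfl | ⟨R, hR, rfl⟩)
    · refine ⟨0, fun y hy y' hy' ↦ ?_⟩
      rw [show f _ = 0 from hy.1, show f _ = 0 from hy'.1, dist_self]
      positivity
    · obtain ⟨K, hK⟩ := hHL R hR
      refine ⟨C * K, ?_⟩
      rintro y ⟨⟨z, -, hRz, hfz⟩, -⟩ y' ⟨⟨z', -, hRz', hfz'⟩, -⟩
      rw [hfz, hfz', NNReal.coe_mul, mul_assoc]
      exact (hρ.dist_le_mul _ _).trans (by gcongr; exact hK _ _ _ _ hRz hRz')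

theorem exists_separating_function (h : PlaqueAtlas r B p n)
    (ξ : Quotient r) {O : Set (Quotient r)} (hO : IsOpen O) (hξ : ξ ∈ O) :
    ∃ f : Quotient r → ℝ, Continuous f ∧ (∀ η, 0 ≤ f η) ∧ f ξ ≠ 0 ∧ (∀ η, f η ≠ 0 → η ∈ O) ∧
      IsPiecewiseTransverselyLipschitz B p (Quotient.mk r) f := by
  obtain ⟨x, rfl⟩ := Quotient.mk_surjective ξ
  have hq : Continuous (Quotient.mk r) := continuous_quotient_mk'
  obtain ⟨j, S, hSB, hS, hxS, ε, hε, hsurj, hεO⟩ :=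
    h.exists_transversal_of_isOpen (hO.preimage hq) hξ
  let ρ : E → ℝ := fun a ↦ max 0 (ε - dist a (p j x))
  have hρL : LipschitzWith (0 + 1) ρ :=
    ((LipschitzWith.const (α := E) ε).sub (LipschitzWith.dist_left (p j x))).const_max 0
  have hρpos : ∀ a, 0 ≤ ρ a := fun a ↦ le_max_left _ _
  have hρε : ∀ a, 0 < ρ a → dist a (p j x) < ε := fun a ha ↦
    sub_pos.1 ((lt_max_iff.1 ha).resolve_left (lt_irrefl 0))
  have hgS : ContinuousOn (ρ ∘ p j) S :=
    hρL.continuous.comp_continuousOn ((h.continuousOn j).mono hSB)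
  refine ⟨fibreSup (Quotient.mk r) S (ρ ∘ p j),
    h.continuous_fibreSup hS hSB hρL.continuous hρpos fun z hz hzρ ↦ hsurj z hz (hρε _ hzρ),
    fibreSup_nonneg fun z ↦ hρpos _, ?_, fun η hη ↦ ?_,
    h.isPiecewiseTransverselyLipschitz_fibreSup hS hSB hρL⟩
  · refine (lt_of_lt_of_le ?_ (le_fibreSup hq hS hgS hxS)).ne'
    simpa [ρ] using hε
  · obtain ⟨z, hz, rfl, hzh⟩ := (fibreSup_eq_zero_or_exists hq hS hgS η).resolve_left hη
    exact hεO z hz (hρε _ ((hρpos _).lt_of_ne' (hzh.symm.trans_ne hη)))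

theorem coveringDimLE (h : PlaqueAtlas r B p n) {A : Set (Quotient r)}
    (hA : IsCompact A) : CoveringDimLE A (n : ℕ) := by
  have : CompactSpace A := isCompact_iff_compactSpace.1 hA
  let L : Set (A → ℝ) := {f | ∃ g : Quotient r → ℝ, Continuous g ∧ (∀ η, 0 ≤ g η) ∧
    IsPiecewiseTransverselyLipschitz B p (Quotient.mk r) g ∧ f = fun a ↦ g a.1}
  refine coveringDimLE_of_dimH_range_le (L := L) ?_ ?_ ?_ ?_
  · rintro _ ⟨g, hg, -, -, rfl⟩
    exact hg.comp continuous_subtype_val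
  · rintro _ ⟨g, -, hg, -, rfl⟩ x
    exact hg x
  · rintro x O hO hx
    obtain ⟨O', hO', rfl⟩ := isOpen_induced_iff.1 hO
    obtain ⟨g, hgc, hg0, hgx, hgO, hgL⟩ := h.exists_separating_function x.1 hO' hx
    exact ⟨fun a ↦ g a.1, ⟨g, hgc, hg0, hgL, rfl⟩, hgx, fun y hy ↦ hgO y hy⟩
  · intro ι _ f hf
    choose g _ _ hgL hfg using hf
    refine (dimH_mono ?_).trans (h.dimH_range_le g hgL)
    rintro _ ⟨a, rfl⟩
    exact ⟨a, funext fun i ↦ (congrFun (hfg i) a).symm⟩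

end PlaqueAtlas

end PlaqueAtlas

/-! ### Transverse flows and fields preserving a direction -/

section TransverseFlow

variable {E : Type*} [NormedAddCommGroup E] [NormedSpace ℝ E]

/-- The linear map `x ↦ x - ℓ x • w`; when `ℓ w = 1` it is the projection onto `ker ℓ` along
`w`, and its value measures how far a vector is from being a multiple of `w`. -/
noncomputable def transverseProj (ℓ : E →L[ℝ] ℝ) (w : E) : E →L[ℝ] E :=
  .id ℝ E - ℓ.smulRight w

theorem transverseProj_apply (ℓ : E →L[ℝ] ℝ) (w x : E) : transverseProj ℓ w x = x - ℓ x • w :=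
  rfl

theorem norm_transverseProj_le (ℓ : E →L[ℝ] ℝ) (w : E) :
    ‖transverseProj ℓ w‖ ≤ 1 + ‖ℓ‖ * ‖w‖ := by
  refine (norm_sub_le _ _).trans (add_le_add ContinuousLinearMap.norm_id_le ?_)
  rw [ContinuousLinearMap.norm_smulRight_apply]

open Asymptotics in
theorem isLittleO_transverseProj_sub {ℓ : E →L[ℝ] ℝ} {w : E} (hw : ℓ w = 1) {c : ℝ → E} {a : ℝ}
    {J : Set ℝ} {s₀ : ℝ} (hc : HasDerivWithinAt c (a • w) J s₀) :
    (fun s ↦ transverseProj ℓ w (c s - c s₀)) =o[𝓝[J] s₀] fun s ↦ s - s₀ := by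
  refine (hasDerivWithinAt_iff_isLittleO.1
    ((transverseProj ℓ w).hasFDerivAt.comp_hasDerivWithinAt s₀ hc)).congr_left fun s ↦ ?_
  have h0 : transverseProj ℓ w w = 0 := by simp [transverseProj_apply, hw]
  simp only [Function.comp_apply, map_sub, map_smul, h0, smul_zero, sub_zero]

theorem exists_integralCurve_of_lipschitzWith [CompleteSpace E] {w : E → E} {K L : ℝ≥0}
    (hK : LipschitzWith K w) (hL : ∀ x, ‖w x‖ ≤ L) (x : E) :
    ∃ β : ℝ → E, β 0 = x ∧ ∀ t, HasDerivAt β (w (β t)) t := by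
  have hloc : ∀ a : ℝ, 0 < a → ∃ β : ℝ → E, β 0 = x ∧
      ∀ t ∈ Ioo (-a) a, HasDerivAt β (w (β t)) t := by
    intro a ha
    have hPL : IsPicardLindelof (fun _ ↦ w) (tmin := -a) (tmax := a)
        ⟨0, by constructor <;> linarith⟩
        x (L * a.toNNReal) 0 L K :=
      { lipschitzOnWith := fun t _ ↦ hK.lipschitzOnWith
        continuousOn := fun _ _ ↦ continuousOn_const
        norm_le := fun _ _ y _ ↦ hL y
        mul_max_le := by simp [ha.le] }
    obtain ⟨β, h0, hβ⟩ := hPL.exists_eq_forall_mem_Icc_hasDerivWithinAt₀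
    exact ⟨β, h0, fun t ht ↦ (hβ t (Ioo_subset_Icc_self ht)).hasDerivAt (Icc_mem_nhds ht.1 ht.2)⟩
  choose! β hβ0 hβ using hloc
  have heq : ∀ a b, 0 < a → a ≤ b → EqOn (β a) (β b) (Ioo (-a) a) := by
    intro a b ha hab
    refine ODE_solution_unique_of_mem_Ioo (v := fun _ ↦ w) (s := fun _ ↦ univ) (K := K) (t₀ := 0)
      (fun t _ ↦ hK.lipschitzOnWith) (by constructor <;> linarith)
      (fun t ht ↦ ⟨hβ a ha t ht, trivial⟩)
      (fun t ht ↦ ⟨hβ b (ha.trans_le hab) t ⟨by linarith [ht.1], by linarith [ht.2]⟩, trivial⟩) ?_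
    rw [hβ0 a ha, hβ0 b (ha.trans_le hab)]
  have hmem : ∀ t : ℝ, t ∈ Ioo (-(|t| + 1)) (|t| + 1) := fun t ↦ abs_lt.1 (by linarith)
  refine ⟨fun t ↦ β (|t| + 1) t, by simpa using hβ0 1 one_pos, fun t ↦ ?_⟩
  have hev : (fun s ↦ β (|s| + 1) s) =ᶠ[𝓝 t] β (|t| + 2) := by
    have : ∀ᶠ s in 𝓝 t, |s| < |t| + 1 :=
      (continuous_abs.tendsto t).eventually_lt_const (by linarith)
    filter_upwards [this] with s hs
    exact heq _ _ (by positivity) (by linarith) (hmem s)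
  have hd := hβ (|t| + 2) (by positivity) t (abs_lt.1 (by linarith))
  have hval : β (|t| + 1) t = β (|t| + 2) t := heq _ _ (by positivity) (by linarith) (hmem t)
  simp only [hval]
  exact hd.congr_of_eventuallyEq hev

/-- `α` is the flow of the bounded Lipschitz field `w`, and `ℓ (w x) = 1` everywhere. -/
structure IsTransverseFlow (ℓ : E →L[ℝ] ℝ) (w : E → E) (α : E → ℝ → E) (K L : ℝ≥0) : Prop where
  lipschitzWith : LipschitzWith K w
  norm_le : ∀ x, ‖w x‖ ≤ L
  normalized : ∀ x, ℓ (w x) = 1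
  zero : ∀ x, α x 0 = x
  hasDerivAt : ∀ x t, HasDerivAt (α x) (w (α x t)) t

/-- The projection along the flow lines of `α` onto the hyperplane `ℓ = c`. -/
def flowProj (ℓ : E →L[ℝ] ℝ) (α : E → ℝ → E) (c : ℝ) (x : E) : E := α x (c - ℓ x)

namespace IsTransverseFlow

variable {ℓ : E →L[ℝ] ℝ} {w : E → E} {α : E → ℝ → E} {K L : ℝ≥0}

theorem eq_of_hasDerivAt (h : IsTransverseFlow ℓ w α K L) {β γ : ℝ → E}
    (hβ : ∀ t, HasDerivAt β (w (β t)) t) (hγ : ∀ t, HasDerivAt γ (w (γ t)) t) (h0 : β 0 = γ 0) :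
    β = γ :=
  ODE_solution_unique_univ (v := fun _ ↦ w) (s := fun _ ↦ univ) (t₀ := 0)
    (fun _ ↦ h.lipschitzWith.lipschitzOnWith) (fun t ↦ ⟨hβ t, trivial⟩)
    (fun t ↦ ⟨hγ t, trivial⟩) h0

theorem add (h : IsTransverseFlow ℓ w α K L) (x : E) (s t : ℝ) : α (α x s) t = α x (s + t) := by
  refine congrFun (h.eq_of_hasDerivAt (h.hasDerivAt (α x s)) (γ := fun t ↦ α x (s + t))
    (fun t ↦ ?_) (by simp [h.zero])) t
  exact (h.hasDerivAt x (s + t)).comp_const_add s t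

theorem dist_le_abs (h : IsTransverseFlow ℓ w α K L) (x : E) (s t : ℝ) :
    dist (α x s) (α x t) ≤ L * |s - t| := by
  have := Convex.norm_image_sub_le_of_norm_hasDerivWithin_le (f := α x) (C := L) (s := univ)
    (fun t _ ↦ (h.hasDerivAt x t).hasDerivWithinAt) (fun t _ ↦ h.norm_le _) convex_univ
    (mem_univ t) (mem_univ s)
  rwa [dist_eq_norm, ← Real.norm_eq_abs]

theorem dist_flow_mul_sub_le (h : IsTransverseFlow ℓ w α K L) (x y : E) {s : ℝ}
    (hs : s ∈ Icc (0 : ℝ) 1) : dist (α x (s * (ℓ y - ℓ x))) x ≤ L * ‖ℓ‖ * dist x y := by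
  have hform : |ℓ y - ℓ x| ≤ ‖ℓ‖ * dist x y := by
    rw [← map_sub, ← Real.norm_eq_abs, dist_comm, dist_eq_norm]
    exact ℓ.le_opNorm _
  calc dist (α x (s * (ℓ y - ℓ x))) x ≤ L * (s * |ℓ y - ℓ x|) := by
        simpa [h.zero, abs_mul, abs_of_nonneg hs.1] using h.dist_le_abs x (s * (ℓ y - ℓ x)) 0
    _ ≤ L * (1 * (‖ℓ‖ * dist x y)) := by
        gcongr
        exact hs.2
    _ = _ := by ring

theorem exists_flow_mul_sub_mem_ball (h : IsTransverseFlow ℓ w α K L) (a : E) {r : ℝ}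
    (hr : 0 < r) : ∃ ρ > 0, ∀ x ∈ Metric.ball a ρ, ∀ y ∈ Metric.ball a ρ, ∀ s ∈ Icc (0 : ℝ) 1,
      α x (s * (ℓ y - ℓ x)) ∈ Metric.ball a r := by
  set ρ := r / (1 + 2 * (L * ‖ℓ‖))
  have hρr : ρ * (1 + 2 * (L * ‖ℓ‖)) = r := div_mul_cancel₀ r (by positivity)
  refine ⟨ρ, by positivity, fun x hx y hy s hs ↦ ?_⟩
  rw [Metric.mem_ball] at hx hy ⊢
  have hxy : dist x y ≤ 2 * ρ := by
    linarith [dist_triangle_right x y a]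
  calc dist (α x (s * (ℓ y - ℓ x))) a ≤ dist (α x (s * (ℓ y - ℓ x))) x + dist x a :=
        dist_triangle _ _ _
    _ < L * ‖ℓ‖ * (2 * ρ) + ρ := by
        refine add_lt_add_of_le_of_lt ((h.dist_flow_mul_sub_le x y hs).trans ?_) hx
        gcongr
    _ = r := by rw [← hρr]; ring

theorem form_apply (h : IsTransverseFlow ℓ w α K L) (x : E) (t : ℝ) : ℓ (α x t) = ℓ x + t := by
  have hd : ∀ t, HasDerivAt (fun t ↦ ℓ (α x t) - t) 0 t := fun t ↦ by
    have := (ℓ.hasFDerivAt.comp_hasDerivAt t (h.hasDerivAt x t)).sub (hasDerivAt_id t)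
    rw [h.normalized, sub_self] at this
    exact this
  have := is_const_of_deriv_eq_zero (fun t ↦ (hd t).differentiableAt) (fun t ↦ (hd t).deriv) t 0
  simp only [h.zero, sub_zero] at this
  linarith

theorem dist_le_of_nonneg (h : IsTransverseFlow ℓ w α K L) (x y : E) {t : ℝ} (ht : 0 ≤ t) :
    dist (α x t) (α y t) ≤ dist x y * Real.exp (K * t) := by
  have := dist_le_of_trajectories_ODE (v := fun _ ↦ w) (K := K) (a := 0) (b := t) (f := α x)
    (g := α y) (δ := dist x y) (fun _ ↦ h.lipschitzWith)
    (fun s _ ↦ (h.hasDerivAt x s).continuousAt.continuousWithinAt)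
    (fun s _ ↦ (h.hasDerivAt x s).hasDerivWithinAt)
    (fun s _ ↦ (h.hasDerivAt y s).continuousAt.continuousWithinAt)
    (fun s _ ↦ (h.hasDerivAt y s).hasDerivWithinAt) (by rw [h.zero, h.zero]) t ⟨ht, le_rfl⟩
  simpa using this

theorem reverse (h : IsTransverseFlow ℓ w α K L) :
    IsTransverseFlow (-ℓ) (fun x ↦ -w x) (fun x t ↦ α x (-t)) K L where
  lipschitzWith := h.lipschitzWith.neg
  norm_le x := by simpa using h.norm_le x
  normalized x := by simp [h.normalized]
  zero x := by simp [h.zero]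
  hasDerivAt x t := by
    have := (h.hasDerivAt x (-t)).scomp t (hasDerivAt_neg t)
    rw [neg_one_smul] at this
    exact this

theorem dist_le (h : IsTransverseFlow ℓ w α K L) (x y : E) (t : ℝ) :
    dist (α x t) (α y t) ≤ dist x y * Real.exp (K * |t|) := by
  rcases le_total 0 t with ht | ht
  · rw [abs_of_nonneg ht]; exact h.dist_le_of_nonneg x y ht
  · rw [abs_of_nonpos ht]
    simpa using h.reverse.dist_le_of_nonneg x y (t := -t) (by linarith)

theorem flowProj_flow (h : IsTransverseFlow ℓ w α K L) (c : ℝ) (x : E) (s : ℝ) :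
    flowProj ℓ α c (α x s) = flowProj ℓ α c x := by
  rw [flowProj, flowProj, h.add, h.form_apply]
  congr 1; ring

theorem form_flowProj (h : IsTransverseFlow ℓ w α K L) (c : ℝ) (x : E) :
    ℓ (flowProj ℓ α c x) = c := by
  rw [flowProj, h.form_apply]; ring

theorem flowProj_of_form_eq (h : IsTransverseFlow ℓ w α K L) {c : ℝ} {x : E} (hx : ℓ x = c) :
    flowProj ℓ α c x = x := by
  rw [flowProj, hx, sub_self, h.zero]

theorem flow_flowProj (h : IsTransverseFlow ℓ w α K L) (c : ℝ) (x : E) (s : ℝ) :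
    α (flowProj ℓ α c x) (s - c) = α x (s - ℓ x) := by
  rw [flowProj, h.add]; congr 1; ring

theorem eq_flow_of_flowProj_eq (h : IsTransverseFlow ℓ w α K L) {c : ℝ} {x y : E}
    (hxy : flowProj ℓ α c x = flowProj ℓ α c y) : y = α x (ℓ y - ℓ x) := by
  have h1 := h.flow_flowProj c x (ℓ y)
  have h2 := h.flow_flowProj c y (ℓ y)
  rw [hxy] at h1
  rw [sub_self, h.zero] at h2
  rw [← h1, h2]

theorem exists_lipschitzOnWith_flowProj (h : IsTransverseFlow ℓ w α K L) (u : E) (R : ℝ) :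
    ∃ C, LipschitzOnWith C (flowProj ℓ α (ℓ u)) (Metric.closedBall u R) := by
  refine ⟨(Real.exp (K * (‖ℓ‖ * R))).toNNReal + L * ‖ℓ‖₊,
    LipschitzOnWith.of_dist_le_mul fun x hx y _ ↦ ?_⟩
  have habs : |ℓ u - ℓ x| ≤ ‖ℓ‖ * R := by
    rw [← map_sub, ← Real.norm_eq_abs]
    refine (ℓ.le_opNorm _).trans ?_
    gcongr
    rw [← dist_eq_norm, dist_comm]; exact hx
  calc dist (flowProj ℓ α (ℓ u) x) (flowProj ℓ α (ℓ u) y)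
      ≤ dist (α x (ℓ u - ℓ x)) (α y (ℓ u - ℓ x)) + dist (α y (ℓ u - ℓ x)) (α y (ℓ u - ℓ y)) :=
        dist_triangle _ _ _
    _ ≤ dist x y * Real.exp (K * (‖ℓ‖ * R)) + L * (‖ℓ‖ * dist x y) := by
        refine add_le_add ((h.dist_le _ _ _).trans ?_) ((h.dist_le_abs _ _ _).trans ?_)
        · gcongr
        · gcongr
          rw [sub_sub_sub_cancel_left, ← map_sub, ← Real.norm_eq_abs, dist_comm, dist_eq_norm]
          exact ℓ.le_opNorm _
    _ = _ := by
        push_cast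
        rw [Real.coe_toNNReal _ (Real.exp_nonneg _)]; ring

theorem continuous_flowProj (h : IsTransverseFlow ℓ w α K L) (u : E) :
    Continuous (flowProj ℓ α (ℓ u)) := by
  refine continuous_iff_continuousAt.2 fun x ↦ ?_
  obtain ⟨C, hC⟩ := h.exists_lipschitzOnWith_flowProj u (dist x u + 1)
  exact hC.continuousOn.continuousAt
    (Metric.closedBall_mem_nhds_of_mem (Metric.mem_ball.2 (by linarith)))

theorem continuous_flow_left (h : IsTransverseFlow ℓ w α K L) (t : ℝ) :
    Continuous (fun x ↦ α x t) := by
  have : LipschitzWith (Real.exp (K * |t|)).toNNReal (fun x ↦ α x t) :=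
    LipschitzWith.of_dist_le_mul fun x y ↦ by
      rw [Real.coe_toNNReal _ (Real.exp_nonneg _), mul_comm]
      exact h.dist_le x y t
  exact this.continuous

theorem contDiff_flow [CompleteSpace E] (h : IsTransverseFlow ℓ w α K L) (hw : ContDiff ℝ ∞ w)
    (x : E) : ContDiff ℝ ∞ (α x) := by
  rw [contDiff_iff_contDiffAt]
  intro t
  have hon : ContDiffOn ℝ ((⊤ : ℕ∞) : WithTop ℕ∞) (α x) (Icc (t - 1) (t + 1)) :=
    ODE.contDiffOn_enat_Icc_of_hasDerivWithinAt (f := fun _ ↦ w) (u := univ)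
      (hw.comp contDiff_snd).contDiffOn (fun s _ ↦ (h.hasDerivAt x s).hasDerivWithinAt)
      (fun _ _ ↦ mem_univ _)
  exact hon.contDiffAt (Icc_mem_nhds (by linarith) (by linarith))

open Asymptotics in
theorem hasDerivWithinAt_flowProj_comp (h : IsTransverseFlow ℓ w α K L) (u : E) {c : ℝ → E}
    {J : Set ℝ} {s₀ : ℝ} (hO : (fun s ↦ c s - c s₀) =O[𝓝[J] s₀] fun s ↦ s - s₀)
    (ho : (fun s ↦ transverseProj ℓ (w (c s₀)) (c s - c s₀)) =o[𝓝[J] s₀] fun s ↦ s - s₀) :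
    HasDerivWithinAt (fun s ↦ flowProj ℓ α (ℓ u) (c s)) 0 J s₀ := by
  set σ : ℝ → ℝ := fun s ↦ ℓ (c s - c s₀) with hσ
  have hσO : σ =O[𝓝[J] s₀] fun s ↦ s - s₀ := (ℓ.isBigO_comp _ _).trans hO
  have hs₀ : Tendsto (fun s ↦ s - s₀) (𝓝[J] s₀) (𝓝 0) :=
    tendsto_sub_nhds_zero_iff.2 nhdsWithin_le_nhds
  have hσ₀ : Tendsto σ (𝓝[J] s₀) (𝓝 0) := hσO.trans_tendsto hs₀
  have hc : Tendsto c (𝓝[J] s₀) (𝓝 (c s₀)) :=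
    tendsto_sub_nhds_zero_iff.1 (hO.trans_tendsto hs₀)
  have hα : Tendsto (fun s ↦ α (c s₀) (σ s)) (𝓝[J] s₀) (𝓝 (c s₀)) := by
    have := (h.hasDerivAt (c s₀) 0).continuousAt.tendsto.comp hσ₀
    rwa [h.zero] at this
  have hαd : (fun s ↦ α (c s₀) (σ s) - c s₀ - σ s • w (c s₀)) =o[𝓝[J] s₀] fun s ↦ s - s₀ := by
    have := (hasDerivAt_iff_isLittleO.1 (h.hasDerivAt (c s₀) 0)).comp_tendsto hσ₀
    simp only [Function.comp_def, h.zero, sub_zero] at this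
    exact this.trans_isBigO hσO
  have hdiff : (fun s ↦ c s - α (c s₀) (σ s)) =o[𝓝[J] s₀] fun s ↦ s - s₀ :=
    (ho.sub hαd).congr_left fun s ↦ by simp only [transverseProj_apply, hσ]; abel
  obtain ⟨C, hC⟩ := h.exists_lipschitzOnWith_flowProj u (dist (c s₀) u + 1)
  have hball : Metric.closedBall u (dist (c s₀) u + 1) ∈ 𝓝 (c s₀) :=
    Metric.closedBall_mem_nhds_of_mem (Metric.mem_ball.2 (by linarith))
  rw [hasDerivWithinAt_iff_isLittleO]
  simp only [smul_zero, sub_zero]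
  refine IsBigO.trans_isLittleO (IsBigO.of_bound C ?_) hdiff
  filter_upwards [hc hball, hα hball] with s h1 h2
  have := hC.dist_le_mul _ h1 _ h2
  rwa [h.flowProj_flow, dist_eq_norm, dist_eq_norm] at this

open Asymptotics in
theorem hasDerivWithinAt_flowProj_comp_of_norm_le (h : IsTransverseFlow ℓ w α K L) (u : E)
    {c c₀ : ℝ → E} {J : Set ℝ} {s₀ a C₁ C₂ C₃ : ℝ} (hc₀ : HasDerivWithinAt c₀ (a • w (c₀ s₀)) J s₀)
    (hle : ∀ᶠ s in 𝓝[J] s₀, ‖c s - c s₀‖ ≤ C₁ * ‖c₀ s - c₀ s₀‖)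
    (hle' : ∀ᶠ s in 𝓝[J] s₀, ‖transverseProj ℓ (w (c s₀)) (c s - c s₀)‖ ≤
      C₂ * (‖transverseProj ℓ (w (c₀ s₀)) (c₀ s - c₀ s₀)‖ + C₃ * ‖c₀ s - c₀ s₀‖ ^ 2)) :
    HasDerivWithinAt (fun s ↦ flowProj ℓ α (ℓ u) (c s)) 0 J s₀ := by
  have hO : (fun s ↦ c₀ s - c₀ s₀) =O[𝓝[J] s₀] fun s ↦ s - s₀ := hc₀.hasFDerivWithinAt.isBigO_sub
  have hsq : (fun s ↦ ‖c₀ s - c₀ s₀‖ ^ 2) =o[𝓝[J] s₀] fun s ↦ s - s₀ :=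
    (hO.norm_norm.pow 2).trans_isLittleO
      ((isLittleO_pow_sub_sub s₀ one_lt_two).mono nhdsWithin_le_nhds)
  refine h.hasDerivWithinAt_flowProj_comp u ((IsBigO.of_bound C₁ hle).trans hO) ?_
  refine (IsBigO.of_bound |C₂| ?_).trans_isLittleO
    ((isLittleO_transverseProj_sub (h.normalized _) hc₀).norm_left.add (hsq.const_mul_left C₃))
  filter_upwards [hle'] with s hs
  exact hs.trans ((le_abs_self _).trans (abs_mul _ _).le)

end IsTransverseFlow

theorem exists_contDiffBump_contDiff_smul [FiniteDimensional ℝ E] {F : Type*}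
    [NormedAddCommGroup F] [NormedSpace ℝ F] {f : E → F} {u : E} {O : Set E} {n : ℕ∞}
    (hO : O ∈ 𝓝 u) (hf : ContDiffOn ℝ n f O) :
    ∃ b : ContDiffBump u, tsupport b ⊆ O ∧ ContDiff ℝ n fun x ↦ b x • f x := by
  obtain ⟨ε, hε, hεO⟩ := Metric.nhds_basis_closedBall.mem_iff.1 (interior_mem_nhds.2 hO)
  let b : ContDiffBump u := ⟨ε / 2, ε, by positivity, by linarith⟩
  have hb : tsupport b ⊆ interior O := by rwa [b.tsupport_eq]
  refine ⟨b, hb.trans interior_subset, contDiff_iff_contDiffAt.2 fun x ↦ ?_⟩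
  by_cases hx : x ∈ tsupport b
  · exact b.contDiffAt.smul (hf.contDiffAt (mem_interior_iff_mem_nhds.1 (hb hx)))
  · refine (contDiffAt_const (c := (0 : F))).congr_of_eventuallyEq ?_
    filter_upwards [notMem_tsupport_iff_eventuallyEq.1 hx] with y hy
    rw [hy, Pi.zero_apply, zero_smul]

theorem exists_isTransverseFlow [FiniteDimensional ℝ E] {ℓ : E →L[ℝ] ℝ} {w : E → E} {u : E}
    {O : Set E} (hO : O ∈ 𝓝 u) (hw : ContDiffOn ℝ ∞ w O) (hℓ : ∀ x ∈ O, ℓ (w x) = 1) :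
    ∃ (w' : E → E) (α : E → ℝ → E) (K L : ℝ≥0), ContDiff ℝ ∞ w' ∧ w' =ᶠ[𝓝 u] w ∧
      IsTransverseFlow ℓ w' α K L := by
  have : CompleteSpace E := FiniteDimensional.complete ℝ E
  -- Cutting off `w - w u` rather than `w` keeps the normalisation `ℓ w' = 1`.
  obtain ⟨b, hbO, hb⟩ := exists_contDiffBump_contDiff_smul hO (hw.sub (contDiffOn_const (c := w u)))
  have hsupp : HasCompactSupport fun x ↦ b x • (w x - w u) := b.hasCompactSupport.smul_right
  obtain ⟨C, hC⟩ := hsupp.exists_bound_of_continuous hb.continuous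
  obtain ⟨K, hK⟩ :=
    (hb.of_le (by norm_cast : (1 : WithTop ℕ∞) ≤ ∞)).lipschitzWith_of_hasCompactSupport hsupp
      one_ne_zero
  have hlip : LipschitzWith (0 + K) fun x ↦ w u + b x • (w x - w u) :=
    (LipschitzWith.const (w u)).add hK
  have hle : ∀ x, ‖w u + b x • (w x - w u)‖ ≤ (‖w u‖₊ + C.toNNReal : ℝ≥0) := fun x ↦
    (norm_add_le _ _).trans (add_le_add le_rfl ((hC x).trans (Real.le_coe_toNNReal C)))
  choose α hα₀ hα using exists_integralCurve_of_lipschitzWith hlip hle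
  refine ⟨_, α, _, _, contDiff_const.add hb, ?_, hlip, hle, fun x ↦ ?_, hα₀, hα⟩
  · filter_upwards [b.eventuallyEq_one] with x hx
    rw [hx, Pi.one_apply, one_smul, add_sub_cancel]
  · have hu : ℓ (w u) = 1 := hℓ u (mem_of_mem_nhds hO)
    by_cases hx : x ∈ O
    · simp [hu, hℓ x hx]
    · simp [image_eq_zero_of_notMem_tsupport fun h ↦ hx (hbO h), hu]

end TransverseFlow

section TangentialGronwall

theorem gronwallBound_le_exp_mul_add {δ K ε x : ℝ} (hK : 0 < K) (hε : 0 ≤ ε) :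
    gronwallBound δ K ε x ≤ Real.exp (K * x) * (δ + ε * x) := by
  have hexp : Real.exp (K * x) - 1 ≤ Real.exp (K * x) * (K * x) := by
    have := mul_le_mul_of_nonneg_left (Real.add_one_le_exp (-(K * x))) (Real.exp_nonneg (K * x))
    rw [← Real.exp_add, add_neg_cancel, Real.exp_zero] at this
    linarith
  calc gronwallBound δ K ε x
      = δ * Real.exp (K * x) + ε / K * (Real.exp (K * x) - 1) := by
        rw [gronwallBound_of_K_ne_0 hK.ne']
    _ ≤ δ * Real.exp (K * x) + ε / K * (Real.exp (K * x) * (K * x)) := by gcongr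
    _ = Real.exp (K * x) * (δ + ε * x) := by field_simp

variable {E : Type*} [NormedAddCommGroup E] [NormedSpace ℝ E]

theorem norm_sub_sub_fderiv_le_of_lipschitzOnWith {F : Type*} [NormedAddCommGroup F]
    [NormedSpace ℝ F] {f : E → F} {s : Set E} {C : ℝ≥0} (hs : Convex ℝ s)
    (hd : ∀ x ∈ s, DifferentiableAt ℝ f x) (hf : LipschitzOnWith C (fderiv ℝ f) s)
    {x y : E} (hx : x ∈ s) (hy : y ∈ s) :
    ‖f y - f x - fderiv ℝ f x (y - x)‖ ≤ C * ‖y - x‖ ^ 2 := by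
  have hseg : segment ℝ x y ⊆ s := hs.segment_subset hx hy
  have hbound : ∀ z ∈ segment ℝ x y, ‖fderiv ℝ f z - fderiv ℝ f x‖ ≤ C * ‖y - x‖ := by
    intro z hz
    refine (hf.norm_sub_le (hseg hz) hx).trans ?_
    obtain ⟨θ, ⟨h0, h1⟩, rfl⟩ := (segment_eq_image' ℝ x y) ▸ hz
    rw [add_sub_cancel_left, norm_smul, Real.norm_of_nonneg h0]
    gcongr
    exact mul_le_of_le_one_left (norm_nonneg _) h1
  calc ‖f y - f x - fderiv ℝ f x (y - x)‖ ≤ C * ‖y - x‖ * ‖y - x‖ :=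
        (convex_segment x y).norm_image_sub_le_of_norm_hasFDerivWithin_le'
          (fun z hz ↦ (hd z (hseg hz)).hasFDerivAt.hasFDerivWithinAt) hbound
          (left_mem_segment ℝ x y) (right_mem_segment ℝ x y)
    _ = C * ‖y - x‖ ^ 2 := by ring

theorem transverseProj_map_transverseProj {ℓ : E →L[ℝ] ℝ} {w b : E} {F : E →L[ℝ] E} {a : ℝ}
    (hw : ℓ w = 1) (hb : ℓ b = 0) (hF : b - F w = a • w) (x : E) :
    transverseProj ℓ w (F (transverseProj ℓ w x)) = transverseProj ℓ w (F x) - ℓ x • b := by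
  have hFw : F w = b - a • w := by rw [← hF]; abel
  simp only [transverseProj_apply, map_sub, map_smul, hFw, hw, hb]
  module

/-- Quantitative form, on a convex open set, of the statement that the flow of `v` preserves the
line field spanned by `w`, where `w` is normalised by `ℓ w = 1`. -/
structure PreservesDirectionOn (ℓ : E →L[ℝ] ℝ) (v w : E → E) (G : Set E) (C L : ℝ≥0) : Prop where
  isOpen : IsOpen G
  convex : Convex ℝ G
  pos : 0 < C
  differentiableAt : ∀ x ∈ G, DifferentiableAt ℝ v x
  norm_fderiv_le : ∀ x ∈ G, ‖fderiv ℝ v x‖ ≤ C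
  lipschitzOnWith_fderiv : LipschitzOnWith C (fderiv ℝ v) G
  differentiableAt_direction : ∀ x ∈ G, DifferentiableAt ℝ w x
  norm_direction_le : ∀ x ∈ G, ‖w x‖ ≤ L
  normalized : ∀ x ∈ G, ℓ (w x) = 1
  lieBracket_eq_smul : ∀ x ∈ G, ∃ a : ℝ, VectorField.lieBracket ℝ v w x = a • w x

namespace PreservesDirectionOn

variable {ℓ : E →L[ℝ] ℝ} {v w : E → E} {G : Set E} {C L : ℝ≥0} {T : ℝ} {X Y : ℝ → E}

theorem form_fderiv_eq_zero (h : PreservesDirectionOn ℓ v w G C L) {x : E} (hx : x ∈ G) (y : E) :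
    ℓ (fderiv ℝ w x y) = 0 := by
  have h1 : HasFDerivAt (fun y ↦ ℓ (w y)) (ℓ.comp (fderiv ℝ w x)) x :=
    ℓ.hasFDerivAt.comp x (h.differentiableAt_direction x hx).hasFDerivAt
  have h2 : HasFDerivAt (fun y ↦ ℓ (w y)) (0 : E →L[ℝ] ℝ) x :=
    (hasFDerivAt_const (1 : ℝ) x).congr_of_eventuallyEq
      (eventuallyEq_of_mem (h.isOpen.mem_nhds hx) h.normalized)
  exact congr($(h1.unique h2) y)

theorem norm_sub_le (h : PreservesDirectionOn ℓ v w G C L)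
    (hXc : ContinuousOn X (Icc 0 T)) (hYc : ContinuousOn Y (Icc 0 T))
    (hXG : ∀ t ∈ Icc 0 T, X t ∈ G) (hYG : ∀ t ∈ Icc 0 T, Y t ∈ G)
    (hX : ∀ t ∈ Ico 0 T, HasDerivWithinAt X (v (X t)) (Ici t) t)
    (hY : ∀ t ∈ Ico 0 T, HasDerivWithinAt Y (v (Y t)) (Ici t) t) {t : ℝ} (ht : t ∈ Icc 0 T) :
    ‖Y t - X t‖ ≤ Real.exp (C * T) * ‖Y 0 - X 0‖ := by
  have hv : LipschitzOnWith C v G :=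
    h.convex.lipschitzOnWith_of_nnnorm_fderiv_le h.differentiableAt h.norm_fderiv_le
  have hdist := dist_le_of_trajectories_ODE_of_mem (v := fun _ ↦ v) (s := fun _ ↦ G) (K := C)
    (fun _ _ ↦ hv) hYc hY (fun t ht ↦ hYG t (Ico_subset_Icc_self ht)) hXc hX
    (fun t ht ↦ hXG t (Ico_subset_Icc_self ht)) le_rfl t ht
  rw [dist_eq_norm, dist_eq_norm, mul_comm, sub_zero] at hdist
  refine hdist.trans ?_
  gcongr
  exact ht.2

theorem hasDerivWithinAt_transverseProj (h : PreservesDirectionOn ℓ v w G C L) {t : ℝ}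
    {J : Set ℝ} (hXG : X t ∈ G) (hX : HasDerivWithinAt X (v (X t)) J t)
    (hY : HasDerivWithinAt Y (v (Y t)) J t) :
    HasDerivWithinAt (fun t ↦ transverseProj ℓ (w (X t)) (Y t - X t))
      (transverseProj ℓ (w (X t)) (fderiv ℝ v (X t) (transverseProj ℓ (w (X t)) (Y t - X t)) +
        (v (Y t) - v (X t) - fderiv ℝ v (X t) (Y t - X t)))) J t := by
  obtain ⟨a, ha⟩ := h.lieBracket_eq_smul _ hXG
  have hd := hY.sub hX
  have hw := (h.differentiableAt_direction _ hXG).hasFDerivAt.comp_hasDerivWithinAt t hX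
  refine (hd.sub ((ℓ.hasFDerivAt.comp_hasDerivWithinAt t hd).smul hw)).congr_deriv ?_
  rw [map_add, map_sub _ _ (fderiv ℝ v (X t) _), transverseProj_map_transverseProj
    (h.normalized _ hXG) (h.form_fderiv_eq_zero hXG (v (X t))) ha]
  simp only [transverseProj_apply]
  abel

theorem norm_transverseProj_deriv_le (h : PreservesDirectionOn ℓ v w G C L) {x y : E}
    (hx : x ∈ G) (hy : y ∈ G) (z : E) :
    ‖transverseProj ℓ (w x) (fderiv ℝ v x z + (v y - v x - fderiv ℝ v x (y - x)))‖ ≤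
      (1 + ‖ℓ‖ * L) * C * ‖z‖ + (1 + ‖ℓ‖ * L) * C * ‖y - x‖ ^ 2 := by
  have hproj : ‖transverseProj ℓ (w x)‖ ≤ 1 + ‖ℓ‖ * L :=
    (norm_transverseProj_le _ _).trans (by gcongr; exact h.norm_direction_le x hx)
  have hz : ‖fderiv ℝ v x z‖ ≤ C * ‖z‖ :=
    (fderiv ℝ v x).le_of_opNorm_le (h.norm_fderiv_le x hx) z
  have hR := norm_sub_sub_fderiv_le_of_lipschitzOnWith h.convex h.differentiableAt
    h.lipschitzOnWith_fderiv hx hy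
  calc _ ≤ (1 + ‖ℓ‖ * L) * (C * ‖z‖ + C * ‖y - x‖ ^ 2) :=
        (ContinuousLinearMap.le_of_opNorm_le _ hproj _).trans
          (by gcongr; exact (norm_add_le _ _).trans (add_le_add hz hR))
    _ = _ := by ring

theorem norm_transverseProj_sub_le (h : PreservesDirectionOn ℓ v w G C L)
    (hXc : ContinuousOn X (Icc 0 T)) (hYc : ContinuousOn Y (Icc 0 T))
    (hXG : ∀ t ∈ Icc 0 T, X t ∈ G) (hYG : ∀ t ∈ Icc 0 T, Y t ∈ G)
    (hX : ∀ t ∈ Ico 0 T, HasDerivWithinAt X (v (X t)) (Ici t) t)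
    (hY : ∀ t ∈ Ico 0 T, HasDerivWithinAt Y (v (Y t)) (Ici t) t) {t : ℝ} (ht : t ∈ Icc 0 T) :
    ‖transverseProj ℓ (w (X t)) (Y t - X t)‖ ≤ Real.exp ((1 + ‖ℓ‖ * L) * C * T) *
      (‖transverseProj ℓ (w (X 0)) (Y 0 - X 0)‖ +
        (1 + ‖ℓ‖ * L) * C * (Real.exp (C * T) * ‖Y 0 - X 0‖) ^ 2 * T) := by
  have hK : 0 < (1 + ‖ℓ‖ * L) * C := mul_pos (by positivity) h.pos
  have hwc : ContinuousOn (fun t ↦ w (X t)) (Icc 0 T) := fun t ht ↦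
    (h.differentiableAt_direction _ (hXG t ht)).continuousAt.comp_continuousWithinAt (hXc t ht)
  have hc : ContinuousOn (fun t ↦ transverseProj ℓ (w (X t)) (Y t - X t)) (Icc 0 T) :=
    (hYc.sub hXc).sub ((ℓ.continuous.comp_continuousOn (hYc.sub hXc)).smul hwc)
  have hbound : ∀ t ∈ Ico 0 T, ‖transverseProj ℓ (w (X t)) (fderiv ℝ v (X t)
      (transverseProj ℓ (w (X t)) (Y t - X t)) +
        (v (Y t) - v (X t) - fderiv ℝ v (X t) (Y t - X t)))‖ ≤
      (1 + ‖ℓ‖ * L) * C * ‖transverseProj ℓ (w (X t)) (Y t - X t)‖ +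
        (1 + ‖ℓ‖ * L) * C * (Real.exp (C * T) * ‖Y 0 - X 0‖) ^ 2 := fun t ht ↦ by
    have ht' := Ico_subset_Icc_self ht
    refine (h.norm_transverseProj_deriv_le (hXG t ht') (hYG t ht') _).trans ?_
    gcongr
    exact h.norm_sub_le hXc hYc hXG hYG hX hY ht'
  have hgronwall := norm_le_gronwallBound_of_norm_deriv_right_le hc
    (fun t ht ↦ h.hasDerivWithinAt_transverseProj (hXG t (Ico_subset_Icc_self ht)) (hX t ht)
      (hY t ht)) le_rfl hbound t ht
  rw [sub_zero] at hgronwall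
  refine (hgronwall.trans (gronwallBound_le_exp_mul_add hK (by positivity))).trans ?_
  have ht₀ : 0 ≤ t := ht.1
  gcongr
  exacts [ht.2, ht.2]

end PreservesDirectionOn

end TangentialGronwall

/-! ### Kernels of smooth families of symmetric forms -/

theorem exists_eq_span_singleton_of_finrank_eq_one {K V : Type*} [Field K] [AddCommGroup V]
    [Module K V] {S : Submodule K V} (hS : Module.finrank K S = 1) : ∃ n ≠ 0, S = K ∙ n := by
  obtain ⟨n, hn, hspan⟩ := finrank_eq_one_iff'.1 hS
  refine ⟨n, by simpa using hn, le_antisymm (fun ξ hξ ↦ ?_) (by simp)⟩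
  obtain ⟨c, hc⟩ := hspan ⟨ξ, hξ⟩
  exact Submodule.mem_span_singleton.2 ⟨c, by simpa using congrArg Subtype.val hc⟩

section SymmetricFormKernel

variable {E : Type*} [NormedAddCommGroup E] [NormedSpace ℝ E]

theorem isInvertible_add_smulRight [FiniteDimensional ℝ E] {B : E →L[ℝ] E →L[ℝ] ℝ}
    (hB : ∀ a b, B a b = B b a) {n : E} (hn : LinearMap.ker B.toLinearMap = ℝ ∙ n)
    {ℓ : E →L[ℝ] ℝ} (hℓ : ℓ n = 1) : (B + ℓ.smulRight ℓ).IsInvertible := by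
  have hBn : B n = 0 := by
    have : n ∈ LinearMap.ker B.toLinearMap := hn ▸ Submodule.mem_span_singleton_self n
    simpa using this
  have hinj : Function.Injective (B + ℓ.smulRight ℓ).toLinearMap := by
    rw [← LinearMap.ker_eq_bot, LinearMap.ker_eq_bot']
    intro ξ hξ
    replace hξ : B ξ + ℓ ξ • ℓ = 0 := hξ
    have hℓξ : ℓ ξ = 0 := by simpa [hB ξ n, hBn, hℓ] using congr($hξ n)
    have hmem : ξ ∈ LinearMap.ker B.toLinearMap := by simpa [hℓξ] using hξ
    obtain ⟨c, rfl⟩ := Submodule.mem_span_singleton.1 (hn ▸ hmem)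
    have hc : c = 0 := by simpa [hℓ] using hℓξ
    rw [hc, zero_smul]
  have hdim : Module.finrank ℝ E = Module.finrank ℝ (E →L[ℝ] ℝ) := by
    rw [← (LinearMap.toContinuousLinearMap (𝕜 := ℝ) (E := E) (F' := ℝ)).finrank_eq]
    exact Subspace.dual_finrank_eq.symm
  exact ⟨(LinearEquiv.ofInjectiveOfFinrankEq _ hinj hdim).toContinuousLinearEquiv, by ext; rfl⟩

theorem ker_eq_span_inverse_add_smulRight {B : E →L[ℝ] E →L[ℝ] ℝ} {ℓ : E →L[ℝ] ℝ}
    (h : (B + ℓ.smulRight ℓ).IsInvertible)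
    (hB : Module.finrank ℝ (LinearMap.ker B.toLinearMap) = 1) :
    ℓ ((B + ℓ.smulRight ℓ).inverse ℓ) = 1 ∧
      LinearMap.ker B.toLinearMap = ℝ ∙ (B + ℓ.smulRight ℓ).inverse ℓ := by
  set w := (B + ℓ.smulRight ℓ).inverse ℓ
  obtain ⟨n, hn0, hn⟩ :=
    exists_eq_span_singleton_of_finrank_eq_one hB
  have hBn : B n = 0 := by
    have : n ∈ LinearMap.ker B.toLinearMap := hn ▸ Submodule.mem_span_singleton_self n
    simpa using this
  have hnw : n = ℓ n • w := by
    calc n = (B + ℓ.smulRight ℓ).inverse ((B + ℓ.smulRight ℓ) n) := (h.inverse_apply_self n).symm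
      _ = ℓ n • w := by simp [hBn, w]
  have hℓn : ℓ n ≠ 0 := fun h0 ↦ hn0 (by rw [hnw, h0, zero_smul])
  refine ⟨mul_left_cancel₀ hℓn ?_, ?_⟩
  · simpa using congrArg ℓ hnw.symm
  · rw [hn, hnw, Submodule.span_singleton_smul_eq hℓn.isUnit]

theorem exists_contDiffOn_ker_eq_span [FiniteDimensional ℝ E] {D : Type*} [NormedAddCommGroup D]
    [NormedSpace ℝ D] {r : WithTop ℕ∞} {G : D → E →L[ℝ] E →L[ℝ] ℝ} {s : Set D} (hs : IsOpen s)
    (hG : ContDiffOn ℝ r G s) (hsymm : ∀ u ∈ s, ∀ a b, G u a b = G u b a)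
    (hker : ∀ u ∈ s, Module.finrank ℝ (LinearMap.ker (G u).toLinearMap) = 1) {u₀ : D}
    (hu₀ : u₀ ∈ s) :
    ∃ (ℓ : E →L[ℝ] ℝ) (w : D → E) (O : Set D), IsOpen O ∧ u₀ ∈ O ∧ O ⊆ s ∧ ContDiffOn ℝ r w O ∧
      ∀ u ∈ O, ℓ (w u) = 1 ∧ LinearMap.ker (G u).toLinearMap = ℝ ∙ w u := by
  have : CompleteSpace E := FiniteDimensional.complete ℝ E
  obtain ⟨n, hn0, hn⟩ := exists_eq_span_singleton_of_finrank_eq_one (hker u₀ hu₀)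
  obtain ⟨ℓ, hℓ⟩ := SeparatingDual.exists_eq_one (R := ℝ) hn0
  set P : D → E →L[ℝ] E →L[ℝ] ℝ := fun u ↦ G u + ℓ.smulRight ℓ
  have hP : ContDiffOn ℝ r P s := hG.add contDiffOn_const
  refine ⟨ℓ, fun u ↦ (P u).inverse ℓ, s ∩ P ⁻¹' {f | f.IsInvertible},
    hP.continuousOn.isOpen_inter_preimage hs ContinuousLinearEquiv.isOpen,
    ⟨hu₀, isInvertible_add_smulRight (hsymm u₀ hu₀) hn hℓ⟩, inter_subset_left, ?_, ?_⟩
  · rintro u ⟨hu, hinv⟩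
    have hPu : ContDiffAt ℝ r P u := hP.contDiffAt (hs.mem_nhds hu)
    exact ((hinv.contDiffAt_map_inverse.comp u hPu).clm_apply contDiffAt_const).contDiffWithinAt
  · rintro u ⟨hu, hinv⟩
    exact ker_eq_span_inverse_add_smulRight hinv (hker u hu)

end SymmetricFormKernel

/-! ### The null distribution of an immersion -/

theorem mdifferentiable_of_mem_maximalAtlas {E M : Type*} [NormedAddCommGroup E]
    [NormedSpace ℝ E] [TopologicalSpace M] [ChartedSpace E M] {n : WithTop ℕ∞} (hn : n ≠ 0)
    {e : OpenPartialHomeomorph M E} (he : e ∈ IsManifold.maximalAtlas 𝓘(ℝ, E) n M) :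
    e.MDifferentiable 𝓘(ℝ, E) 𝓘(ℝ, E) :=
  ⟨(contMDiffOn_of_mem_maximalAtlas he).mdifferentiableOn hn,
    (contMDiffOn_symm_of_mem_maximalAtlas he).mdifferentiableOn hn⟩

theorem mfderiv_injective_of_isImmersionAt {E F : Type*} [NormedAddCommGroup E]
    [NormedSpace ℝ E] [NormedAddCommGroup F] [NormedSpace ℝ F] {M U : Type*}
    [TopologicalSpace M] [ChartedSpace E M] [TopologicalSpace U] [ChartedSpace F U]
    {f : M → U} {x : M} (h : Manifold.IsImmersionAt 𝓘(ℝ, E) 𝓘(ℝ, F) ∞ f x) :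
    Function.Injective (mfderiv 𝓘(ℝ, E) 𝓘(ℝ, F) f x) := by
  set e := h.domChart
  set e' := h.codChart
  have he : e.MDifferentiable 𝓘(ℝ, E) 𝓘(ℝ, E) :=
    mdifferentiable_of_mem_maximalAtlas (by simp) h.domChart_mem_maximalAtlas
  have he' : MDifferentiableAt 𝓘(ℝ, F) 𝓘(ℝ, F) e' (f x) :=
    (mdifferentiable_of_mem_maximalAtlas (by simp) h.codChart_mem_maximalAtlas).mdifferentiableAt
      h.mem_codChart_source
  let L : E →L[ℝ] F := (h.equiv : (E × h.complement) →L[ℝ] F).comp (.inl ℝ E h.complement)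
  have hL : Function.Injective L := h.equiv.injective.comp (Prod.mk_left_injective 0)
  have hwritten : e' ∘ f =ᶠ[𝓝 x] L ∘ e := by
    filter_upwards [e.open_source.mem_nhds h.mem_domChart_source] with y hy
    have hmem : e y ∈ (e.extend 𝓘(ℝ, E)).target := by simpa using e.map_source hy
    have := h.writtenInCharts hmem
    simpa [L, e, e', h.domChart.left_inv hy] using this
  have hf : MDifferentiableAt 𝓘(ℝ, E) 𝓘(ℝ, F) f x := h.contMDiffAt.mdifferentiableAt (by simp)
  have hderiv := hwritten.mfderiv_eq (I := 𝓘(ℝ, E)) (I' := 𝓘(ℝ, F))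
  rw [mfderiv_comp x he' hf, mfderiv_comp x L.mdifferentiableAt
    (he.mdifferentiableAt h.mem_domChart_source), L.hasMFDerivAt.mfderiv] at hderiv
  intro a b hab
  refine he.mfderiv_injective h.mem_domChart_source (hL ?_)
  exact (DFunLike.congr_fun hderiv a).symm.trans <|
    (congrArg (mfderiv 𝓘(ℝ, F) 𝓘(ℝ, F) e' (f x)) hab).trans (DFunLike.congr_fun hderiv b)

theorem LorentzianMetric.finrank_le_one_of_forall_form_self_eq_zero {n : ℕ} [NeZero n] {U : Type*}
    [TopologicalSpace U] [ChartedSpace (EuclideanSpace ℝ (Fin n)) U] [IsManifold (𝓡 n) ∞ U]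
    (g : LorentzianMetric n U) {p : U} {S : Submodule ℝ (TangentSpace (𝓡 n) p)}
    (hS : ∀ v ∈ S, g.form p v v = 0) : Module.finrank ℝ S ≤ 1 := by
  obtain ⟨b, hb⟩ := g.signature p
  have hself : ∀ v, g.form p v v = ∑ i, if i = 0 then -b.repr v i ^ 2 else b.repr v i ^ 2 :=
    fun v ↦ by
    conv_lhs => rw [← b.sum_repr v]
    simp only [map_sum, map_smul, sum_apply, smul_apply, hb, smul_eq_mul, mul_ite, mul_zero,
      Finset.sum_ite_eq', Finset.mem_univ, if_true]
    exact Finset.sum_congr rfl fun i _ ↦ by split_ifs <;> ring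
  -- A null vector without time component vanishes.
  have hinj : Function.Injective ((b.coord 0).domRestrict S) := by
    refine (injective_iff_map_eq_zero _).2 fun v hv ↦ Subtype.ext (b.ext_elem fun i ↦ ?_)
    have hv₀ : b.repr v 0 = 0 := hv
    have hterm : ∀ i, (if i = 0 then -b.repr v i ^ 2 else b.repr v i ^ 2) = b.repr v i ^ 2 :=
      fun i ↦ by split_ifs with hi <;> simp [hi, hv₀]
    have hsum : ∑ i, b.repr v i ^ 2 = 0 := by
      simpa only [hself, hterm] using hS v v.2
    have hzero := (Finset.sum_eq_zero_iff_of_nonneg fun i _ ↦ sq_nonneg _).1 hsum i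
      (Finset.mem_univ i)
    simpa using hzero
  simpa using LinearMap.finrank_le_finrank_of_injective hinj

theorem finrank_nullDistribution_le_one {m n : ℕ} [NeZero n] {U : Type*} [TopologicalSpace U]
    [ChartedSpace (EuclideanSpace ℝ (Fin n)) U] [IsManifold (𝓡 n) ∞ U]
    (g : LorentzianMetric n U) {M : Type*} [TopologicalSpace M]
    [ChartedSpace (EuclideanSpace ℝ (Fin m)) M] (ι : M → U) {x : M}
    (hinj : Function.Injective (mfderiv (𝓡 m) (𝓡 n) ι x)) :
    Module.finrank ℝ (nullDistribution (m := m) g ι x) ≤ 1 := by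
  have h := g.finrank_le_one_of_forall_form_self_eq_zero
    (S := (nullDistribution (m := m) g ι x).map (mfderiv (𝓡 m) (𝓡 n) ι x).toLinearMap) <| by
      rintro _ ⟨v, hv, rfl⟩
      exact hv v
  rwa [← (Submodule.equivMapOfInjective _ hinj _).finrank_eq] at h

/-! ### Vector fields and line fields in a chart -/

section ChartDerivative

variable {E : Type*} [NormedAddCommGroup E] [NormedSpace ℝ E] {M : Type*} [TopologicalSpace M]
  [ChartedSpace E M]

/-- The derivative of a chart, with values in the model space. -/
noncomputable def chartDeriv (e : OpenPartialHomeomorph M E) (x : M) :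
    TangentSpace 𝓘(ℝ, E) x →L[ℝ] E :=
  mfderiv 𝓘(ℝ, E) 𝓘(ℝ, E) e x

/-- The derivative of an inverse chart, defined on the model space. -/
noncomputable def chartDerivSymm (e : OpenPartialHomeomorph M E) (u : E) :
    E →L[ℝ] TangentSpace 𝓘(ℝ, E) (e.symm u) :=
  mfderiv 𝓘(ℝ, E) 𝓘(ℝ, E) e.symm u

/-- A vector field on a manifold, read in a chart. -/
noncomputable def chartField (e : OpenPartialHomeomorph M E)
    (V : ∀ x : M, TangentSpace 𝓘(ℝ, E) x) : E → E :=
  VectorField.mpullback 𝓘(ℝ, E) 𝓘(ℝ, E) e.symm V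

variable {e : OpenPartialHomeomorph M E}

theorem chartDeriv_comp_chartDerivSymm (he : e ∈ IsManifold.maximalAtlas 𝓘(ℝ, E) ∞ M) {u : E}
    (hu : u ∈ e.target) : (chartDeriv e (e.symm u)).comp (chartDerivSymm e u) = .id ℝ E :=
  (mdifferentiable_of_mem_maximalAtlas (by simp) he).comp_symm_deriv hu

theorem chartDeriv_chartDerivSymm (he : e ∈ IsManifold.maximalAtlas 𝓘(ℝ, E) ∞ M) {u : E}
    (hu : u ∈ e.target) (a : E) : chartDeriv e (e.symm u) (chartDerivSymm e u a) = a :=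
  DFunLike.congr_fun (chartDeriv_comp_chartDerivSymm he hu) a

theorem chartDerivSymm_comp_chartDeriv (he : e ∈ IsManifold.maximalAtlas 𝓘(ℝ, E) ∞ M) {u : E}
    (hu : u ∈ e.target) :
    (chartDerivSymm e u).comp (chartDeriv e (e.symm u)) =
      .id ℝ (TangentSpace 𝓘(ℝ, E) (e.symm u)) := by
  have hcomp := (mdifferentiable_of_mem_maximalAtlas (by simp) he).symm_comp_deriv (e.map_target hu)
  -- `e (e.symm u) = u` cannot be rewritten inside the dependent type of `mfderiv`.
  have hcast : ∀ u', u' = u → (mfderiv 𝓘(ℝ, E) 𝓘(ℝ, E) e.symm u' : E → E) =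
      (mfderiv 𝓘(ℝ, E) 𝓘(ℝ, E) e.symm u : E → E) := by
    rintro _ rfl; rfl
  ext ξ
  exact (congrFun (hcast (e (e.symm u)) (e.right_inv hu)) _).symm.trans (DFunLike.congr_fun hcomp ξ)

theorem chartDerivSymm_chartDeriv (he : e ∈ IsManifold.maximalAtlas 𝓘(ℝ, E) ∞ M) {u : E}
    (hu : u ∈ e.target) (ξ : TangentSpace 𝓘(ℝ, E) (e.symm u)) :
    chartDerivSymm e u (chartDeriv e (e.symm u) ξ) = ξ :=
  DFunLike.congr_fun (chartDerivSymm_comp_chartDeriv he hu) ξ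

theorem chartField_apply (he : e ∈ IsManifold.maximalAtlas 𝓘(ℝ, E) ∞ M) {u : E}
    (hu : u ∈ e.target) (V : ∀ x : M, TangentSpace 𝓘(ℝ, E) x) :
    chartField e V u = chartDeriv e (e.symm u) (V (e.symm u)) :=
  DFunLike.congr_fun (ContinuousLinearMap.inverse_eq (f := chartDerivSymm e u)
    (chartDerivSymm_comp_chartDeriv he hu) (chartDeriv_comp_chartDerivSymm he hu)) (V (e.symm u))

theorem mpullback_chart_apply (he : e ∈ IsManifold.maximalAtlas 𝓘(ℝ, E) ∞ M) {u : E}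
    (hu : u ∈ e.target) (w : E → E) :
    VectorField.mpullback 𝓘(ℝ, E) 𝓘(ℝ, E) e w (e.symm u) = chartDerivSymm e u (w u) := by
  have hinv : VectorField.mpullback 𝓘(ℝ, E) 𝓘(ℝ, E) e w (e.symm u) =
      chartDerivSymm e u (w (e (e.symm u))) :=
    DFunLike.congr_fun (ContinuousLinearMap.inverse_eq (f := chartDeriv e (e.symm u))
      (chartDeriv_comp_chartDerivSymm he hu) (chartDerivSymm_comp_chartDeriv he hu)) _
  rw [hinv, e.right_inv hu]

theorem isInvertible_mfderiv_chart (he : e ∈ IsManifold.maximalAtlas 𝓘(ℝ, E) ∞ M) {x : M}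
    (hx : x ∈ e.source) : (mfderiv 𝓘(ℝ, E) 𝓘(ℝ, E) e x).IsInvertible :=
  ⟨(mdifferentiable_of_mem_maximalAtlas (by simp) he).mfderiv hx, rfl⟩

theorem isInvertible_mfderiv_chart_symm (he : e ∈ IsManifold.maximalAtlas 𝓘(ℝ, E) ∞ M) {u : E}
    (hu : u ∈ e.target) : (mfderiv 𝓘(ℝ, E) 𝓘(ℝ, E) e.symm u).IsInvertible :=
  ⟨(mdifferentiable_of_mem_maximalAtlas (by simp) he).symm.mfderiv hu, rfl⟩

variable [CompleteSpace E] [IsManifold 𝓘(ℝ, E) ∞ M]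

theorem contDiffAt_chartField {r : WithTop ℕ∞} (hr : r + 1 ≤ ∞)
    (he : e ∈ IsManifold.maximalAtlas 𝓘(ℝ, E) ∞ M) {u : E} (hu : u ∈ e.target)
    {V : ∀ x : M, TangentSpace 𝓘(ℝ, E) x}
    (hV : ContMDiff 𝓘(ℝ, E) 𝓘(ℝ, E).tangent r
      (fun x ↦ (⟨x, V x⟩ : TangentBundle 𝓘(ℝ, E) M))) :
    ContDiffAt ℝ r (chartField e V) u :=
  contMDiffAt_vectorSpace_iff_contDiffAt.1 <|
    ContMDiffAt.mpullback_vectorField_preimage (n := ∞) (hV _)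
      ((contMDiffOn_symm_of_mem_maximalAtlas he).contMDiffAt (e.open_target.mem_nhds hu))
      (isInvertible_mfderiv_chart_symm he hu) hr

theorem chartField_mlieBracket (he : e ∈ IsManifold.maximalAtlas 𝓘(ℝ, E) ∞ M) {u : E}
    (hu : u ∈ e.target) {V W : ∀ x : M, TangentSpace 𝓘(ℝ, E) x}
    (hV : MDifferentiableAt 𝓘(ℝ, E) 𝓘(ℝ, E).tangent
      (fun x ↦ (⟨x, V x⟩ : TangentBundle 𝓘(ℝ, E) M)) (e.symm u))
    (hW : MDifferentiableAt 𝓘(ℝ, E) 𝓘(ℝ, E).tangent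
      (fun x ↦ (⟨x, W x⟩ : TangentBundle 𝓘(ℝ, E) M)) (e.symm u)) :
    chartField e (VectorField.mlieBracket 𝓘(ℝ, E) V W) u =
      VectorField.lieBracket ℝ (chartField e V) (chartField e W) u := by
  have two_le_infty : minSmoothness ℝ 2 ≤ (∞ : WithTop ℕ∞) := by
    simpa using WithTop.coe_le_coe.2 (le_top : (2 : ℕ∞) ≤ ⊤)
  have : IsManifold 𝓘(ℝ, E) (minSmoothness ℝ 2) M := .of_le two_le_infty
  have hpullback := VectorField.mpullback_mlieBracket hV hW
    ((contMDiffOn_symm_of_mem_maximalAtlas he).contMDiffAt (e.open_target.mem_nhds hu)) two_le_infty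
  rw [← VectorField.lieBracketWithin_univ]
  exact hpullback.trans (congrFun VectorField.mlieBracketWithin_eq_lieBracketWithin u)

end ChartDerivative

/-- In the chart `e`, over the open set `O`, the distribution `N` is the line field spanned by `w`,
normalized by `ℓ (w u) = 1`. -/
structure IsNormalForm {E : Type*} [NormedAddCommGroup E] [NormedSpace ℝ E] {M : Type*}
    [TopologicalSpace M] [ChartedSpace E M] (N : ∀ x : M, Submodule ℝ (TangentSpace 𝓘(ℝ, E) x))
    (e : OpenPartialHomeomorph M E) (ℓ : E →L[ℝ] ℝ) (w : E → E) (O : Set E) : Prop where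
  isOpen : IsOpen O
  subset : O ⊆ e.target
  contDiffOn : ContDiffOn ℝ ∞ w O
  normalized : ∀ u ∈ O, ℓ (w u) = 1
  mem_iff : ∀ u ∈ O, ∀ ξ : TangentSpace 𝓘(ℝ, E) (e.symm u),
    ξ ∈ N (e.symm u) ↔ ∃ a : ℝ, chartDeriv e (e.symm u) ξ = a • w u

namespace IsNormalForm

variable {E : Type*} [NormedAddCommGroup E] [NormedSpace ℝ E] {M : Type*} [TopologicalSpace M]
  [ChartedSpace E M] {N : ∀ x : M, Submodule ℝ (TangentSpace 𝓘(ℝ, E) x)}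
  {e : OpenPartialHomeomorph M E} {ℓ : E →L[ℝ] ℝ} {w : E → E} {O : Set E}

theorem chartDerivSymm_mem (h : IsNormalForm N e ℓ w O)
    (he : e ∈ IsManifold.maximalAtlas 𝓘(ℝ, E) ∞ M) {u : E} (hu : u ∈ O) (a : ℝ) :
    chartDerivSymm e u (a • w u) ∈ N (e.symm u) :=
  (h.mem_iff u hu _).2 ⟨a, chartDeriv_chartDerivSymm he (h.subset hu) _⟩

theorem congr (h : IsNormalForm N e ℓ w O) {w' : E → E} {O' : Set E} (hO' : IsOpen O')
    (hsub : O' ⊆ O) (hw : EqOn w' w O') : IsNormalForm N e ℓ w' O' where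
  isOpen := hO'
  subset := hsub.trans h.subset
  contDiffOn := (h.contDiffOn.mono hsub).congr hw
  normalized u hu := by rw [hw hu, h.normalized u (hsub hu)]
  mem_iff u hu ξ := by rw [hw hu, h.mem_iff u (hsub hu)]

theorem exists_chartDeriv_eq_smul (h : IsNormalForm N e ℓ w O) {x : M} (hx : x ∈ e.source)
    (hxO : e x ∈ O) {ξ : TangentSpace 𝓘(ℝ, E) x} (hξ : ξ ∈ N x) :
    ∃ a : ℝ, chartDeriv e x ξ = a • w (e x) := by
  obtain ⟨u, hu, rfl⟩ : ∃ u ∈ O, e.symm u = x := ⟨e x, hxO, e.left_inv hx⟩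
  rw [e.right_inv (h.subset hu)]
  exact (h.mem_iff u hu ξ).1 hξ

theorem contMDiffOn_mpullback [CompleteSpace E] [IsManifold 𝓘(ℝ, E) ∞ M]
    (h : IsNormalForm N e ℓ w O) (he : e ∈ IsManifold.maximalAtlas 𝓘(ℝ, E) ∞ M) :
    ContMDiffOn 𝓘(ℝ, E) 𝓘(ℝ, E).tangent ∞
      (fun x ↦ (⟨x, VectorField.mpullback 𝓘(ℝ, E) 𝓘(ℝ, E) e w x⟩ : TangentBundle 𝓘(ℝ, E) M))
      (e.source ∩ e ⁻¹' O) := fun _ hx ↦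
  (ContMDiffAt.mpullback_vectorField_preimage (n := ∞)
    (contMDiffAt_vectorSpace_iff_contDiffAt.2 (h.contDiffOn.contDiffAt (h.isOpen.mem_nhds hx.2)))
    ((contMDiffOn_of_mem_maximalAtlas he).contMDiffAt (e.open_source.mem_nhds hx.1))
    (isInvertible_mfderiv_chart he hx.1) (by simp)).contMDiffWithinAt

end IsNormalForm

namespace IsNormalForm

variable {m : ℕ} {M : Type*} [TopologicalSpace M] [T2Space M]
  [ChartedSpace (EuclideanSpace ℝ (Fin m)) M] [IsManifold (𝓡 m) ∞ M]
  {N : ∀ x : M, Submodule ℝ (TangentSpace (𝓡 m) x)}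
  {e : OpenPartialHomeomorph M (EuclideanSpace ℝ (Fin m))} {ℓ : EuclideanSpace ℝ (Fin m) →L[ℝ] ℝ}
  {w : EuclideanSpace ℝ (Fin m) → EuclideanSpace ℝ (Fin m)} {O : Set (EuclideanSpace ℝ (Fin m))}

theorem exists_isSmoothSection (h : IsNormalForm N e ℓ w O)
    (he : e ∈ IsManifold.maximalAtlas (𝓡 m) ∞ M) {u : EuclideanSpace ℝ (Fin m)} (hu : u ∈ O) :
    ∃ W, IsSmoothSection N W ∧ chartField e W =ᶠ[𝓝 u] w := by
  have hopen : IsOpen (e.source ∩ e ⁻¹' O) := e.isOpen_inter_preimage h.isOpen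
  have hmem : e.symm u ∈ e.source ∩ e ⁻¹' O :=
    ⟨e.map_target (h.subset hu), by rwa [mem_preimage, e.right_inv (h.subset hu)]⟩
  obtain ⟨f, -, hf⟩ := (SmoothBumpFunction.nhds_basis_tsupport (I := 𝓡 m) (e.symm u)).mem_iff.1
    (hopen.mem_nhds hmem)
  set W : ∀ x : M, TangentSpace (𝓡 m) x :=
    fun x ↦ f x • VectorField.mpullback (𝓡 m) (𝓡 m) e w x
  have hW : ∀ u' ∈ O, W (e.symm u') = f (e.symm u') • chartDerivSymm e u' (w u') := fun u' hu' ↦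
    congrArg (f (e.symm u') • ·) (mpullback_chart_apply he (h.subset hu') w)
  refine ⟨W, ⟨ContMDiffOn.smul_section_of_tsupport f.contMDiff.contMDiffOn hopen hf
    (h.contMDiffOn_mpullback he), fun x ↦ ?_⟩, ?_⟩
  · by_cases hx : x ∈ e.source ∩ e ⁻¹' O
    · obtain ⟨u', hu', rfl⟩ : ∃ u' ∈ O, e.symm u' = x := ⟨e x, hx.2, e.left_inv hx.1⟩
      rw [hW u' hu', ← map_smul]
      exact h.chartDerivSymm_mem he hu' _
    · have hfx : f x = 0 := image_eq_zero_of_notMem_tsupport fun h' ↦ hx (hf h')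
      simp [W, hfx]
  · have hf1 : ∀ᶠ u' in 𝓝 u, f (e.symm u') = 1 :=
      (e.continuousAt_symm (h.subset hu)).eventually f.eventuallyEq_one
    filter_upwards [hf1, h.isOpen.mem_nhds hu] with u' hf1 hu'
    rw [chartField_apply he (h.subset hu'), hW u' hu', hf1, one_smul,
      chartDeriv_chartDerivSymm he (h.subset hu')]

theorem exists_lieBracket_chartField_eq_smul (h : IsNormalForm N e ℓ w O)
    (he : e ∈ IsManifold.maximalAtlas (𝓡 m) ∞ M) {V : ∀ x : M, TangentSpace (𝓡 m) x}
    (hV : IsVectorFieldOfClass 1 V) (hproj : IsProjectable N V) {u : EuclideanSpace ℝ (Fin m)}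
    (hu : u ∈ O) :
    ∃ a : ℝ, VectorField.lieBracket ℝ (chartField e V) w u = a • w u := by
  obtain ⟨W, hW, hWw⟩ := h.exists_isSmoothSection he hu
  obtain ⟨a, ha⟩ := (h.mem_iff u hu _).1 (hproj W hW (e.symm u))
  refine ⟨a, ?_⟩
  rw [← ha, ← chartField_apply he (h.subset hu), chartField_mlieBracket he (h.subset hu)
    ((hV _).mdifferentiableAt (by simp)) ((hW.1 _).mdifferentiableAt (by simp))]
  exact ((EventuallyEq.refl _ (chartField e V)).lieBracket_vectorField_eq (𝕜 := ℝ) hWw).symm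

end IsNormalForm

/-! ### The null distribution in a chart -/

section NullNormalForm

variable {n : ℕ} [NeZero n] {U : Type*} [TopologicalSpace U]
  [ChartedSpace (EuclideanSpace ℝ (Fin n)) U] [IsManifold (𝓡 n) ∞ U] (g : LorentzianMetric n U)

namespace LorentzianMetric

variable {E : Type*} [NormedAddCommGroup E] [NormedSpace ℝ E]

/-- The pull-back of a Lorentzian metric by a map defined on a vector space. -/
noncomputable def pullbackForm (f : E → U) (u : E) : E →L[ℝ] E →L[ℝ] ℝ :=
  ContinuousLinearMap.bilinearComp (E := EuclideanSpace ℝ (Fin n)) (F := EuclideanSpace ℝ (Fin n))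
    (g.form (f u)) (mfderiv 𝓘(ℝ, E) (𝓡 n) f u) (mfderiv 𝓘(ℝ, E) (𝓡 n) f u)

theorem contDiffOn_pullbackForm [FiniteDimensional ℝ E] {f : E → U} {s : Set E} (hs : IsOpen s)
    (hf : ContMDiffOn 𝓘(ℝ, E) (𝓡 n) ∞ f s) : ContDiffOn ℝ ∞ (g.pullbackForm f) s := by
  have hsection : ∀ a : E, ContMDiffOn 𝓘(ℝ, E) (𝓡 n).tangent ∞
      (fun u ↦ (⟨f u, mfderiv 𝓘(ℝ, E) (𝓡 n) f u a⟩ : TangentBundle (𝓡 n) U)) s := by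
    intro a
    have hconst : ContMDiffOn 𝓘(ℝ, E) 𝓘(ℝ, E).tangent ∞
        (fun u ↦ (⟨u, a⟩ : TangentBundle 𝓘(ℝ, E) E)) s :=
      contMDiffOn_vectorSpace_iff_contDiffOn.2 contDiffOn_const
    refine ((hf.contMDiffOn_tangentMapWithin (m := ∞) (by simp) hs.uniqueMDiffOn).comp hconst
      fun u hu ↦ hu).congr fun u hu ↦ ?_
    simp only [Function.comp_apply, tangentMapWithin, mfderivWithin_of_isOpen hs hu]
  refine contDiffOn_clm_apply.2 fun a ↦ contDiffOn_clm_apply.2 fun b ↦ ?_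
  rw [← contMDiffOn_iff_contDiffOn]
  intro u hu
  have htotal : ContMDiffWithinAt 𝓘(ℝ, E) ((𝓡 n).prod 𝓘(ℝ)) ∞
      (fun u ↦ TotalSpace.mk' ℝ (E := Bundle.Trivial U ℝ) (f u)
        (g.form (f u) (mfderiv 𝓘(ℝ, E) (𝓡 n) f u a) (mfderiv 𝓘(ℝ, E) (𝓡 n) f u b))) s u :=
    (g.contMDiff.contMDiffAt.comp_contMDiffWithinAt u (hf u hu)).clm_bundle_apply₂
      (F₁ := EuclideanSpace ℝ (Fin n)) (F₂ := EuclideanSpace ℝ (Fin n))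
      (hsection a u hu) (hsection b u hu)
  exact ((contMDiffWithinAt_totalSpace).1 htotal).2

end LorentzianMetric

variable {m : ℕ} {M : Type*} [TopologicalSpace M] [ChartedSpace (EuclideanSpace ℝ (Fin m)) M]
  {ι : M → U} {e : OpenPartialHomeomorph M (EuclideanSpace ℝ (Fin m))}
  {u : EuclideanSpace ℝ (Fin m)}

theorem pullbackForm_comp_chart_symm_apply (hι : MDifferentiable (𝓡 m) (𝓡 n) ι)
    (he : e ∈ IsManifold.maximalAtlas (𝓡 m) ∞ M) (hu : u ∈ e.target)
    (a b : EuclideanSpace ℝ (Fin m)) :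
    g.pullbackForm (ι ∘ e.symm) u a b =
      inducedForm g ι (e.symm u) (chartDerivSymm e u a) (chartDerivSymm e u b) := by
  have hcomp : mfderiv (𝓡 m) (𝓡 n) (ι ∘ e.symm) u =
      (mfderiv (𝓡 m) (𝓡 n) ι (e.symm u)).comp (mfderiv (𝓡 m) (𝓡 m) e.symm u) :=
    mfderiv_comp u (hι _)
      ((mdifferentiable_of_mem_maximalAtlas (by simp) he).mdifferentiableAt_symm hu)
  change g.form ((ι ∘ e.symm) u) (mfderiv (𝓡 m) (𝓡 n) (ι ∘ e.symm) u a)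
    (mfderiv (𝓡 m) (𝓡 n) (ι ∘ e.symm) u b) = _
  rw [hcomp]
  rfl

theorem pullbackForm_comp_chart_symm_eq_zero_iff (hι : MDifferentiable (𝓡 m) (𝓡 n) ι)
    (he : e ∈ IsManifold.maximalAtlas (𝓡 m) ∞ M) (hu : u ∈ e.target)
    {a : EuclideanSpace ℝ (Fin m)} :
    g.pullbackForm (ι ∘ e.symm) u a = 0 ↔
      chartDerivSymm e u a ∈ nullDistribution (m := m) g ι (e.symm u) := by
  refine ⟨fun h b ↦ ?_, fun h ↦ ?_⟩
  · rw [← chartDerivSymm_chartDeriv he hu b, ← pullbackForm_comp_chart_symm_apply g hι he hu, h]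
    rfl
  · ext b
    exact (pullbackForm_comp_chart_symm_apply g hι he hu a b).trans (h _)

theorem finrank_ker_pullbackForm_comp_chart_symm (hι : MDifferentiable (𝓡 m) (𝓡 n) ι)
    (he : e ∈ IsManifold.maximalAtlas (𝓡 m) ∞ M) (hu : u ∈ e.target) :
    Module.finrank ℝ (LinearMap.ker (g.pullbackForm (ι ∘ e.symm) u).toLinearMap) =
      Module.finrank ℝ (nullDistribution (m := m) g ι (e.symm u)) := by
  let D : EuclideanSpace ℝ (Fin m) ≃ₗ[ℝ] TangentSpace (𝓡 m) (e.symm u) :=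
    .ofLinearMap (chartDerivSymm e u).toLinearMap (chartDeriv e (e.symm u)).toLinearMap
      (by ext ξ; exact chartDerivSymm_chartDeriv he hu ξ)
      (by ext ξ : 1; exact chartDeriv_chartDerivSymm he hu ξ)
  have hker : LinearMap.ker (g.pullbackForm (ι ∘ e.symm) u).toLinearMap =
      (nullDistribution (m := m) g ι (e.symm u)).comap D.toLinearMap :=
    Submodule.ext fun _ ↦ pullbackForm_comp_chart_symm_eq_zero_iff g hι he hu
  rw [hker]
  exact (D.ofSubmodule' _).finrank_eq

theorem exists_isNormalForm_nullDistribution (hι : ContMDiff (𝓡 m) (𝓡 n) ∞ ι)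
    (hrank : ∀ x, Module.finrank ℝ (nullDistribution (m := m) g ι x) = 1)
    (he : e ∈ IsManifold.maximalAtlas (𝓡 m) ∞ M) (hu : u ∈ e.target) :
    ∃ ℓ w O, u ∈ O ∧ IsNormalForm (nullDistribution (m := m) g ι) e ℓ w O := by
  have hd : MDifferentiable (𝓡 m) (𝓡 n) ι := hι.mdifferentiable (by simp)
  obtain ⟨ℓ, w, O, hO, huO, hsub, hw, hker⟩ := exists_contDiffOn_ker_eq_span e.open_target
    (g.contDiffOn_pullbackForm e.open_target
      (hι.comp_contMDiffOn (contMDiffOn_symm_of_mem_maximalAtlas he)))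
    (fun u hu a b ↦ by
      simp only [pullbackForm_comp_chart_symm_apply g hd he hu]
      exact g.symm _ _ _)
    (fun u hu ↦ (finrank_ker_pullbackForm_comp_chart_symm g hd he hu).trans (hrank _)) hu
  refine ⟨ℓ, w, O, huO, hO, hsub, hw, fun u hu ↦ (hker u hu).1, fun u hu ξ ↦ ?_⟩
  have hspan : g.pullbackForm (ι ∘ e.symm) u (chartDeriv e (e.symm u) ξ) = 0 ↔
      chartDeriv e (e.symm u) ξ ∈ ℝ ∙ w u := by
    rw [← (hker u hu).2]
    rfl
  rw [pullbackForm_comp_chart_symm_eq_zero_iff g hd he (hsub hu),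
    chartDerivSymm_chartDeriv he (hsub hu), Submodule.mem_span_singleton] at hspan
  simpa only [eq_comm] using hspan

end NullNormalForm

/-! ### Flow boxes of a line field -/

section TangentCurve

variable {E : Type*} [NormedAddCommGroup E] [NormedSpace ℝ E] {M : Type*} [TopologicalSpace M]
  [ChartedSpace E M]

/-- `γ` is differentiable within `J` with velocity in the distribution `N`. -/
def IsTangentCurveOn (N : ∀ x : M, Submodule ℝ (TangentSpace 𝓘(ℝ, E) x)) (γ : ℝ → M)
    (J : Set ℝ) : Prop :=
  ∀ s ∈ J, ∃ ξ ∈ N (γ s),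
    HasMFDerivWithinAt 𝓘(ℝ, ℝ) 𝓘(ℝ, E) γ J s ((1 : ℝ →L[ℝ] ℝ).smulRight ξ)

namespace IsTangentCurveOn

variable {N : ∀ x : M, Submodule ℝ (TangentSpace 𝓘(ℝ, E) x)} {γ : ℝ → M} {J J' : Set ℝ}

theorem mono (h : IsTangentCurveOn N γ J) (hJ : J' ⊆ J) : IsTangentCurveOn N γ J' :=
  fun s hs ↦ (h s (hJ hs)).imp fun _ hξ ↦ ⟨hξ.1, hξ.2.mono hJ⟩

theorem continuousOn (h : IsTangentCurveOn N γ J) : ContinuousOn γ J := fun s hs ↦ by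
  obtain ⟨ξ, -, hξ⟩ := h s hs
  exact hξ.continuousWithinAt

end IsTangentCurveOn

theorem isTangentCurveOn_of_contMDiffOn {m : ℕ} {M : Type*} [TopologicalSpace M]
    [ChartedSpace (EuclideanSpace ℝ (Fin m)) M] {N : ∀ x : M, Submodule ℝ (TangentSpace (𝓡 m) x)}
    {γ : ℝ → M} {J : Set ℝ} (hγ : ContMDiffOn 𝓘(ℝ, ℝ) (𝓡 m) ∞ γ J)
    (h : ∀ t ∈ J, mfderivWithin 𝓘(ℝ, ℝ) (𝓡 m) γ J t (1 : ℝ) ∈ N (γ t)) :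
    IsTangentCurveOn N γ J := by
  refine fun s hs ↦ ⟨_, h s hs,
    ((hγ s hs).mdifferentiableWithinAt (by simp)).hasMFDerivWithinAt.congr_mfderiv ?_⟩
  ext
  exact (one_smul ℝ (mfderivWithin 𝓘(ℝ, ℝ) (𝓡 m) γ J s (1 : ℝ))).symm

theorem hasDerivWithinAt_chart_comp {e : OpenPartialHomeomorph M E}
    (he : e ∈ IsManifold.maximalAtlas 𝓘(ℝ, E) ∞ M) {γ : ℝ → M} {J : Set ℝ} {s : ℝ}
    (hs : γ s ∈ e.source) {ξ : TangentSpace 𝓘(ℝ, E) (γ s)}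
    (h : HasMFDerivWithinAt 𝓘(ℝ, ℝ) 𝓘(ℝ, E) γ J s ((1 : ℝ →L[ℝ] ℝ).smulRight ξ)) :
    HasDerivWithinAt (fun s ↦ e (γ s)) (chartDeriv e (γ s) ξ) J s := by
  have hchart :=
    ((mdifferentiable_of_mem_maximalAtlas (by simp) he).mdifferentiableAt hs).hasMFDerivAt
  have hcomp : HasFDerivWithinAt (fun s ↦ e (γ s))
      ((chartDeriv e (γ s)).comp ((1 : ℝ →L[ℝ] ℝ).smulRight ξ)) J s :=
    (hchart.comp_hasMFDerivWithinAt s h).hasFDerivWithinAt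
  have hone : ((1 : ℝ →L[ℝ] ℝ).smulRight ξ) 1 = ξ := by simp
  exact hcomp.hasDerivWithinAt.congr_deriv (congrArg (chartDeriv e (γ s)) hone)

theorem hasMFDerivWithinAt_chart_symm_comp {e : OpenPartialHomeomorph M E}
    (he : e ∈ IsManifold.maximalAtlas 𝓘(ℝ, E) ∞ M) {c : ℝ → E} {J : Set ℝ} {s : ℝ} {a : E}
    (h : HasDerivWithinAt c a J s) (hs : c s ∈ e.target) :
    HasMFDerivWithinAt 𝓘(ℝ, ℝ) 𝓘(ℝ, E) (fun s ↦ e.symm (c s)) J s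
      ((1 : ℝ →L[ℝ] ℝ).smulRight (chartDerivSymm e (c s) a)) := by
  have hchart :=
    ((mdifferentiable_of_mem_maximalAtlas (by simp) he).mdifferentiableAt_symm hs).hasMFDerivAt
  refine HasMFDerivWithinAt.congr_mfderiv
    (hchart.comp_hasMFDerivWithinAt s h.hasFDerivWithinAt.hasMFDerivWithinAt) ?_
  ext
  change chartDerivSymm e (c s) (ContinuousLinearMap.toSpanSingleton ℝ a 1) =
    (1 : ℝ →L[ℝ] ℝ) 1 • chartDerivSymm e (c s) a
  simp

theorem eq_of_hasDerivWithinAt_zero {f : ℝ → E} {J : Set ℝ} (hJ : Convex ℝ J)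
    (h : ∀ s ∈ J, HasDerivWithinAt f 0 J s) {s t : ℝ} (hs : s ∈ J) (ht : t ∈ J) : f s = f t := by
  have := hJ.norm_image_sub_le_of_norm_hasDerivWithin_le (f := f) (C := 0) h (by simp) ht hs
  simpa [sub_eq_zero] using this

end TangentCurve

/-- A chart in which the line field `N` is spanned by a vector field with a complete flow, together
with a ball on which the flow stays in the domain of the chart. -/
structure FlowBox {E : Type*} [NormedAddCommGroup E] [NormedSpace ℝ E] {M : Type*}
    [TopologicalSpace M] [ChartedSpace E M]
    (N : ∀ x : M, Submodule ℝ (TangentSpace 𝓘(ℝ, E) x)) where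
  /-- The chart. -/
  chart : OpenPartialHomeomorph M E
  /-- The linear form normalizing the vector field. -/
  form : E →L[ℝ] ℝ
  /-- The vector field spanning the line field. -/
  field : E → E
  /-- The flow of the vector field. -/
  flow : E → ℝ → E
  /-- A Lipschitz constant of the vector field. -/
  lip : ℝ≥0
  /-- A bound for the vector field. -/
  bound : ℝ≥0
  /-- The open set where the vector field spans the line field. -/
  region : Set E
  /-- The centre of the box. -/
  center : E
  /-- The radius of the box. -/
  radius : ℝ
  mem_maximalAtlas : chart ∈ IsManifold.maximalAtlas 𝓘(ℝ, E) ∞ M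
  contDiff_field : ContDiff ℝ ∞ field
  isTransverseFlow : IsTransverseFlow form field flow lip bound
  isNormalForm : IsNormalForm N chart form field region
  radius_pos : 0 < radius
  flow_mem : ∀ z ∈ Metric.ball center radius, ∀ z' ∈ Metric.ball center radius,
    ∀ s ∈ Icc (0 : ℝ) 1, flow z (s * (form z' - form z)) ∈ region

section FlowBox

variable {E : Type*} [NormedAddCommGroup E] [NormedSpace ℝ E] {M : Type*} [TopologicalSpace M]
  [ChartedSpace E M] {N : ∀ x : M, Submodule ℝ (TangentSpace 𝓘(ℝ, E) x)}

theorem IsNormalForm.exists_flowBox [FiniteDimensional ℝ E] {e : OpenPartialHomeomorph M E}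
    {ℓ : E →L[ℝ] ℝ} {w : E → E} {O : Set E} (h : IsNormalForm N e ℓ w O)
    (he : e ∈ IsManifold.maximalAtlas 𝓘(ℝ, E) ∞ M) {x : M} (hx : x ∈ e.source) (hxO : e x ∈ O) :
    ∃ b : FlowBox N, x ∈ b.chart.source ∧ b.chart x = b.center := by
  obtain ⟨w', α, K, L, hw', hev, hα⟩ :=
    exists_isTransverseFlow (h.isOpen.mem_nhds hxO) h.contDiffOn h.normalized
  obtain ⟨r, hr, hball⟩ := Metric.mem_nhds_iff.1 (inter_mem (h.isOpen.mem_nhds hxO) hev)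
  obtain ⟨ρ, hρ, hmem⟩ := hα.exists_flow_mul_sub_mem_ball (e x) hr
  exact ⟨⟨e, ℓ, w', α, K, L, Metric.ball (e x) r, e x, ρ, he, hw', hα,
    h.congr Metric.isOpen_ball (fun u hu ↦ (hball hu).1) (fun u hu ↦ (hball hu).2), hρ, hmem⟩,
    hx, rfl⟩

namespace FlowBox

section Basic

variable (b : FlowBox N)

/-- The domain of a flow box. -/
def domain : Set M := b.chart.source ∩ b.chart ⁻¹' Metric.ball b.center b.radius

/-- The projection of a flow box along the leaves of the line field. -/
def proj (x : M) : E := flowProj b.form b.flow (b.form b.center) (b.chart x)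

theorem isOpen_domain : IsOpen b.domain := b.chart.isOpen_inter_preimage Metric.isOpen_ball

theorem continuousOn_proj : ContinuousOn b.proj b.domain :=
  (b.isTransverseFlow.continuous_flowProj b.center).comp_continuousOn
    (b.chart.continuousOn.mono inter_subset_left)

theorem form_proj (x : M) : b.form (b.proj x) = b.form b.center :=
  b.isTransverseFlow.form_flowProj _ _

theorem ball_subset_region : Metric.ball b.center b.radius ⊆ b.region := fun z hz ↦ by
  simpa [b.isTransverseFlow.zero] using b.flow_mem z hz z hz 0 (by simp)

theorem chart_symm_mem_domain {z : E} (hz : z ∈ Metric.ball b.center b.radius) :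
    b.chart.symm z ∈ b.domain := by
  have ht := b.isNormalForm.subset (b.ball_subset_region hz)
  exact ⟨b.chart.map_target ht, by rwa [mem_preimage, b.chart.right_inv ht]⟩

theorem proj_chart_symm_flow {z : E} {τ : ℝ} (h : b.flow z τ ∈ b.chart.target) :
    b.proj (b.chart.symm (b.flow z τ)) = flowProj b.form b.flow (b.form b.center) z := by
  rw [proj, b.chart.right_inv h, b.isTransverseFlow.flowProj_flow]

theorem proj_chart_symm_of_form_eq {z : E} (hz : z ∈ b.chart.target)
    (h : b.form z = b.form b.center) : b.proj (b.chart.symm z) = z := by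
  rw [proj, b.chart.right_inv hz, b.isTransverseFlow.flowProj_of_form_eq h]

theorem flow_eq_of_proj_eq {x y : M} (h : b.proj x = b.proj y) :
    b.chart y = b.flow (b.chart x) (b.form (b.chart y) - b.form (b.chart x)) :=
  b.isTransverseFlow.eq_flow_of_flowProj_eq h

end Basic

variable {b : FlowBox N} {γ : ℝ → M} {J : Set ℝ}

theorem hasDerivWithinAt_proj_comp {s : ℝ} (hγ : IsTangentCurveOn N γ J) (hs : s ∈ J)
    (hsb : γ s ∈ b.domain) : HasDerivWithinAt (fun s ↦ b.proj (γ s)) 0 J s := by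
  obtain ⟨ξ, hξ, hd⟩ := hγ s hs
  obtain ⟨a, ha⟩ := b.isNormalForm.exists_chartDeriv_eq_smul hsb.1 (b.ball_subset_region hsb.2) hξ
  have hchart := hasDerivWithinAt_chart_comp b.mem_maximalAtlas hsb.1 hd
  rw [ha] at hchart
  exact b.isTransverseFlow.hasDerivWithinAt_flowProj_comp b.center (c := fun s ↦ b.chart (γ s))
    hchart.hasFDerivWithinAt.isBigO_sub
    (isLittleO_transverseProj_sub (b.isTransverseFlow.normalized _) hchart)

theorem proj_eq_of_isTangentCurveOn (hJ : Convex ℝ J) (hγ : IsTangentCurveOn N γ J)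
    (hb : ∀ s ∈ J, γ s ∈ b.domain) {s t : ℝ} (hs : s ∈ J) (ht : t ∈ J) :
    b.proj (γ s) = b.proj (γ t) :=
  eq_of_hasDerivWithinAt_zero (f := fun s ↦ b.proj (γ s)) hJ
    (fun s hs ↦ hasDerivWithinAt_proj_comp hγ hs (hb s hs)) hs ht

theorem eventually_proj_eq_of_isTangentCurveOn (hJ : Convex ℝ J) (hγ : IsTangentCurveOn N γ J)
    {s₀ : ℝ} (hs₀ : s₀ ∈ J) (hb : γ s₀ ∈ b.domain) :
    ∀ᶠ s in 𝓝[J] s₀, γ s ∈ b.domain ∧ b.proj (γ s) = b.proj (γ s₀) := by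
  have hdom : ∀ᶠ s in 𝓝[J] s₀, γ s ∈ b.domain :=
    (hγ.continuousOn s₀ hs₀).eventually (b.isOpen_domain.mem_nhds hb)
  obtain ⟨ε, hε, hball⟩ := Metric.mem_nhdsWithin_iff.1 hdom
  filter_upwards [inter_mem_nhdsWithin J (Metric.ball_mem_nhds s₀ hε)] with s hs
  exact ⟨hball hs.symm, proj_eq_of_isTangentCurveOn ((convex_ball s₀ ε).inter hJ)
    (hγ.mono inter_subset_right) (fun s hs ↦ hball hs) hs.symm ⟨Metric.mem_ball_self hε, hs₀⟩⟩

theorem isTangentCurveOn_flow {z : E} {τ : ℝ} (h : ∀ s ∈ J, b.flow z (s * τ) ∈ b.region) :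
    IsTangentCurveOn N (fun s ↦ b.chart.symm (b.flow z (s * τ))) J := by
  intro s hs
  have hflow : HasDerivAt (fun s ↦ b.flow z (s * τ)) (τ • b.field (b.flow z (s * τ))) s :=
    (b.isTransverseFlow.hasDerivAt z (s * τ)).scomp s (hasDerivAt_mul_const τ)
  exact ⟨_, b.isNormalForm.chartDerivSymm_mem b.mem_maximalAtlas (h s hs) τ,
    hasMFDerivWithinAt_chart_symm_comp b.mem_maximalAtlas hflow.hasDerivWithinAt
      (b.isNormalForm.subset (h s hs))⟩

end FlowBox

end FlowBox

namespace FlowBox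

variable {m : ℕ} {M : Type*} [TopologicalSpace M] [ChartedSpace (EuclideanSpace ℝ (Fin m)) M]
  {N : ∀ x : M, Submodule ℝ (TangentSpace (𝓡 m) x)} {b : FlowBox N} {x y : M}

theorem joinedByTangentArc (hx : x ∈ b.domain) (hy : y ∈ b.domain) (h : b.proj x = b.proj y) :
    JoinedByTangentArc N x y := by
  set τ := b.form (b.chart y) - b.form (b.chart x) with hτ
  have hmem : ∀ s ∈ Icc (0 : ℝ) 1, b.flow (b.chart x) (s * τ) ∈ b.region :=
    b.flow_mem _ hx.2 _ hy.2
  refine ⟨fun s ↦ b.chart.symm (b.flow (b.chart x) (s * τ)), ?_, ?_, ?_, fun t ht ↦ ?_⟩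
  · have hflow : ContDiff ℝ ∞ (fun s : ℝ ↦ b.flow (b.chart x) (s * τ)) :=
      (b.isTransverseFlow.contDiff_flow b.contDiff_field _).comp (contDiff_id.mul contDiff_const)
    exact (contMDiffOn_symm_of_mem_maximalAtlas b.mem_maximalAtlas).comp hflow.contMDiff.contMDiffOn
      fun s hs ↦ b.isNormalForm.subset (hmem s hs)
  · simp [b.isTransverseFlow.zero, b.chart.left_inv hx.1]
  · simp only [one_mul]
    rw [hτ, ← b.flow_eq_of_proj_eq h, b.chart.left_inv hy.1]
  · obtain ⟨ξ, hξ, hd⟩ := isTangentCurveOn_flow hmem t ht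
    rw [hd.mfderivWithin ((uniqueDiffOn_Icc_zero_one t ht).uniqueMDiffWithinAt)]
    have hone : ((1 : ℝ →L[ℝ] ℝ).smulRight ξ) 1 = ξ := by simp
    exact hone.symm ▸ hξ

theorem leafSetoid_rel (hx : x ∈ b.domain) (hy : y ∈ b.domain) (h : b.proj x = b.proj y) :
    leafSetoid N x y :=
  .rel _ _ (joinedByTangentArc hx hy h)

end FlowBox

/-! ### The plaque atlas of a line field -/

theorem dimH_setOf_form_eq_le {E : Type*} [NormedAddCommGroup E] [NormedSpace ℝ E]
    [FiniteDimensional ℝ E] {ℓ : E →L[ℝ] ℝ} (hℓ : ℓ ≠ 0) (u : E) :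
    dimH {x | ℓ x = ℓ u} ≤ ((Module.finrank ℝ E - 1 : ℕ) : ENNReal) := by
  let f : LinearMap.ker ℓ.toLinearMap → E := fun k ↦ (k : E) + u
  have hf : Isometry f := Isometry.of_dist_eq fun a b ↦ by simp [f, Subtype.dist_eq]
  have himage : {x | ℓ x = ℓ u} ⊆ f '' univ := fun x (hx : ℓ x = ℓ u) ↦
    ⟨⟨x - u, by simp [hx]⟩, mem_univ _, by simp [f]⟩
  have hrank := Module.Dual.finrank_ker_add_one_of_ne_zero
    (f := ℓ.toLinearMap) fun h ↦ hℓ (by ext x; exact LinearMap.congr_fun h x)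
  calc dimH {x | ℓ x = ℓ u} ≤ dimH (f '' univ) := dimH_mono himage
    _ = dimH (univ : Set (LinearMap.ker ℓ.toLinearMap)) := hf.dimH_image _
    _ = ((Module.finrank ℝ (LinearMap.ker ℓ.toLinearMap) : ℕ) : ENNReal) :=
        Real.dimH_univ_eq_finrank _
    _ = ((Module.finrank ℝ E - 1 : ℕ) : ENNReal) := by rw [← hrank, Nat.add_sub_cancel]

namespace FlowBox

section Transition

variable {E : Type*} [NormedAddCommGroup E] [NormedSpace ℝ E] {M : Type*} [TopologicalSpace M]
  [ChartedSpace E M] {N : ∀ x : M, Submodule ℝ (TangentSpace 𝓘(ℝ, E) x)} (b b' : FlowBox N)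

theorem form_ne_zero : b.form ≠ 0 := fun h ↦ by
  simpa [h] using b.isTransverseFlow.normalized b.center

theorem dimH_proj_image_le [FiniteDimensional ℝ E] (S : Set M) :
    dimH (b.proj '' S) ≤ ((Module.finrank ℝ E - 1 : ℕ) : ENNReal) :=
  have hsub : b.proj '' S ⊆ {z | b.form z = b.form b.center} :=
    image_subset_iff.2 fun x _ ↦ b.form_proj x
  (dimH_mono hsub).trans (dimH_setOf_form_eq_le b.form_ne_zero b.center)

variable {b b'}

theorem proj_chart_symm_flow_eq {x : M} {τ : ℝ} (hx : x ∈ b.chart.source)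
    (hb : ∀ s ∈ Icc (0 : ℝ) 1, b.flow (b.chart x) (s * τ) ∈ b.region)
    (hb' : ∀ s ∈ Icc (0 : ℝ) 1, b.chart.symm (b.flow (b.chart x) (s * τ)) ∈ b'.domain) :
    b'.proj (b.chart.symm (b.flow (b.chart x) τ)) = b'.proj x := by
  simpa [b.isTransverseFlow.zero, b.chart.left_inv hx] using
    proj_eq_of_isTangentCurveOn (convex_Icc (0 : ℝ) 1) (isTangentCurveOn_flow hb) hb'
      (s := 1) (t := 0) (by simp) (by simp)

theorem continuousAt_flow_chart {x : M} (hx : x ∈ b.chart.source) (τ : ℝ) :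
    ContinuousAt (fun y ↦ b.flow (b.chart y) τ) x :=
  (b.isTransverseFlow.continuous_flow_left τ).continuousAt.comp (b.chart.continuousAt hx)

theorem exists_lipschitzOnWith_proj_chart_symm {z : M} (hz : z ∈ b.domain ∩ b'.domain) :
    ∃ η > 0, ∃ K : ℝ≥0, Metric.ball (b.chart z) η ⊆ Metric.ball b.center b.radius ∧
      (∀ y ∈ Metric.ball (b.chart z) η, b.chart.symm y ∈ b'.domain) ∧
      LipschitzOnWith K (fun y ↦ b'.proj (b.chart.symm y)) (Metric.ball (b.chart z) η) := by
  have htarget : b.chart z ∈ b.chart.target := b.chart.map_source hz.1.1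
  have hleft := b.chart.left_inv hz.1.1
  have htransition : ContMDiffAt 𝓘(ℝ, E) 𝓘(ℝ, E) ∞ (b'.chart ∘ b.chart.symm) (b.chart z) := by
    refine ContMDiffAt.comp (b.chart z) (I' := 𝓘(ℝ, E)) ?_
      ((contMDiffOn_symm_of_mem_maximalAtlas b.mem_maximalAtlas).contMDiffAt
        (b.chart.open_target.mem_nhds htarget))
    rw [hleft]
    exact (contMDiffOn_of_mem_maximalAtlas b'.mem_maximalAtlas).contMDiffAt
      (b'.chart.open_source.mem_nhds hz.2.1)
  obtain ⟨K₁, s, hs, hK₁⟩ := (htransition.contDiffAt.of_le (n := ∞)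
    (WithTop.coe_le_coe.2 (le_top : (1 : ℕ∞) ≤ ⊤))).exists_lipschitzOnWith
  obtain ⟨K₂, hK₂⟩ := b'.isTransverseFlow.exists_lipschitzOnWith_flowProj b'.center b'.radius
  have hdom : b.chart.symm ⁻¹' b'.domain ∈ 𝓝 (b.chart z) :=
    b.chart.continuousAt_symm htarget (b'.isOpen_domain.mem_nhds (hleft.symm ▸ hz.2))
  obtain ⟨η, hη, hball⟩ := Metric.mem_nhds_iff.1
    (inter_mem (inter_mem hs hdom) (Metric.isOpen_ball.mem_nhds hz.1.2))
  exact ⟨η, hη, K₂ * K₁, fun y hy ↦ (hball hy).2, fun y hy ↦ (hball hy).1.2,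
    hK₂.comp (hK₁.mono fun y hy ↦ (hball hy).1.1) fun y hy ↦
      Metric.ball_subset_closedBall (hball hy).1.2.2⟩

-- Points near `z` are first moved along the flow lines to the hyperplane of `form` through `z`.
theorem exists_dist_proj_le {z : M} (hz : z ∈ b.domain ∩ b'.domain) :
    ∃ O ∈ 𝓝 z, ∃ K : ℝ≥0, ∀ x ∈ O, ∀ y ∈ O,
      dist (b'.proj x) (b'.proj y) ≤ K * dist (b.proj x) (b.proj y) := by
  obtain ⟨η, hη, K, hηb, hηb', hK⟩ := exists_lipschitzOnWith_proj_chart_symm hz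
  set a := b.chart z
  obtain ⟨ρ, hρ, harc⟩ := b.isTransverseFlow.exists_flow_mul_sub_mem_ball a hη
  have ha : a ∈ Metric.ball a ρ := Metric.mem_ball_self hρ
  let O : Set M := b.chart.source ∩ b.chart ⁻¹' Metric.ball a ρ
  have hO : O ∈ 𝓝 z := (b.chart.isOpen_inter_preimage Metric.isOpen_ball).mem_nhds ⟨hz.1.1, ha⟩
  set c := b.form a - b.form b.center
  have hslice : ∀ x ∈ O, b.flow (b.proj x) c ∈ Metric.ball a η ∧
      b'.proj (b.chart.symm (b.flow (b.proj x) c)) = b'.proj x := by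
    intro x hx
    rw [show b.flow (b.proj x) c = b.flow (b.chart x) (b.form a - b.form (b.chart x)) from
      b.isTransverseFlow.flow_flowProj _ _ _]
    have hxa := harc _ hx.2 a ha
    exact ⟨by simpa using hxa 1 (by simp), proj_chart_symm_flow_eq hx.1
      (fun s hs ↦ b.ball_subset_region (hηb (hxa s hs))) fun s hs ↦ hηb' _ (hxa s hs)⟩
  refine ⟨O, hO, K * (Real.exp (b.lip * |c|)).toNNReal, fun x hx y hy ↦ ?_⟩
  rw [← (hslice x hx).2, ← (hslice y hy).2, NNReal.coe_mul, mul_assoc,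
    Real.coe_toNNReal _ (Real.exp_nonneg _), mul_comm (Real.exp _)]
  refine (hK.dist_le_mul _ (hslice x hx).1 _ (hslice y hy).1).trans ?_
  gcongr
  exact b.isTransverseFlow.dist_le _ _ _

theorem eventually_proj_eq_of_eventually_proj_eq {γ : ℝ → M} {J : Set ℝ} {s₀ : ℝ}
    (hγ : ContinuousWithinAt γ J s₀) (hs₀ : γ s₀ ∈ b.domain ∩ b'.domain)
    (h : ∀ᶠ s in 𝓝[J] s₀, b.proj (γ s) = b.proj (γ s₀)) :
    ∀ᶠ s in 𝓝[J] s₀, b'.proj (γ s) = b'.proj (γ s₀) := by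
  obtain ⟨O, hO, K, hK⟩ := exists_dist_proj_le hs₀
  filter_upwards [h, hγ hO] with s hs hsO
  simpa [hs] using hK _ hsO _ (mem_of_mem_nhds hO)

variable (b) in
theorem exists_isCompact_transversal [FiniteDimensional ℝ E] {x : M}
    (hx : x ∈ b.chart.source) (hxb : b.chart x = b.center) :
    x ∈ b.domain ∧ ∃ S ⊆ b.domain, IsCompact S ∧ x ∈ S ∧ InjOn b.proj S ∧
      ∃ ε > 0, ∀ z ∈ b.domain, dist (b.proj z) (b.proj x) < ε →
        ∃ z' ∈ S, b.proj z' = b.proj z := by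
  have hr := b.radius_pos
  let D : Set E := {z | b.form z = b.form b.center} ∩ Metric.closedBall b.center (b.radius / 2)
  have hball : D ⊆ Metric.ball b.center b.radius := fun z hz ↦
    Metric.closedBall_subset_ball (by linarith) hz.2
  have htarget : D ⊆ b.chart.target := fun z hz ↦
    b.isNormalForm.subset (b.ball_subset_region (hball hz))
  have hD : IsCompact D := (isCompact_closedBall _ _).inter_left
    (isClosed_eq b.form.continuous continuous_const)
  have hproj : ∀ z ∈ D, b.proj (b.chart.symm z) = z := fun z hz ↦
    b.proj_chart_symm_of_form_eq (htarget hz) hz.1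
  have hcenter : b.center ∈ D := ⟨rfl, Metric.mem_closedBall_self (by positivity)⟩
  have hxe : b.chart.symm b.center = x := by rw [← hxb, b.chart.left_inv hx]
  refine ⟨hxe ▸ b.chart_symm_mem_domain (hball hcenter), b.chart.symm '' D, ?_,
    hD.image_of_continuousOn (b.chart.continuousOn_symm.mono htarget), ⟨_, hcenter, hxe⟩, ?_,
    b.radius / 2, by positivity, fun z _ hzx ↦ ?_⟩
  · rintro _ ⟨z, hz, rfl⟩
    exact b.chart_symm_mem_domain (hball hz)
  · rintro _ ⟨z, hz, rfl⟩ _ ⟨z', hz', rfl⟩ h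
    rw [hproj z hz, hproj z' hz'] at h
    rw [h]
  · rw [← hxe, hproj _ hcenter] at hzx
    have hmem : b.proj z ∈ D := ⟨b.form_proj z, Metric.mem_closedBall.2 hzx.le⟩
    exact ⟨_, ⟨_, hmem, rfl⟩, hproj _ hmem⟩

end Transition

section Leaf

variable {m : ℕ} {M : Type*} [TopologicalSpace M] [ChartedSpace (EuclideanSpace ℝ (Fin m)) M]
  {N : ∀ x : M, Submodule ℝ (TangentSpace (𝓡 m) x)}

theorem eqvGen_samePlaque_of_leafSetoid {J : Set (FlowBox N)} (hJ : ∀ x, ∃ b ∈ J, x ∈ b.domain)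
    {x y : M} (hxy : leafSetoid N x y) :
    Relation.EqvGen (SamePlaque (fun b : FlowBox N ↦ b.domain) (fun b ↦ b.proj) J) x y := by
  have hxy' : Relation.EqvGen (JoinedByTangentArc N) x y := hxy
  induction hxy' with
  | rel x y h =>
    obtain ⟨γ, hγ, rfl, rfl, htan⟩ := h
    have hcurve := isTangentCurveOn_of_contMDiffOn hγ htan
    refine isPreconnected_Icc.induction₂ (s := Icc (0 : ℝ) 1)
      (fun s t ↦ Relation.EqvGen (SamePlaque (fun b : FlowBox N ↦ b.domain) (fun b ↦ b.proj) J)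
        (γ s) (γ t)) (fun s hs ↦ ?_) (fun _ _ _ _ _ _ h₁ h₂ ↦ h₁.trans _ _ _ h₂)
      (fun _ _ _ _ h ↦ h.symm) (by simp) (by simp)
    obtain ⟨b, hb, hsb⟩ := hJ (γ s)
    filter_upwards [eventually_proj_eq_of_isTangentCurveOn (convex_Icc _ _) hcurve hs hsb] with t ht
    exact .rel _ _ ⟨b, hb, hsb, ht.1, ht.2.symm⟩
  | refl x => exact .refl x
  | symm x y h ih => exact (ih h).symm
  | trans x y z h₁ h₂ ih₁ ih₂ => exact (ih₁ h₁).trans _ _ _ (ih₂ h₂)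

theorem eventually_exists_leafSetoid_rel {b : FlowBox N} {y z : M} (hy : y ∈ b.domain)
    (hz : z ∈ b.domain) (hyz : b.proj y = b.proj z) {O : Set M} (hO : O ∈ 𝓝 z) :
    ∀ᶠ y' in 𝓝 y, ∃ z' ∈ O, leafSetoid N y' z' := by
  have hflow := b.flow_eq_of_proj_eq hyz
  set τ := b.form (b.chart z) - b.form (b.chart y)
  have htarget : b.flow (b.chart y) τ ∈ b.chart.target := hflow ▸ b.chart.map_source hz.1
  have hcont : ContinuousAt (fun y' ↦ b.chart.symm (b.flow (b.chart y') τ)) y :=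
    ContinuousAt.comp (f := fun y' ↦ b.flow (b.chart y') τ) (b.chart.continuousAt_symm htarget)
      (continuousAt_flow_chart hy.1 τ)
  have hmem : O ∩ b.domain ∈ 𝓝 (b.chart.symm (b.flow (b.chart y) τ)) := by
    rw [← hflow, b.chart.left_inv hz.1]
    exact inter_mem hO (b.isOpen_domain.mem_nhds hz)
  filter_upwards [hcont hmem, continuousAt_flow_chart hy.1 τ (b.chart.open_target.mem_nhds htarget),
    b.isOpen_domain.mem_nhds hy] with y' hy'O hy't hy'
  exact ⟨_, hy'O.1, leafSetoid_rel hy' hy'O.2 (b.proj_chart_symm_flow hy't).symm⟩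

theorem plaqueAtlas (hbox : ∀ x, ∃ b : FlowBox N, x ∈ b.chart.source ∧ b.chart x = b.center) :
    PlaqueAtlas (leafSetoid N) (fun b : FlowBox N ↦ b.domain) (fun b ↦ b.proj) (m - 1) where
  isOpen b := b.isOpen_domain
  continuousOn b := b.continuousOn_proj
  rel _ _ hx _ hy h := leafSetoid_rel hx hy h
  generated _ hJ _ _ hxy := eqvGen_samePlaque_of_leafSetoid hJ hxy
  lipschitz _ _ _ hz := exists_dist_proj_le hz
  plaque_open _ _ hy _ hz hyz _ hO := eventually_exists_leafSetoid_rel hy hz hyz hO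
  exists_transversal x := by
    obtain ⟨b, hx, hxb⟩ := hbox x
    exact ⟨b, b.exists_isCompact_transversal hx hxb⟩
  dimH_le b := by simpa using b.dimH_proj_image_le b.domain

end Leaf

end FlowBox

/-! ### Invariance of the leaves under a projectable evolution -/

theorem forall_of_eventually_forall_add {Q : ℝ≥0 → Prop} (h0 : Q 0)
    (h : ∀ t, ∃ δ > 0, ∀ᶠ t₁ in 𝓝 t, Q t₁ → ∀ s ≤ δ, Q (t₁ + s)) (t : ℝ≥0) : Q t := by
  let S : Set ℝ≥0 := {t | ∀ t' ≤ t, Q t'}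
  have hS : S.Nonempty := ⟨0, fun t' ht' ↦ by rwa [le_zero_iff.1 ht']⟩
  by_contra hQ
  have hbdd : BddAbove S := ⟨t, fun x hx ↦ le_of_not_ge fun hle ↦ hQ (hx t hle)⟩
  obtain ⟨δ, hδ, hstep⟩ := h (sSup S)
  have hnear : ∀ᶠ t₁ in 𝓝 (sSup S), sSup S < t₁ + δ :=
    (continuous_id.add continuous_const).tendsto (sSup S) |>.eventually_const_lt
      (lt_add_of_pos_right _ hδ)
  obtain ⟨t₁, ⟨ht₁, hlt⟩, ht₁S⟩ :=
    mem_closure_iff_nhds.1 (csSup_mem_closure hS hbdd) _ (hstep.and hnear)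
  refine hlt.not_ge (le_csSup hbdd fun t' ht' ↦ ?_)
  rcases le_total t' t₁ with hle | hle
  · exact ht₁S t' hle
  · rw [← add_tsub_cancel_of_le hle]
    exact ht₁ (ht₁S t₁ le_rfl) _ (tsub_le_iff_left.2 ht')

theorem exists_forall_flow_mem {M : Type*} [TopologicalSpace M] (φ : Flow ℝ≥0 M) {x₀ : M}
    {O : Set M} (hO : O ∈ 𝓝 x₀) : ∃ O' ∈ 𝓝 x₀, ∃ δ > 0, ∀ x ∈ O', ∀ t ≤ δ, φ t x ∈ O := by
  have hcont : ContinuousAt (fun q : ℝ≥0 × M ↦ φ q.1 q.2) (0, x₀) :=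
    (φ.continuous continuous_fst continuous_snd).continuousAt
  have hev : ∀ᶠ q in 𝓝 (0 : ℝ≥0) ×ˢ 𝓝 x₀, φ q.1 q.2 ∈ O := by
    rw [← nhds_prod_eq]
    exact hcont (by simpa only [Flow.map_zero_apply] using hO)
  obtain ⟨P, hP, O', hO', hPO⟩ := mem_prod_iff.1 hev
  obtain ⟨ε, hε, hεP⟩ := NNReal.nhds_zero_basis.mem_iff.1 hP
  obtain ⟨δ, hδ, hδε⟩ := exists_between hε
  exact ⟨O', hO', δ, hδ, fun x hx t ht ↦ hPO (mk_mem_prod (hεP (ht.trans_lt hδε)) hx)⟩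

section Evolution

variable {m : ℕ} {M : Type*} [TopologicalSpace M] [ChartedSpace (EuclideanSpace ℝ (Fin m)) M]
  {N : ∀ x : M, Submodule ℝ (TangentSpace (𝓡 m) x)}
  {V : ∀ x : M, TangentSpace (𝓡 m) x} {φ : Flow ℝ≥0 M}

theorem hasDerivWithinAt_chart_evolution {e : OpenPartialHomeomorph M (EuclideanSpace ℝ (Fin m))}
    (he : e ∈ IsManifold.maximalAtlas (𝓡 m) ∞ M) (hφ : IsEvolutionOf φ V) {x : M} {t : ℝ}
    (ht : 0 ≤ t) (hx : φ t.toNNReal x ∈ e.source) :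
    HasDerivWithinAt (fun t : ℝ ↦ e (φ t.toNNReal x)) (chartField e V (e (φ t.toNNReal x)))
      (Ici 0) t := by
  rw [chartField_apply he (e.map_source hx), e.left_inv hx]
  exact hasDerivWithinAt_chart_comp he (γ := fun t : ℝ ↦ φ t.toNNReal x) hx (hφ x t ht)

theorem PreservesDirectionOn.exists_norm_chart_evolution_sub_le
    {e : OpenPartialHomeomorph M (EuclideanSpace ℝ (Fin m))}
    {ℓ : EuclideanSpace ℝ (Fin m) →L[ℝ] ℝ}
    {w : EuclideanSpace ℝ (Fin m) → EuclideanSpace ℝ (Fin m)} {G : Set (EuclideanSpace ℝ (Fin m))}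
    {C L : ℝ≥0} (h : PreservesDirectionOn ℓ (chartField e V) w G C L)
    (he : e ∈ IsManifold.maximalAtlas (𝓡 m) ∞ M) (hφ : IsEvolutionOf φ V) (δ : ℝ≥0) :
    ∃ C₁ C₂ C₃ : ℝ, ∀ x y, (∀ t ≤ δ, φ t x ∈ e.source ∩ e ⁻¹' G) →
      (∀ t ≤ δ, φ t y ∈ e.source ∩ e ⁻¹' G) → ∀ t ≤ δ,
        ‖e (φ t y) - e (φ t x)‖ ≤ C₁ * ‖e y - e x‖ ∧
        ‖transverseProj ℓ (w (e (φ t x))) (e (φ t y) - e (φ t x))‖ ≤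
          C₂ * (‖transverseProj ℓ (w (e x)) (e y - e x)‖ + C₃ * ‖e y - e x‖ ^ 2) := by
  let orbit (x : M) (t : ℝ) := e (φ t.toNNReal x)
  have hmem : ∀ {x}, (∀ t ≤ δ, φ t x ∈ e.source ∩ e ⁻¹' G) → ∀ t ∈ Icc (0 : ℝ) δ,
      φ t.toNNReal x ∈ e.source ∩ e ⁻¹' G := fun hx t ht ↦
    hx _ (Real.toNNReal_le_iff_le_coe.2 ht.2)
  have hderiv : ∀ {x}, (∀ t ≤ δ, φ t x ∈ e.source ∩ e ⁻¹' G) → ∀ t ∈ Icc (0 : ℝ) δ,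
      HasDerivWithinAt (orbit x) (chartField e V (orbit x t)) (Ici 0) t := fun hx t ht ↦
    hasDerivWithinAt_chart_evolution he hφ ht.1 (hmem hx t ht).1
  have hcont : ∀ {x}, (∀ t ≤ δ, φ t x ∈ e.source ∩ e ⁻¹' G) →
      ContinuousOn (orbit x) (Icc 0 δ) := fun hx t ht ↦
    (hderiv hx t ht).continuousWithinAt.mono Icc_subset_Ici_self
  have hright : ∀ {x}, (∀ t ≤ δ, φ t x ∈ e.source ∩ e ⁻¹' G) → ∀ t ∈ Ico (0 : ℝ) δ,
      HasDerivWithinAt (orbit x) (chartField e V (orbit x t)) (Ici t) t := fun hx t ht ↦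
    (hderiv hx t (Ico_subset_Icc_self ht)).mono (Ici_subset_Ici.2 ht.1)
  refine ⟨Real.exp (C * δ), Real.exp ((1 + ‖ℓ‖ * L) * C * δ),
    (1 + ‖ℓ‖ * L) * C * Real.exp (C * δ) ^ 2 * δ, fun x y hx hy t ht ↦ ⟨?_, ?_⟩⟩
  · simpa [orbit] using h.norm_sub_le (hcont hx) (hcont hy) (fun t ht ↦ (hmem hx t ht).2)
      (fun t ht ↦ (hmem hy t ht).2) (hright hx) (hright hy) (t := t) ⟨t.2, ht⟩
  · have := h.norm_transverseProj_sub_le (hcont hx) (hcont hy) (fun t ht ↦ (hmem hx t ht).2)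
      (fun t ht ↦ (hmem hy t ht).2) (hright hx) (hright hy) (t := t) ⟨t.2, ht⟩
    simp only [orbit, Real.toNNReal_coe, Real.toNNReal_zero, Flow.map_zero_apply] at this
    exact this.trans_eq (by ring)

namespace FlowBox

theorem proj_map_eq_of_norm_sub_le (b : FlowBox N) {f : M → M} {C₁ C₂ C₃ : ℝ} {O : Set M}
    (hf : ∀ x ∈ O, ∀ y ∈ O,
      ‖b.chart (f y) - b.chart (f x)‖ ≤ C₁ * ‖b.chart y - b.chart x‖ ∧
      ‖transverseProj b.form (b.field (b.chart (f x))) (b.chart (f y) - b.chart (f x))‖ ≤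
        C₂ * (‖transverseProj b.form (b.field (b.chart x)) (b.chart y - b.chart x)‖ +
          C₃ * ‖b.chart y - b.chart x‖ ^ 2))
    {x y : M} (hx : x ∈ b.chart.source) (hy : y ∈ b.chart.source) (hxy : b.proj x = b.proj y)
    (harc : ∀ s ∈ Icc (0 : ℝ) 1,
      b.flow (b.chart x) (s * (b.form (b.chart y) - b.form (b.chart x))) ∈
        b.chart.target ∩ b.chart.symm ⁻¹' O) :
    b.proj (f x) = b.proj (f y) := by
  set τ := b.form (b.chart y) - b.form (b.chart x)
  let arc (s : ℝ) := b.flow (b.chart x) (s * τ)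
  have hderiv : ∀ s₀ ∈ Icc (0 : ℝ) 1,
      HasDerivWithinAt (fun s ↦ b.proj (f (b.chart.symm (arc s)))) 0 (Icc 0 1) s₀ := by
    intro s₀ hs₀
    have harcd : HasDerivAt arc (τ • b.field (arc s₀)) s₀ :=
      (b.isTransverseFlow.hasDerivAt _ (s₀ * τ)).scomp s₀ (hasDerivAt_mul_const τ)
    refine b.isTransverseFlow.hasDerivWithinAt_flowProj_comp_of_norm_le b.center
      (c := fun s ↦ b.chart (f (b.chart.symm (arc s)))) (C₁ := C₁) (C₂ := C₂) (C₃ := C₃)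
      harcd.hasDerivWithinAt ?_ ?_
    all_goals
      filter_upwards [self_mem_nhdsWithin] with s hs
      have := hf _ (harc s₀ hs₀).2 _ (harc s hs).2
      rw [b.chart.right_inv (harc s hs).1, b.chart.right_inv (harc s₀ hs₀).1] at this
    exacts [this.1, this.2]
  have harc₀ : b.chart.symm (arc 0) = x := by
    simp [arc, b.isTransverseFlow.zero, b.chart.left_inv hx]
  have harc₁ : b.chart.symm (arc 1) = y := by
    simp only [arc, one_mul, τ]
    rw [← b.flow_eq_of_proj_eq hxy, b.chart.left_inv hy]
  have := eq_of_hasDerivWithinAt_zero (convex_Icc (0 : ℝ) 1) hderiv (s := 0) (t := 1)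
    (by simp) (by simp)
  rwa [harc₀, harc₁] at this

variable [T2Space M] [IsManifold (𝓡 m) ∞ M]

theorem exists_preservesDirectionOn (b : FlowBox N) (hV : IsVectorFieldOfClass 2 V)
    (hproj : IsProjectable N V) {u : EuclideanSpace ℝ (Fin m)}
    (hu : u ∈ Metric.ball b.center b.radius) :
    ∃ G ∈ 𝓝 u, ∃ C : ℝ≥0, G ⊆ Metric.ball b.center b.radius ∧
      PreservesDirectionOn b.form (chartField b.chart V) b.field G C b.bound := by
  have hv : ContDiffAt ℝ 2 (chartField b.chart V) u :=
    contDiffAt_chartField (by norm_cast) b.mem_maximalAtlas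
      (b.isNormalForm.subset (b.ball_subset_region hu)) hV
  have hv' : ContDiffAt ℝ 1 (fderiv ℝ (chartField b.chart V)) u :=
    hv.fderiv_right (by norm_num)
  have hdiff : ∀ᶠ x in 𝓝 u, DifferentiableAt ℝ (chartField b.chart V) x :=
    (hv.eventually (by simp)).mono fun x hx ↦ hx.differentiableAt (by simp)
  obtain ⟨K, s, hs, hK⟩ := hv'.exists_lipschitzOnWith
  have hbound : ∀ᶠ x in 𝓝 u, ‖fderiv ℝ (chartField b.chart V) x‖ <
      ‖fderiv ℝ (chartField b.chart V) u‖ + 1 :=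
    hv'.continuousAt.norm.eventually_lt_const (lt_add_one _)
  obtain ⟨r, hr, hball⟩ := Metric.mem_nhds_iff.1
    (inter_mem (inter_mem hs (Metric.isOpen_ball.mem_nhds hu)) (hdiff.and hbound))
  refine ⟨Metric.ball u r, Metric.ball_mem_nhds u hr,
    K + (‖fderiv ℝ (chartField b.chart V) u‖₊ + 1), fun x hx ↦ (hball hx).1.2, ?_⟩
  exact
    { isOpen := Metric.isOpen_ball
      convex := convex_ball u r
      pos := by positivity
      differentiableAt := fun x hx ↦ (hball hx).2.1
      norm_fderiv_le := fun x hx ↦ (hball hx).2.2.le.trans (by simp)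
      lipschitzOnWith_fderiv := (hK.mono fun x hx ↦ (hball hx).1.1).weaken (by simp)
      differentiableAt_direction := fun x _ ↦ b.contDiff_field.differentiable (by simp) x
      norm_direction_le := fun x _ ↦ b.isTransverseFlow.norm_le x
      normalized := fun x _ ↦ b.isTransverseFlow.normalized x
      lieBracket_eq_smul := fun x hx ↦ b.isNormalForm.exists_lieBracket_chartField_eq_smul
        b.mem_maximalAtlas (hV.of_le (by norm_num)) hproj
        (b.ball_subset_region (hball hx).1.2) }

theorem exists_proj_evolution_eq (b : FlowBox N) (hV : IsVectorFieldOfClass 2 V)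
    (hproj : IsProjectable N V) (hφ : IsEvolutionOf φ V) {x₀ : M} (hx₀ : x₀ ∈ b.domain) :
    ∃ O ∈ 𝓝 x₀, ∃ δ > 0, (∀ x ∈ O, ∀ t ≤ δ, φ t x ∈ b.domain) ∧
      ∀ x ∈ O, ∀ y ∈ O, b.proj x = b.proj y → ∀ t ≤ δ, b.proj (φ t x) = b.proj (φ t y) := by
  obtain ⟨G, hG, C, hGb, hdir⟩ := b.exists_preservesDirectionOn hV hproj hx₀.2
  obtain ⟨O, hO, δ, hδ, hmem⟩ := exists_forall_flow_mem φ
    (inter_mem (b.chart.open_source.mem_nhds hx₀.1) (b.chart.continuousAt hx₀.1 hG))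
  obtain ⟨C₁, C₂, C₃, hest⟩ :=
    hdir.exists_norm_chart_evolution_sub_le b.mem_maximalAtlas hφ δ
  have hOsymm : b.chart.symm ⁻¹' O ∈ 𝓝 (b.chart x₀) :=
    b.chart.continuousAt_symm (b.chart.map_source hx₀.1) (by rwa [b.chart.left_inv hx₀.1])
  obtain ⟨r, hr, hball⟩ := Metric.mem_nhds_iff.1
    (inter_mem (b.chart.open_target.mem_nhds (b.chart.map_source hx₀.1)) hOsymm)
  obtain ⟨ρ, hρ, hflow⟩ := b.isTransverseFlow.exists_flow_mul_sub_mem_ball (b.chart x₀) hr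
  let O' : Set M := b.chart.source ∩ b.chart ⁻¹' Metric.ball (b.chart x₀) ρ
  have hO' : O' ∈ 𝓝 x₀ := (b.chart.isOpen_inter_preimage Metric.isOpen_ball).mem_nhds
    ⟨hx₀.1, Metric.mem_ball_self hρ⟩
  exact ⟨O ∩ O', inter_mem hO hO', δ, hδ,
    fun x hx t ht ↦ ⟨(hmem x hx.1 t ht).1, hGb (hmem x hx.1 t ht).2⟩,
    fun x hx y hy hxy t ht ↦ b.proj_map_eq_of_norm_sub_le
      (fun x hx y hy ↦ hest x y (hmem x hx) (hmem y hy) t ht) hx.2.1 hy.2.1 hxy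
      fun s hs ↦ hball (hflow _ hx.2.2 _ hy.2.2 s hs)⟩

theorem eventually_proj_evolution_eq (hbox : ∀ x, ∃ b : FlowBox N, x ∈ b.domain)
    (hV : IsVectorFieldOfClass 2 V) (hproj : IsProjectable N V) (hφ : IsEvolutionOf φ V)
    {γ : ℝ → M} {J : Set ℝ} (hJ : Convex ℝ J) (hγ : IsTangentCurveOn N γ J) {s₀ : ℝ}
    (hs₀ : s₀ ∈ J) (t : ℝ≥0) (b : FlowBox N) (hb : φ t (γ s₀) ∈ b.domain) :
    ∀ᶠ s in 𝓝[J] s₀, b.proj (φ t (γ s)) = b.proj (φ t (γ s₀)) := by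
  have hcont : ∀ t, ContinuousWithinAt (fun s ↦ φ t (γ s)) J s₀ := fun t ↦
    (φ.continuous_toFun t).continuousAt.comp_continuousWithinAt (hγ.continuousOn s₀ hs₀)
  refine forall_of_eventually_forall_add (Q := fun t ↦ ∀ b : FlowBox N, φ t (γ s₀) ∈ b.domain →
    ∀ᶠ s in 𝓝[J] s₀, b.proj (φ t (γ s)) = b.proj (φ t (γ s₀))) ?_ (fun t ↦ ?_) t b hb
  · intro b hb
    simp only [Flow.map_zero_apply] at hb ⊢
    exact (eventually_proj_eq_of_isTangentCurveOn hJ hγ hs₀ hb).mono fun s hs ↦ hs.2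
  · obtain ⟨b, hb⟩ := hbox (φ t (γ s₀))
    obtain ⟨O, hO, δ, hδ, hdom, hstep⟩ := b.exists_proj_evolution_eq hV hproj hφ hb
    have horbit : ∀ᶠ t₁ in 𝓝 t, O ∈ 𝓝 (φ t₁ (γ s₀)) :=
      (φ.continuous continuous_id continuous_const).continuousAt.eventually
        (eventually_mem_nhds_iff.2 hO)
    refine ⟨δ, hδ, horbit.mono fun t₁ ht₁ hQ s hs b' hb' ↦ ?_⟩
    have hO₁ := mem_of_mem_nhds ht₁
    rw [add_comm, Flow.map_add] at hb'
    simp only [add_comm t₁ s, Flow.map_add]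
    refine eventually_proj_eq_of_eventually_proj_eq (b := b)
      (γ := fun s' ↦ φ s (φ t₁ (γ s'))) ?_ ⟨hdom _ hO₁ s hs, hb'⟩ ?_
    · simpa only [Flow.map_add] using hcont (s + t₁)
    · filter_upwards [hQ b (by simpa using hdom _ hO₁ 0 zero_le), hcont t₁ ht₁] with s' hs' hs'O
      exact hstep _ hs'O _ hO₁ hs' _ hs

theorem leafSetoid_evolution (hbox : ∀ x, ∃ b : FlowBox N, x ∈ b.domain)
    (hV : IsVectorFieldOfClass 2 V) (hproj : IsProjectable N V) (hφ : IsEvolutionOf φ V)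
    (t : ℝ≥0) {x y : M} (hxy : leafSetoid N x y) : leafSetoid N (φ t x) (φ t y) := by
  have hxy' : Relation.EqvGen (JoinedByTangentArc N) x y := hxy
  induction hxy' with
  | rel x y h =>
    obtain ⟨γ, hγ, rfl, rfl, htan⟩ := h
    have hcurve := isTangentCurveOn_of_contMDiffOn hγ htan
    refine isPreconnected_Icc.induction₂ (s := Icc (0 : ℝ) 1)
      (fun s s' ↦ leafSetoid N (φ t (γ s)) (φ t (γ s'))) (fun s hs ↦ ?_)
      (fun _ _ _ _ _ _ h₁ h₂ ↦ (leafSetoid N).trans h₁ h₂) (fun _ _ _ _ h ↦ (leafSetoid N).symm h)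
      (by simp) (by simp)
    obtain ⟨b, hb⟩ := hbox (φ t (γ s))
    have hcont : ContinuousWithinAt (fun s ↦ φ t (γ s)) (Icc 0 1) s :=
      (φ.continuous_toFun t).continuousAt.comp_continuousWithinAt (hcurve.continuousOn s hs)
    filter_upwards [eventually_proj_evolution_eq hbox hV hproj hφ (convex_Icc _ _) hcurve hs t b hb,
      hcont (b.isOpen_domain.mem_nhds hb)] with s' hproj_eq hs'
    exact leafSetoid_rel hb hs' hproj_eq.symm
  | refl x => exact (leafSetoid N).refl _
  | symm x y h ih => exact (leafSetoid N).symm (ih h)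
  | trans x y z h₁ h₂ ih₁ ih₂ => exact (leafSetoid N).trans (ih₁ h₁) (ih₂ h₂)

end FlowBox

end Evolution

/-! ### The dimension bound -/

section NullFoliation

variable {m n k : ℕ} [NeZero n] {U : Type*} [TopologicalSpace U]
  [ChartedSpace (EuclideanSpace ℝ (Fin n)) U] [IsManifold (𝓡 n) ∞ U] (g : LorentzianMetric n U)

section

variable {M : Type*} [TopologicalSpace M] [ChartedSpace (EuclideanSpace ℝ (Fin m)) M]
  [IsManifold (𝓡 m) ∞ M] {ι : M → U}

theorem exists_flowBox_nullDistribution (hι : ContMDiff (𝓡 m) (𝓡 n) ∞ ι)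
    (hrank : ∀ x, Module.finrank ℝ (nullDistribution (m := m) g ι x) = 1) (x : M) :
    ∃ b : FlowBox (nullDistribution (m := m) g ι), x ∈ b.chart.source ∧ b.chart x = b.center := by
  have he : chartAt (EuclideanSpace ℝ (Fin m)) x ∈ IsManifold.maximalAtlas (𝓡 m) ∞ M :=
    IsManifold.chart_mem_maximalAtlas x
  obtain ⟨ℓ, w, O, hO, h⟩ :=
    exists_isNormalForm_nullDistribution g hι hrank he (mem_chart_target _ x)
  exact h.exists_flowBox he (mem_chart_source _ x) hO

theorem leafSetoid_nullDistribution_evolution [T2Space M] (hι : ContMDiff (𝓡 m) (𝓡 n) ∞ ι)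
    (hrank : ∀ x, Module.finrank ℝ (nullDistribution (m := m) g ι x) = 1)
    {V : ∀ x : M, TangentSpace (𝓡 m) x} {φ : Flow ℝ≥0 M}
    (hV : IsVectorFieldOfClass 2 V) (hφ : IsEvolutionOf φ V)
    (hproj : IsProjectable (nullDistribution (m := m) g ι) V) (t : ℝ≥0) {x y : M}
    (hxy : leafSetoid (nullDistribution (m := m) g ι) x y) :
    leafSetoid (nullDistribution (m := m) g ι) (φ t x) (φ t y) :=
  FlowBox.leafSetoid_evolution (fun x ↦ (exists_flowBox_nullDistribution g hι hrank x).imp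
    fun b hb ↦ (b.exists_isCompact_transversal hb.1 hb.2).1) hV hproj hφ t hxy

end

theorem theorem2_general (hk : 1 ≤ k) {M : Type*} [MetricSpace M] [SecondCountableTopology M]
    [ChartedSpace (EuclideanSpace ℝ (Fin m)) M] [IsManifold (𝓡 m) ∞ M] {ι : M → U}
    (hι : Manifold.IsImmersion (𝓡 m) (𝓡 n) ∞ ι)
    (hrank : ∀ x, Module.finrank ℝ (nullDistribution (m := m) g ι x) = k)
    {V : ∀ x : M, TangentSpace (𝓡 m) x} (hV : IsVectorFieldOfClass 2 V)
    {φ : Flow ℝ≥0 M} (hφ : IsEvolutionOf φ V)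
    (hac : IsAsymptoticallyCompact φ) (habs : HasBoundedAbsorbingSet φ)
    (hT2 : T2Space (LeafSpace (nullDistribution (m := m) g ι)))
    (hproj : IsProjectable (nullDistribution (m := m) g ι) V) :
    ∃ A : Set M, IsGlobalAttractor φ A ∧ (∀ A', IsGlobalAttractor φ A' → A' = A) ∧
      IsCompact (leafProj (nullDistribution (m := m) g ι) '' A) ∧
      (∃! ψ : Flow ℝ≥0 (LeafSpace (nullDistribution (m := m) g ι)),
        Flow.IsSemiconjugacy (leafProj (nullDistribution (m := m) g ι)) φ ψ) ∧
      (∀ ψ : Flow ℝ≥0 (LeafSpace (nullDistribution (m := m) g ι)),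
        Flow.IsSemiconjugacy (leafProj (nullDistribution (m := m) g ι)) φ ψ →
        ∀ t, ψ t '' (leafProj (nullDistribution (m := m) g ι) '' A) =
          leafProj (nullDistribution (m := m) g ι) '' A) ∧
      coveringDim (leafProj (nullDistribution (m := m) g ι) '' A) ≤ ((m - k : ℕ) : WithBot ℕ∞) := by
  obtain ⟨A, hA⟩ := exists_isGlobalAttractor hac habs
  have hAc : IsCompact (leafProj (nullDistribution (m := m) g ι) '' A) :=
    hA.isCompact.image continuous_quotient_mk'
  suffices (∀ t x y, leafSetoid (nullDistribution (m := m) g ι) x y →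
      leafSetoid (nullDistribution (m := m) g ι) (φ t x) (φ t y)) ∧
      CoveringDimLE (leafProj (nullDistribution (m := m) g ι) '' A) (m - k : ℕ) from
    ⟨A, hA, fun A' hA' ↦ hA.eq hA', hAc, existsUnique_isSemiconjugacy_quotient φ _ this.1,
      fun ψ hψ t ↦ image_image_eq_of_isSemiconjugacy hψ (hA.invariant t), sInf_le this.2⟩
  rcases isEmpty_or_nonempty M with hM | ⟨⟨x⟩⟩
  · have : IsEmpty (leafProj (nullDistribution (m := m) g ι) '' A) := by
      rw [isEmpty_coe_sort, image_eq_empty]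
      exact eq_empty_of_isEmpty A
    exact ⟨fun t x ↦ isEmptyElim x, coveringDimLE_of_isEmpty _ _⟩
  · obtain rfl : k = 1 := le_antisymm (hrank x ▸ finrank_nullDistribution_le_one g ι
      (mfderiv_injective_of_isImmersionAt (hι.isImmersionAt x))) hk
    have hι' := hι.contMDiff
    exact ⟨fun t x y ↦ leafSetoid_nullDistribution_evolution g hι' hrank hV hφ hproj t,
      (FlowBox.plaqueAtlas (exists_flowBox_nullDistribution g hι' hrank)).coveringDimLE hAc⟩

end NullFoliation

theorem theorem2 {m k : ℕ} (hk : 1 ≤ k)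
    -- the ambient Lorentzian phase space and the regular constraint function
    {U : Type*} [TopologicalSpace U] [T2Space U] [SecondCountableTopology U]
    [ChartedSpace (EuclideanSpace ℝ (Fin (m + 1))) U] [IsManifold (𝓡 (m + 1)) ∞ U]
    (g : LorentzianMetric (m + 1) U)
    (Φ : U → ℝ) (hΦ : ContMDiff (𝓡 (m + 1)) 𝓘(ℝ, ℝ) ∞ Φ)
    (hreg : ∀ p, Φ p = 0 → mfderiv (𝓡 (m + 1)) 𝓘(ℝ, ℝ) Φ p ≠ 0)
    -- the constraint manifold, embedded in `U` as the zero set of `Φ`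
    {M : Type*} [MetricSpace M] [ChartedSpace (EuclideanSpace ℝ (Fin m)) M]
    [IsManifold (𝓡 m) ∞ M]
    (ι : M → U) (hι : Manifold.IsSmoothEmbedding (𝓡 m) (𝓡 (m + 1)) ∞ ι)
    (hrange : Set.range ι = Φ ⁻¹' {0})
    -- the induced form has constant corank `k`
    (hrank : ∀ x, Module.finrank ℝ (nullDistribution (m := m) g ι x) = k)
    -- the intrinsic evolution
    (V : ∀ x : M, TangentSpace (𝓡 m) x) (hV : IsVectorFieldOfClass 2 V)
    (φ : Flow ℝ≥0 M) (hφ : IsEvolutionOf φ V)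
    (hac : IsAsymptoticallyCompact φ) (habs : HasBoundedAbsorbingSet φ)
    -- the null foliation
    (hinv : IsInvolutive (nullDistribution (m := m) g ι))
    (hcompact : ∀ x, IsCompact (leaf (nullDistribution (m := m) g ι) x))
    (hemb : ∀ x, IsEmbeddedSubmanifold (m := m) k (leaf (nullDistribution (m := m) g ι) x))
    (hT2 : T2Space (LeafSpace (nullDistribution (m := m) g ι)))
    (hproj : IsProjectable (nullDistribution (m := m) g ι) V) :
    -- the global attractor exists and is unique
    ∃ A : Set M, IsGlobalAttractor φ A ∧ (∀ A', IsGlobalAttractor φ A' → A' = A) ∧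
      -- its projection is compact
      IsCompact (leafProj (nullDistribution (m := m) g ι) '' A) ∧
      -- there is a unique reduced semiflow, and the projected attractor is invariant under it
      (∃! ψ : Flow ℝ≥0 (LeafSpace (nullDistribution (m := m) g ι)),
        Flow.IsSemiconjugacy (leafProj (nullDistribution (m := m) g ι)) φ ψ) ∧
      (∀ ψ : Flow ℝ≥0 (LeafSpace (nullDistribution (m := m) g ι)),
        Flow.IsSemiconjugacy (leafProj (nullDistribution (m := m) g ι)) φ ψ →
        ∀ t, ψ t '' (leafProj (nullDistribution (m := m) g ι) '' A) =
          leafProj (nullDistribution (m := m) g ι) '' A) ∧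
      -- the dimension bound
      coveringDim (leafProj (nullDistribution (m := m) g ι) '' A) ≤ ((m - k : ℕ) : WithBot ℕ∞) := by
  have := hι.isEmbedding.secondCountableTopology
  exact theorem2_general g hk hι.isImmersion hrank hV hφ hac habs hT2 hproj
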